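/- **Axioms.** Let $\mathbf{Ax}$ be a finite set of formulas $(A_1\to B_1)\vee\dots\vee(A_m\to B_m)$ with $m\ge 1$, where each $A_i$ is a conjunction of $n_i\ge 0$ propositional variables ($A_i=\top$ if $n_i=0$), each $B_i$ is a propositional variable, $\top$ or $\bot$, all the variables occurring in $A_1,\dots,A_m$ are distinct, and each of them is equal to some $B_l$. **Terms.** The proof terms of $\lambda_{\mathbf{Ax}}$ are those of the simply typed $\lambda$-calculus for intuitionistic propositional logic (variables $x^A$, $\mathsf{tt}:\top$, $\lambda x^A u$, $tu$, $\langle u,v\rangle$, $u\pi_0$, $u\pi_1$, $\iota_0(u)$, $\iota_1(u)$, $t[x^A.u,y^B.v]$, and $u\,\mathsf{efq}_P$ for $u:\bot$ and $P\ne\bot$ atomic) extended by (i) $a\,u:G$ for $u:F$ and a channel variable $a:F\to G$; (ii) $u\parallel v:C$ for $u,v:C$; (iii) sessions $_a(u_1\parallel\dots\parallel u_m):C$ for $u_1,\dots,u_m:C$ and a substitution instance $(F_1\to G_1)\vee\dots\vee(F_m\to G_m)$ of an element of $\mathbf{Ax}$; the channel $a$ is bound and has type $F_i\to G_i$ in $u_i$.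 Terms are taken up to renaming of bound variables. Every channel variable is either active or inactive; a session is active if its bound channel is. A term without $\parallel$ and without sessions is *simply typed*. A *parallel form* is a term built from simply typed terms by (ii) and (iii). A one-element stack $\xi$ is an argument $t$, a projection $\pi_i$, a case $[x.u,y.v]$ or $\mathsf{efq}_P$. Tuples $\langle t_1,\dots,t_n\rangle$ are iterated pairs, $\langle\,\rangle=\mathsf{tt}$ and $\langle t\rangle=t$. A *value* is an iterated pair, bracketed in any way, one of whose components has the form $\lambda x\,s$, $\iota_i(s)$, $s\,\mathsf{efq}_P$, $s[x.u,y.v]$ or $a\sigma$ with $a$ an active channel and $\sigma$ a sequence of one-element stacks. **Reduction.** $t\mapsto t'$ means that $t'$ is obtained from $t$ by one of the following contractions at a subterm. 1. *Intuitionistic reductions*: $(\lambda x\,u)t\mapsto u[t/x]$; $\langle u_0,u_1\rangle\pi_i\mapsto u_i$; $\iota_i(t)[x_0.u_0,x_1.u_1]\mapsto u_i[t/x_i]$; and case permutations $t[x.u,y.v]\xi\mapsto t[x.u\xi,y.v\xi]$. 2. *Parallel operator permutations*: $E[{}_a(u_1\parallel\dots\parallel u_m)]\mapsto{}_a(E[u_1]\parallel\dots\parallel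 E[u_m])$, where $E$ is any single term constructor other than $\parallel$ and sessions, with a hole in any argument place (including the branches of a case and the argument of a channel), and $a$ is not free in $E$; for an *active* session $_a(u_1\parallel\dots\parallel u_m)$ such that $u_1,\dots,u_m$ contain no active session and $u_i={}_b(w_1\parallel\dots\parallel w_n)$, the session is replaced by $_b(s_1\parallel\dots\parallel s_n)$, where $s_k$ is $_a(u_1\parallel\dots\parallel u_m)$ with $u_i$ replaced by $w_k$; and the same two permutations with the inner session replaced by some $v\parallel w$. 3. *Activation*: an inactive bound channel $a$ of a session that has an occurrence $a\,w$ with $w$ a value is renamed to a fresh active channel. 4. *Cross reductions that discard processes*: $_a(u_1\parallel\dots\parallel u_m)\mapsto u_{j_1}\parallel\dots\parallel u_{j_n}$ if $n\ge1$, $j_1<\dots<j_n$ and $a$ does not occur in $u_{j_1},\dots,u_{j_n}$. 5. *Basic cross reductions*, for an active session $_a(u_1\parallel\dots\parallel u_m)$: if $i\neq j$, $u_i=\mathcal C_i[a\,t]$ and $u_j=\mathcal C_j[a\,u]$ are simply typed, the displayed occurrences of $a$ are the rightmost ones, $t$ has no free variables, and $B_j$ is a variable that is the $q$-th conjunct of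 $A_i$, then $u_j$ is replaced by $\mathcal C_j[t']$, where $t'$ is the $q$-th component of $t$ viewed as an $n_i$-tuple ($t'=t$ if $n_i=1$). 6. *Cross reductions*, for an active session whose processes $u_i=\mathcal C_i[a\,t_i]$ are all simply typed, the displayed occurrences of $a$ being the rightmost ones: $_a(u_1\parallel\dots\parallel u_m)\mapsto{}_b(s_1\parallel\dots\parallel s_m)$, where $b$ is a fresh inactive channel and $s_i$ is the active session $_a(u_1\parallel\dots\parallel\mathcal C_i[r_i]\parallel\dots\parallel u_m)$. Here $\vec y_i$ is the sequence of the free variables of $t_i$ bound in $\mathcal C_i[a\,t_i]$, and $\ell_i$ is $b$ applied to the tuple of $n_i$ copies of $\langle\vec y_i\rangle$ (so $\ell_i=b\langle\vec y_i\rangle$ if $n_i=1$). If $B_i$ is a variable that is the $q$-th conjunct of some $A_j$, then $r_i$ is the $q$-th component of $t_j[\ell_i/\langle\vec y_j\rangle]$ viewed as an $n_j$-tuple, where $[\ell_i/\langle\vec y_j\rangle]$ replaces the $k$-th variable of $\vec y_j$ by the $k$-th projection of $\ell_i$; otherwise (in particular if $B_i=\bot$) $r_i=\ell_i$. The instance of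 the axiom for $b$ interprets the conjuncts of $A_j$ by the type of $\langle\vec y_j\rangle$, and all other variables as for $a$. A term is *normal* if no $t\mapsto t'$ is possible. **Master reduction strategy.** First bring the term into parallel form by parallel operator permutations. Then execute finitely many times the following round of three phases: apply intuitionistic reductions as long as possible; apply activation reductions as long as possible; apply as long as possible the following steps, at a session whose processes contain no active session, arriving at a term without active sessions: (a) for an active session, the permutation with an inner session or an inner $\parallel$; (b) for an active session of simply typed processes, a cross reduction (6), immediately followed by projections and case permutations until none is left; (c) a cross reduction (4). **Theorem (Normalization).** For every proof term $t:A$ of $\lambda_{\mathbf{Ax}}$, possibly with free variables of both sorts, there is a term $t'$ that is reached from $t$ in finitely many steps by following the master reduction strategy (in particular $t\mapsto^* t'$), such that $t':A$ in the same typing context and $t'$ is a normal parallel form. -/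

import Mathlib

/-! Typed concurrent lambda calculi extracted from disjunctive axioms.

Terms are written with two separate families of de Bruijn indices: one for intuitionistic variables
and one for channel variables. Renaming of bound variables is thereby built in, and "fresh" channels
are new binders. -/

namespace LamAx

/-- Propositional formulas; `¬ A` is `A → ⊥`. -/
inductive Ty : Type
  | var (p : ℕ)
  | top
  | bot
  | imp (A B : Ty)
  | and (A B : Ty)
  | or (A B : Ty)

/-- The right-nested conjunction of a list of formulas; it is `⊤` for the empty list. -/
def Ty.conj : List Ty → Ty
  | [] => .top
  | [A] => A
  | A :: B :: l => .and A (Ty.conj (B :: l))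

/-- The formulas that ex falso may conclude: the atomic ones except `⊥`. -/
def Ty.IsEfqAtom : Ty → Prop
  | .var _ => True
  | .top => True
  | _ => False

/-- The succedent of a disjunct: a propositional variable, `⊤` or `⊥`. -/
inductive Atom : Type
  | var (p : ℕ)
  | top
  | bot

/-- Instance of a succedent under an assignment of formulas to propositional variables. -/
def Atom.inst (s : ℕ → Ty) : Atom → Ty
  | .var p => s p
  | .top => .top
  | .bot => .bot

/-- A disjunction `(A₁ → B₁) ∨ ⋯ ∨ (Aₘ → Bₘ)`. The antecedent `Aᵢ` is the conjunction of the
propositional variables in the list `ante i` (so it is `⊤` if the list is empty). -/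
structure DisjAxiom : Type where
  m : ℕ
  ante : Fin m → List ℕ
  succ : Fin m → Atom

/-- The admitted class: there is at least one disjunct, the variables occurring in the antecedents
are all distinct, and each of them is one of the succedents. -/
structure DisjAxiom.Admissible (ax : DisjAxiom) : Prop where
  pos : 0 < ax.m
  nodup : ∀ i, (ax.ante i).Nodup
  disjoint : ∀ i j, i ≠ j → List.Disjoint (ax.ante i) (ax.ante j)
  covered : ∀ i, ∀ p ∈ ax.ante i, ∃ j, ax.succ j = .var p

/-- The formula `Aᵢ` of an instance of the axiom. -/
def DisjAxiom.dom (ax : DisjAxiom) (s : ℕ → Ty) (i : Fin ax.m) : Ty :=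
  Ty.conj ((ax.ante i).map s)

/-- The formula `Bᵢ` of an instance of the axiom. -/
def DisjAxiom.cod (ax : DisjAxiom) (s : ℕ → Ty) (i : Fin ax.m) : Ty :=
  (ax.succ i).inst s

/-- The index of the disjunct in whose antecedent the variable `p` occurs, if there is one.
(There is at most one if the axiom is admissible.) -/
def DisjAxiom.source (ax : DisjAxiom) (p : ℕ) : Option (Fin ax.m) :=
  (List.finRange ax.m).find? (fun j => decide (p ∈ ax.ante j))

/-- Proof terms. In `proj`, `false` and `true` stand for the projections `π₀` and `π₁`; in `inj`
they stand for the injections `ι₀` and `ι₁`, annotated with the other disjunct of the type.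
`case A B t u v` is `t [x^A.u, y^B.v]`, where `u` and `v` bind one intuitionistic variable each.
`chan k t` is `a t` for the channel variable `a` with index `k`. `par u v` is the parallel operator
typed by contraction. `ses ax s act us` is the session `ₐ(u₁ ∥ ⋯ ∥ uₘ)` typed by the instance of the
axiom `ax` under the assignment `s`; it binds the channel `a` in every `us i`, and `act` tells whether
`a` is an active channel variable. -/
inductive Tm : Type
  | var (n : ℕ)
  | tt
  | lam (A : Ty) (u : Tm)
  | app (t u : Tm)
  | pair (u v : Tm)
  | proj (i : Bool) (u : Tm)
  | inj (i : Bool) (C : Ty) (u : Tm)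
  | case (A B : Ty) (t u v : Tm)
  | efq (P : Ty) (u : Tm)
  | chan (k : ℕ) (t : Tm)
  | par (u v : Tm)
  | ses (ax : DisjAxiom) (s : ℕ → Ty) (act : Bool) (us : Fin ax.m → Tm)

/-- Extension of an environment by a value for the newly bound index `0`. -/
def cons {X : Type} (x : X) (f : ℕ → X) : ℕ → X
  | 0 => x
  | n + 1 => f n

/-- The type assignment. `Γ` gives the types of the free intuitionistic variables; `Δ k = (A, B)`
says that the free channel variable with index `k` has type `A → B`. -/
inductive HasType (Ax : Finset DisjAxiom) :
    (ℕ → Ty) → (ℕ → Ty × Ty) → Tm → Ty → Prop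
  | var (Γ Δ n) : HasType Ax Γ Δ (.var n) (Γ n)
  | tt (Γ Δ) : HasType Ax Γ Δ .tt .top
  | lam {Γ Δ A B u} : HasType Ax (cons A Γ) Δ u B → HasType Ax Γ Δ (.lam A u) (.imp A B)
  | app {Γ Δ A B t u} : HasType Ax Γ Δ t (.imp A B) → HasType Ax Γ Δ u A →
      HasType Ax Γ Δ (.app t u) B
  | pair {Γ Δ A B u v} : HasType Ax Γ Δ u A → HasType Ax Γ Δ v B →
      HasType Ax Γ Δ (.pair u v) (.and A B)
  | fst {Γ Δ A B u} : HasType Ax Γ Δ u (.and A B) → HasType Ax Γ Δ (.proj false u) A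
  | snd {Γ Δ A B u} : HasType Ax Γ Δ u (.and A B) → HasType Ax Γ Δ (.proj true u) B
  | inl {Γ Δ A B u} : HasType Ax Γ Δ u A → HasType Ax Γ Δ (.inj false B u) (.or A B)
  | inr {Γ Δ A B u} : HasType Ax Γ Δ u B → HasType Ax Γ Δ (.inj true A u) (.or A B)
  | case {Γ Δ A B C t u v} : HasType Ax Γ Δ t (.or A B) →
      HasType Ax (cons A Γ) Δ u C → HasType Ax (cons B Γ) Δ v C →
      HasType Ax Γ Δ (.case A B t u v) C
  | efq {Γ Δ P u} : P.IsEfqAtom → HasType Ax Γ Δ u .bot → HasType Ax Γ Δ (.efq P u) P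
  | chan {Γ Δ t} (k : ℕ) : HasType Ax Γ Δ t (Δ k).1 → HasType Ax Γ Δ (.chan k t) (Δ k).2
  | par {Γ Δ A u v} : HasType Ax Γ Δ u A → HasType Ax Γ Δ v A → HasType Ax Γ Δ (.par u v) A
  | ses {Γ Δ C ax s act us} : ax ∈ Ax →
      (∀ i, HasType Ax Γ (cons (ax.dom s i, ax.cod s i) Δ) (us i) C) →
      HasType Ax Γ Δ (.ses ax s act us) C

/-! ### Renaming and substitution -/

/-- A renaming extended to a scope with one more bound variable. -/
def liftRen (r : ℕ → ℕ) : ℕ → ℕ := cons 0 (fun n => r n + 1)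

/-- Exchange of the two innermost indices. -/
def swapRen : ℕ → ℕ
  | 0 => 1
  | 1 => 0
  | n + 2 => n + 2

/-- Simultaneous renaming of intuitionistic variables (by `r`) and channel variables (by `c`). -/
def Tm.ren (r c : ℕ → ℕ) : Tm → Tm
  | .var n => .var (r n)
  | .tt => .tt
  | .lam A u => .lam A (u.ren (liftRen r) c)
  | .app t u => .app (t.ren r c) (u.ren r c)
  | .pair u v => .pair (u.ren r c) (v.ren r c)
  | .proj i u => .proj i (u.ren r c)
  | .inj i C u => .inj i C (u.ren r c)
  | .case A B t u v => .case A B (t.ren r c) (u.ren (liftRen r) c) (v.ren (liftRen r) c)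
  | .efq P u => .efq P (u.ren r c)
  | .chan k t => .chan (c k) (t.ren r c)
  | .par u v => .par (u.ren r c) (v.ren r c)
  | .ses ax s act us => .ses ax s act (fun i => (us i).ren r (liftRen c))

/-- Capture-avoiding substitution of terms for intuitionistic variables. -/
def Tm.sub (e : ℕ → Tm) : Tm → Tm
  | .var n => e n
  | .tt => .tt
  | .lam A u => .lam A (u.sub (cons (.var 0) (fun n => (e n).ren Nat.succ id)))
  | .app t u => .app (t.sub e) (u.sub e)
  | .pair u v => .pair (u.sub e) (v.sub e)
  | .proj i u => .proj i (u.sub e)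
  | .inj i C u => .inj i C (u.sub e)
  | .case A B t u v => .case A B (t.sub e)
      (u.sub (cons (.var 0) (fun n => (e n).ren Nat.succ id)))
      (v.sub (cons (.var 0) (fun n => (e n).ren Nat.succ id)))
  | .efq P u => .efq P (u.sub e)
  | .chan k t => .chan k (t.sub e)
  | .par u v => .par (u.sub e) (v.sub e)
  | .ses ax s act us => .ses ax s act (fun i => (us i).sub (fun n => (e n).ren id Nat.succ))

/-- `u[t/x]`, where `x` is the innermost intuitionistic variable of `u`. -/
def Tm.inst (u t : Tm) : Tm := u.sub (cons t Tm.var)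

/-! ### Occurrences and shapes of terms -/

/-- The intuitionistic variable with index `n` occurs free. -/
def HasVar : ℕ → Tm → Prop
  | n, .var k => k = n
  | _, .tt => False
  | n, .lam _ u => HasVar (n + 1) u
  | n, .app t u => HasVar n t ∨ HasVar n u
  | n, .pair u v => HasVar n u ∨ HasVar n v
  | n, .proj _ u => HasVar n u
  | n, .inj _ _ u => HasVar n u
  | n, .case _ _ t u v => HasVar n t ∨ HasVar (n + 1) u ∨ HasVar (n + 1) v
  | n, .efq _ u => HasVar n u
  | n, .chan _ t => HasVar n t
  | n, .par u v => HasVar n u ∨ HasVar n v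
  | n, .ses _ _ _ us => ∃ i, HasVar n (us i)

/-- The channel variable with index `k` occurs free. -/
def HasChan : ℕ → Tm → Prop
  | _, .var _ => False
  | _, .tt => False
  | k, .lam _ u => HasChan k u
  | k, .app t u => HasChan k t ∨ HasChan k u
  | k, .pair u v => HasChan k u ∨ HasChan k v
  | k, .proj _ u => HasChan k u
  | k, .inj _ _ u => HasChan k u
  | k, .case _ _ t u v => HasChan k t ∨ HasChan k u ∨ HasChan k v
  | k, .efq _ u => HasChan k u
  | k, .chan l t => l = k ∨ HasChan k t
  | k, .par u v => HasChan k u ∨ HasChan k v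
  | k, .ses _ _ _ us => ∃ i, HasChan (k + 1) (us i)

/-- A term without free variables of either sort. -/
def Closed (t : Tm) : Prop := (∀ n, ¬ HasVar n t) ∧ (∀ k, ¬ HasChan k t)

/-- The simply typed lambda terms: those in which no parallel operator occurs. -/
def Simple : Tm → Prop
  | .var _ => True
  | .tt => True
  | .lam _ u => Simple u
  | .app t u => Simple t ∧ Simple u
  | .pair u v => Simple u ∧ Simple v
  | .proj _ u => Simple u
  | .inj _ _ u => Simple u
  | .case _ _ t u v => Simple t ∧ Simple u ∧ Simple v
  | .efq _ u => Simple u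
  | .chan _ t => Simple t
  | .par _ _ => False
  | .ses _ _ _ _ => False

/-- No active session occurs in the term. -/
def NoActive : Tm → Prop
  | .var _ => True
  | .tt => True
  | .lam _ u => NoActive u
  | .app t u => NoActive t ∧ NoActive u
  | .pair u v => NoActive u ∧ NoActive v
  | .proj _ u => NoActive u
  | .inj _ _ u => NoActive u
  | .case _ _ t u v => NoActive t ∧ NoActive u ∧ NoActive v
  | .efq _ u => NoActive u
  | .chan _ t => NoActive t
  | .par u v => NoActive u ∧ NoActive v
  | .ses _ _ act us => act = false ∧ ∀ i, NoActive (us i)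

/-- Parallel forms: simply typed lambda terms combined by parallel operators. -/
inductive ParallelForm : Tm → Prop
  | simple {t} : Simple t → ParallelForm t
  | par {u v} : ParallelForm u → ParallelForm v → ParallelForm (.par u v)
  | ses {ax s act us} : (∀ i, ParallelForm (us i)) → ParallelForm (.ses ax s act us)

/-- The term has the form `a σ` for an active channel `a` and a stack `σ`. Here, as below,
`α : ℕ → Bool` tells which free channel variables are active. -/
def ActiveHead (α : ℕ → Bool) : Tm → Prop
  | .chan k _ => α k = true
  | .app t _ => ActiveHead α t
  | .proj _ t => ActiveHead α t
  | .case _ _ t _ _ => ActiveHead α t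
  | .efq _ t => ActiveHead α t
  | _ => False

/-- Values: tuples some component of which is an abstraction, an injection, an ex falso, a case
distinction or of the form `a σ` with `a` active. -/
def IsValue (α : ℕ → Bool) : Tm → Prop
  | .pair u v => IsValue α u ∨ IsValue α v
  | .lam _ _ => True
  | .inj _ _ _ => True
  | .efq _ _ => True
  | .case _ _ _ _ _ => True
  | t => ActiveHead α t

/-- Some occurrence of the free channel with index `k` is applied to a value. -/
def Activable : (ℕ → Bool) → ℕ → Tm → Prop
  | _, _, .var _ => False
  | _, _, .tt => False
  | α, k, .lam _ u => Activable α k u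
  | α, k, .app t u => Activable α k t ∨ Activable α k u
  | α, k, .pair u v => Activable α k u ∨ Activable α k v
  | α, k, .proj _ u => Activable α k u
  | α, k, .inj _ _ u => Activable α k u
  | α, k, .case _ _ t u v => Activable α k t ∨ Activable α k u ∨ Activable α k v
  | α, k, .efq _ u => Activable α k u
  | α, k, .chan l t => (l = k ∧ IsValue α t) ∨ Activable α k t
  | α, k, .par u v => Activable α k u ∨ Activable α k v
  | α, k, .ses _ _ act us => ∃ i, Activable (cons act α) (k + 1) (us i)

/-! ### One-element stacks, frames and simple contexts -/

/-- The one-element stacks. -/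
inductive Elim : Type
  | arg (u : Tm)
  | proj (i : Bool)
  | case (A B : Ty) (u v : Tm)
  | efq (P : Ty)

/-- `t ξ` -/
def Elim.plug : Elim → Tm → Tm
  | .arg u, t => .app t u
  | .proj i, t => .proj i t
  | .case A B u v, t => .case A B t u v
  | .efq P, t => .efq P t

def Elim.ren (r c : ℕ → ℕ) : Elim → Elim
  | .arg u => .arg (u.ren r c)
  | .proj i => .proj i
  | .case A B u v => .case A B (u.ren (liftRen r) c) (v.ren (liftRen r) c)
  | .efq P => .efq P

/-- Term constructors other than the parallel operators, with a hole in one argument place. -/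
inductive Frame : Type
  | elim (ξ : Elim)
  | appR (w : Tm)
  | lam (A : Ty)
  | inj (i : Bool) (C : Ty)
  | pairL (w : Tm)
  | pairR (w : Tm)
  | caseL (A B : Ty) (t v : Tm)
  | caseR (A B : Ty) (t u : Tm)
  | chan (k : ℕ)

/-- Fill the hole, without renaming of the variable that the frame binds. -/
def Frame.plug : Frame → Tm → Tm
  | .elim ξ, t => ξ.plug t
  | .appR w, t => .app w t
  | .lam A, t => .lam A t
  | .inj i C, t => .inj i C t
  | .pairL w, t => .pair t w
  | .pairR w, t => .pair w t
  | .caseL A B s v, t => .case A B s t v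
  | .caseR A B s u, t => .case A B s u t
  | .chan k, t => .chan k t

/-- Renaming of the channel variables of a frame. -/
def Frame.renChan (c : ℕ → ℕ) : Frame → Frame
  | .elim ξ => .elim (ξ.ren id c)
  | .appR w => .appR (w.ren id c)
  | .lam A => .lam A
  | .inj i C => .inj i C
  | .pairL w => .pairL (w.ren id c)
  | .pairR w => .pairR (w.ren id c)
  | .caseL A B s v => .caseL A B (s.ren id c) (v.ren id c)
  | .caseR A B s u => .caseR A B (s.ren id c) (u.ren id c)
  | .chan k => .chan (c k)

/-- The types of the variables that the frame binds in its hole (at most one). -/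
def Frame.binds : Frame → List Ty
  | .lam A => [A]
  | .caseL A _ _ _ => [A]
  | .caseR _ B _ _ => [B]
  | _ => []

/-- The channel with index `k` occurs in the frame to the right of the hole. -/
def Frame.HasChanRight (k : ℕ) : Frame → Prop
  | .elim (.arg u) => HasChan k u
  | .elim (.case _ _ u v) => HasChan k u ∨ HasChan k v
  | .pairL w => HasChan k w
  | .caseL _ _ _ v => HasChan k v
  | _ => False

/-- Contexts with one hole that is not below a parallel operator, as lists of frames, the outermost
one first. A simple context is one whose filling by a simply typed lambda term is simply typed. -/
abbrev Ctx : Type := List Frame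

def Ctx.plug (K : Ctx) (t : Tm) : Tm := K.foldr Frame.plug t

def Ctx.renChan (c : ℕ → ℕ) (K : Ctx) : Ctx := K.map (Frame.renChan c)

/-- The types of the variables bound at the hole, by index: the innermost one comes first. -/
def Ctx.binds : Ctx → List Ty
  | [] => []
  | F :: K => Ctx.binds K ++ F.binds

/-- `u = C[a t]` is a simply typed lambda term, where `a` is the channel with index `0`, and the
displayed occurrence of `a` is the rightmost one. -/
def RightmostSend (u : Tm) (K : Ctx) (t : Tm) : Prop :=
  u = K.plug (.chan 0 t) ∧ Simple u ∧ ¬ HasChan 0 t ∧ ∀ F ∈ K, ¬ F.HasChanRight 0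

/-! ### Tuples -/

/-- `⟨t₁, …, tₙ⟩`, right-nested, which is `tt` for `n = 0`. -/
def tuple : List Tm → Tm
  | [] => .tt
  | [t] => t
  | t :: u :: l => .pair t (tuple (u :: l))

/-- The projection of `t`, seen as a tuple of length `n`, to its component number `q` (from `0`). -/
def tupleProj (n q : ℕ) (t : Tm) : Tm :=
  if q + 1 = n then (Tm.proj true)^[q] t else .proj false ((Tm.proj true)^[q] t)

/-- `t₁ ∥ ⋯ ∥ tₙ` by contraction, for a nonempty list. -/
def parList : List Tm → Tm
  | [] => .tt
  | [t] => t
  | t :: u :: l => .par t (parList (u :: l))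

/-! ### Basic reductions -/

/-- Application and injection redexes. -/
inductive LogicalRule : Tm → Tm → Prop
  | beta (A u t) : LogicalRule (.app (.lam A u) t) (u.inst t)
  | caseL (A B C t u v) : LogicalRule (.case A B (.inj false C t) u v) (u.inst t)
  | caseR (A B C t u v) : LogicalRule (.case A B (.inj true C t) u v) (v.inst t)

/-- Projection and case permutation redexes. -/
inductive StructRule : Tm → Tm → Prop
  | fst (u v) : StructRule (.proj false (.pair u v)) u
  | snd (u v) : StructRule (.proj true (.pair u v)) v
  | perm (A B t u v) (ξ : Elim) :
      StructRule (ξ.plug (.case A B t u v))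
        (.case A B t ((ξ.ren Nat.succ id).plug u) ((ξ.ren Nat.succ id).plug v))

/-- Intuitionistic reductions and disjunction permutations. -/
def IntRule (t t' : Tm) : Prop := LogicalRule t t' ∨ StructRule t t'

/-- Permutation of an active session with a parallel operator inside one of its processes, if the
processes contain no active sessions. -/
inductive ScopeRule : Tm → Tm → Prop
  | ses (ax s us) (i : Fin ax.m) (ax' s' act' ws) :
      us i = .ses ax' s' act' ws → (∀ l, NoActive (us l)) →
      ScopeRule (.ses ax s true us)
        (.ses ax' s' act' (fun k => .ses ax s true (fun l =>
          if l = i then (ws k).ren id swapRen else (us l).ren id (liftRen Nat.succ))))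
  | par (ax s us) (i : Fin ax.m) (v w) :
      us i = .par v w → (∀ l, NoActive (us l)) →
      ScopeRule (.ses ax s true us)
        (.par (.ses ax s true (Function.update us i v)) (.ses ax s true (Function.update us i w)))

/-- Parallel operator permutations. The indices of the free channel variables of the frame are
shifted, so the channel of the session does not occur free in the frame. -/
inductive PermRule : Tm → Tm → Prop
  | ses (F : Frame) (ax s act us) :
      PermRule (F.plug (.ses ax s act us))
        (.ses ax s act (fun i => (F.renChan Nat.succ).plug (us i)))
  | par (F : Frame) (u v) : PermRule (F.plug (.par u v)) (.par (F.plug u) (F.plug v))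
  | scope {t t'} : ScopeRule t t' → PermRule t t'

/-- Activation reduction: an inactive bound channel that is applied to some value in some process is
renamed to an active one. -/
inductive ActRule (α : ℕ → Bool) : Tm → Tm → Prop
  | act (ax s us) : (∃ i, Activable (cons false α) 0 (us i)) →
      ActRule α (.ses ax s false us) (.ses ax s true us)

/-- Basic cross reduction: the process `i` sends the closed message `t` to the process `j`; the
succedent `p` of the latter is the conjunct number `(ax.ante i).idxOf p` of the antecedent of the
former (if it is the only conjunct, `t` itself is received). -/
inductive BasicCrossRule : Tm → Tm → Prop
  | send (ax s us) (i j : Fin ax.m) (p : ℕ) (K K' t u) :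
      i ≠ j → p ∈ ax.ante i → ax.succ j = .var p →
      RightmostSend (us i) K t → RightmostSend (us j) K' u → Closed t →
      BasicCrossRule (.ses ax s true us)
        (.ses ax s true
          (Function.update us j (K'.plug (tupleProj (ax.ante i).length ((ax.ante i).idxOf p) t))))

/-- Cross reduction that keeps some processes in which the channel does not occur. -/
inductive EraseRule : Tm → Tm → Prop
  | erase (ax s act us) (l : List (Fin ax.m)) : l ≠ [] → l.Pairwise (· < ·) →
      (∀ j ∈ l, ¬ HasChan 0 (us j)) →
      EraseRule (.ses ax s act us) (parList (l.map (fun j => (us j).ren id Nat.pred)))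

open Classical in
/-- The sequence `y` of the free variables of `t` that are bound in `C[a t]`. -/
noncomputable def captured (K : Ctx) (t : Tm) : List ℕ :=
  (List.range K.binds.length).filter (fun n => decide (HasVar n t))

/-- The type of the tuple of the variables `captured K t`. -/
noncomputable def capturedTy (K : Ctx) (t : Tm) : Ty :=
  Ty.conj ((captured K t).map (fun n => K.binds.getD n .top))

/-- The assignment for the new session of a cross reduction: the variables in the antecedent of the
disjunct `j` are interpreted by the type of `⟨yⱼ⟩`, all other variables as before. -/
noncomputable def crossAssign (ax : DisjAxiom) (s : ℕ → Ty) (K : Fin ax.m → Ctx)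
    (t : Fin ax.m → Tm) (p : ℕ) : Ty :=
  match ax.source p with
  | some j => capturedTy (K j) (t j)
  | none => s p

/-- The term `bᵢ ⟨yᵢ⟩` in the scope of the hole of the context of the process `i`. The new channel
`b` has index `1` there. If the antecedent has `n` conjuncts, `b` is applied to the `n`-tuple of
copies of `⟨yᵢ⟩`, which is `⟨yᵢ⟩` for `n = 1` and `tt` for `n = 0`. -/
noncomputable def crossLink (ax : DisjAxiom) (K : Fin ax.m → Ctx) (t : Fin ax.m → Tm)
    (i : Fin ax.m) : Tm :=
  .chan 1 (tuple (List.replicate (ax.ante i).length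
    (tuple ((captured (K i) (t i)).map Tm.var))))

/-- The message `tⱼ` in the scope of the hole of the context of the process `i`, with the variables
`yⱼ` replaced by the projections of `bᵢ ⟨yᵢ⟩`. The variables of `tⱼ` not bound in its context are
reindexed for the new place. -/
noncomputable def crossMessage (ax : DisjAxiom) (K : Fin ax.m → Ctx) (t : Fin ax.m → Tm)
    (i j : Fin ax.m) : Tm :=
  ((t j).ren id (liftRen Nat.succ)).sub (fun n =>
    if n < (K j).binds.length then
      tupleProj (captured (K j) (t j)).length ((captured (K j) (t j)).idxOf n)
        (crossLink ax K t i)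
    else .var (n - (K j).binds.length + (K i).binds.length))

/-- What replaces `a tᵢ` in the process `i`: the message of the process `j` whose antecedent has the
succedent of `i` among its conjuncts (projected to that conjunct if there are several), and `bᵢ ⟨yᵢ⟩`
if there is no such `j`, in particular if the succedent of `i` is `⊥`. -/
noncomputable def crossReceived (ax : DisjAxiom) (K : Fin ax.m → Ctx) (t : Fin ax.m → Tm)
    (i : Fin ax.m) : Tm :=
  match ax.succ i with
  | .var p =>
    match ax.source p with
    | some j => tupleProj (ax.ante j).length ((ax.ante j).idxOf p) (crossMessage ax K t i j)
    | none => crossLink ax K t i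
  | _ => crossLink ax K t i

/-- The result `b(s₁ ∥ ⋯ ∥ sₘ)` of a cross reduction; the new channel `b` is inactive. -/
noncomputable def crossResult (ax : DisjAxiom) (s : ℕ → Ty) (K : Fin ax.m → Ctx)
    (t : Fin ax.m → Tm) : Tm :=
  .ses ax (crossAssign ax s K t) false (fun i => .ses ax s true (fun k =>
    if k = i then ((K i).renChan (liftRen Nat.succ)).plug (crossReceived ax K t i)
    else ((K k).plug (.chan 0 (t k))).ren id (liftRen Nat.succ)))

/-- Cross reduction by which all processes of an active session communicate at once. -/
inductive CrossRule : Tm → Tm → Prop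
  | cross (ax s us) (K : Fin ax.m → Ctx) (t : Fin ax.m → Tm) :
      (∀ i, RightmostSend (us i) (K i) (t i)) →
      CrossRule (.ses ax s true us) (crossResult ax s K t)

/-- All basic reductions. -/
def Rule (α : ℕ → Bool) (t t' : Tm) : Prop :=
  IntRule t t' ∨ PermRule t t' ∨ ActRule α t t' ∨ BasicCrossRule t t' ∨ EraseRule t t' ∨
    CrossRule t t'

/-! ### Reduction -/

/-- The closure of a relation under all term constructors. -/
inductive Inside (R : (ℕ → Bool) → Tm → Tm → Prop) : (ℕ → Bool) → Tm → Tm → Prop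
  | root {α t t'} : R α t t' → Inside R α t t'
  | frame {α t t'} (F : Frame) : Inside R α t t' → Inside R α (F.plug t) (F.plug t')
  | parL {α t t'} (u) : Inside R α t t' → Inside R α (.par t u) (.par t' u)
  | parR {α t t'} (u) : Inside R α t t' → Inside R α (.par u t) (.par u t')
  | ses {α t'} (ax s act us) (i : Fin ax.m) : Inside R (cons act α) (us i) t' →
      Inside R α (.ses ax s act us) (.ses ax s act (Function.update us i t'))

/-- One-step reduction. -/
def Step : (ℕ → Bool) → Tm → Tm → Prop := Inside Rule

/-- Reduction in finitely many steps. -/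
def Steps (α : ℕ → Bool) : Tm → Tm → Prop := Relation.ReflTransGen (Step α)

def Normal (α : ℕ → Bool) (t : Tm) : Prop := ∀ t', ¬ Step α t t'

/-! ### The master reduction strategy -/

/-- Apply `R` as long as possible. -/
def Exhaust (R : Tm → Tm → Prop) (t t' : Tm) : Prop :=
  Relation.ReflTransGen R t t' ∧ ∀ u, ¬ R t' u

/-- Projections and case permutations anywhere in a term. -/
def StructStep (α : ℕ → Bool) : Tm → Tm → Prop := Inside (fun _ => StructRule) α

/-- The side reduction strategy at a session whose processes contain no active sessions: permute an
active session outwards; or perform a cross reduction on an active session of simply typed lambda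
terms, followed by all projections and case permutations; or remove a session by a cross reduction
that keeps processes in which its channel does not occur. -/
inductive SideRule (α : ℕ → Bool) : Tm → Tm → Prop
  | scope {t t'} : ScopeRule t t' → SideRule α t t'
  | cross {t t' t''} : CrossRule t t' → Exhaust (StructStep α) t' t'' → SideRule α t t''
  | erase {ax s act us t'} : (∀ i, NoActive (us i)) → EraseRule (.ses ax s act us) t' →
      SideRule α (.ses ax s act us) t'

/-- One round of the three phases. -/
def Round (α : ℕ → Bool) (t t' : Tm) : Prop :=
  ∃ u v, Exhaust (Inside (fun _ => IntRule) α) t u ∧ Exhaust (Inside ActRule α) u v ∧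
    Exhaust (Inside SideRule α) v t' ∧ NoActive t'

/-- `t'` is reached from `t` by the master reduction strategy: `t` is first brought into parallel
form by permutations, then finitely many rounds of the three phases are executed. -/
def Master (α : ℕ → Bool) (t t' : Tm) : Prop :=
  ∃ u, Relation.ReflTransGen (Inside (fun _ => PermRule) α) t u ∧ ParallelForm u ∧
    Relation.ReflTransGen (Round α) u t'

end LamAx

namespace LamAx

/-! ### Rank bounds -/

/-! Every round of the strategy lowers by one a bound on the ranks of the logical redexes. Between
rounds the term is a `Tree` of parallel operators whose leaves satisfy `Comm τ`. Such a leaf has no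
projection or permutation redex, and each application or injection redex has rank at most `τ`. Among
the channels bound in the tree, an active one carries messages whose abstractions and injections
have rank at most `τ`, and an inactive one carries no value. After a round no session is active.
Channels free in the whole term can never be activated or communicate, so their messages are
unconstrained; the predicate `R` singles out the bound ones.

Why the bound falls from `τ + 1` to `τ`: at the start of the round all bound channels are inactive,
so no message is a value. Contracting a redex of rank at most `τ + 1` substitutes terms whose types
have rank at most `τ`, and the result of a contracted application has such a type as well.
Hereditary substitution (`subNormalizes`) therefore reaches intuitionistic normal leaves in which
every abstraction or injection that has entered a message has rank at most `τ` (`Tame.exists_nf`).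
Activation changes only the marks of the sessions; once it is exhausted, the channels still inactive
carry no values (`Tree.comm_of_exhausted`). A cross reduction puts a message with values of rank at
most `τ` in place of an application of the active channel, so the logical redexes it creates have
rank at most `τ` (`exists_replaces`, `exists_crossResult`). The new links `b⟨y⟩` carry only tuples
of variables, so `b` may stay inactive. The clause `a σ` in the definition of values is what
protects the other inactive channels: a component of a message headed by the active channel already
counts as a value, so receiving something there cannot turn a non-value into a value.

Communication terminates because the rightmost occurrences are used. Nothing to the right of the
replaced occurrence contains the channel, so case permutations duplicate no occurrence of it, and
the messages do not contain it either. Hence each new active session has fewer occurrences in total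
(`communicates_simple`). Parallel operators inside an active session are first moved out of it
(`communicates_ses`), and nested active sessions are treated from the inside out
(`Tree.communicates`).

At `τ = 0` no logical redex is left, since implications and disjunctions have positive rank. There
are no active sessions, no inactive channel carries a value, and sessions with an idle process have
been erased, so no rule applies (`Tree.normal`). The descent starts because every typed term
permutes to a parallel form (`HasType.toParallel`), whose finitely many leaves have normal forms
with a common bound (`ParallelForm.exists_nf`). Each phase is shown to have one suitable terminating
reduction sequence; strong normalization is not needed. -/

/-- The number of connectives of a formula. -/
def Ty.rank : Ty → ℕ
  | .imp A B => A.rank + B.rank + 1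
  | .and A B => A.rank + B.rank + 1
  | .or A B => A.rank + B.rank + 1
  | _ => 0

/-- The abstractions and injections among the components of `t : T`, also those in the branches of
case distinctions, have types of rank at most `N`. -/
def ValueLE (N : ℕ) : Tm → Ty → Prop
  | .lam _ _, T => T.rank ≤ N
  | .inj _ _ _, T => T.rank ≤ N
  | .pair u v, .and A B => ValueLE N u A ∧ ValueLE N v B
  | .case _ _ _ u v, T => ValueLE N u T ∧ ValueLE N v T
  | _, _ => True

/-- Under an elimination, `t : T` forms no projection or permutation redex, and the rank of the
logical redex, if there is one, is at most `τ`. -/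
def Principal (τ : ℕ) : Tm → Ty → Prop
  | .lam _ _, T => T.rank ≤ τ
  | .inj _ _ _, T => T.rank ≤ τ
  | .pair _ _, _ => False
  | .case _ _ _ _ _, _ => False
  | _, _ => True

/-- The condition on messages `t : T` sent along the channel `k`: among the channels in `R`, the
active ones carry values of rank at most `M`, and the inactive ones carry no values. -/
def Sendable (M : ℕ) (R : ℕ → Prop) (β : ℕ → Bool) (k : ℕ) (t : Tm) (T : Ty) : Prop :=
  R k → (β k = true → ValueLE M t T) ∧ (β k = false → ¬ IsValue β t)

/-- `t : A` is a simply typed term without projection and permutation redexes; the ranks of its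
logical redexes are bounded by `τ`, its messages are `Sendable`. -/
def Tame (τ M : ℕ) (R : ℕ → Prop) (β : ℕ → Bool) (Δ : ℕ → Ty × Ty) : (ℕ → Ty) → Tm → Ty → Prop
  | Γ, .var n, A => Γ n = A
  | _, .tt, A => A = .top
  | Γ, .lam B u, A => ∃ C, A = .imp B C ∧ Tame τ M R β Δ (cons B Γ) u C
  | Γ, .app t u, B => ∃ A, Tame τ M R β Δ Γ t (.imp A B) ∧ Principal τ t (.imp A B) ∧
      Tame τ M R β Δ Γ u A
  | Γ, .pair u v, A => ∃ B C, A = .and B C ∧ Tame τ M R β Δ Γ u B ∧ Tame τ M R β Δ Γ v C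
  | Γ, .proj false u, A => ∃ B, Tame τ M R β Δ Γ u (.and A B) ∧ Principal τ u (.and A B)
  | Γ, .proj true u, B => ∃ A, Tame τ M R β Δ Γ u (.and A B) ∧ Principal τ u (.and A B)
  | Γ, .inj false C u, A => ∃ B, A = .or B C ∧ Tame τ M R β Δ Γ u B
  | Γ, .inj true C u, A => ∃ B, A = .or C B ∧ Tame τ M R β Δ Γ u B
  | Γ, .case A B t u v, C => Tame τ M R β Δ Γ t (.or A B) ∧ Principal τ t (.or A B) ∧
      Tame τ M R β Δ (cons A Γ) u C ∧ Tame τ M R β Δ (cons B Γ) v C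
  | Γ, .efq P u, A => A = P ∧ P.IsEfqAtom ∧ Tame τ M R β Δ Γ u .bot ∧ Principal τ u .bot
  | Γ, .chan k t, A => A = (Δ k).2 ∧ Tame τ M R β Δ Γ t (Δ k).1 ∧ Sendable M R β k t (Δ k).1
  | _, .par _ _, _ => False
  | _, .ses _ _ _ _, _ => False

variable {τ M N : ℕ} {R R' : ℕ → Prop} {β β' : ℕ → Bool} {Δ Δ' : ℕ → Ty × Ty} {Γ Γ' : ℕ → Ty}

theorem ValueLE.mono {N' : ℕ} (hN : N ≤ N') {t : Tm} {T : Ty} (h : ValueLE N t T) :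
    ValueLE N' t T := by
  induction t generalizing T with
  | lam => exact le_trans h hN
  | inj => exact le_trans h hN
  | pair u v hu hv => cases T <;> first | trivial | exact ⟨hu h.1, hv h.2⟩
  | case A B t u v _ hu hv => exact ⟨hu h.1, hv h.2⟩
  | _ => trivial

theorem Principal.mono {N' : ℕ} (hN : N ≤ N') {t : Tm} {T : Ty} (h : Principal N t T) :
    Principal N' t T := by
  cases t <;> first | exact h | exact le_trans h hN

theorem Principal.valueLE {t : Tm} {T : Ty} (h : Principal N t T) : ValueLE N t T := by
  cases t <;> first | exact h | exact h.elim

/-- A non-value has no abstraction, injection or case distinction among its components, so nothing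
is left to bound. This lets messages on inactive channels forget the old rank bound. -/
theorem valueLE_of_not_isValue {t : Tm} (h : ¬ IsValue β t) (T : Ty) : ValueLE N t T := by
  induction t generalizing T with
  | lam => exact (h trivial).elim
  | inj => exact (h trivial).elim
  | pair u v hu hv =>
    cases T <;> first | trivial | exact ⟨hu (fun x => h (.inl x)) _, hv (fun x => h (.inr x)) _⟩
  | case A B t u v _ hu hv => exact (h trivial).elim
  | _ => trivial

/-! ### Stability under renaming -/

theorem cons_liftRen {X : Type} {f g : ℕ → X} {r : ℕ → ℕ} (h : ∀ n, g (r n) = f n) (x : X) (n : ℕ) :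
    cons x g (liftRen r n) = cons x f n := by
  cases n with
  | zero => rfl
  | succ n => exact h n

theorem activeHead_ren {t : Tm} (r c : ℕ → ℕ) (h : ∀ k, HasChan k t → β' (c k) = β k) :
    ActiveHead β' (t.ren r c) ↔ ActiveHead β t := by
  induction t with
  | chan k t _ => simp only [Tm.ren, ActiveHead, h k (.inl rfl)]
  | app t u ht _ => exact ht fun k hk => h k (.inl hk)
  | proj i t ht => exact ht fun k hk => h k hk
  | case A B t u v ht _ _ => exact ht fun k hk => h k (.inl hk)
  | efq P t ht => exact ht fun k hk => h k hk
  | _ => exact Iff.rfl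

theorem isValue_ren {t : Tm} (r c : ℕ → ℕ) (h : ∀ k, HasChan k t → β' (c k) = β k) :
    IsValue β' (t.ren r c) ↔ IsValue β t := by
  induction t with
  | pair u v hu hv =>
    exact or_congr (hu fun k hk => h k (.inl hk)) (hv fun k hk => h k (.inr hk))
  | chan k t _ => exact activeHead_ren r c h
  | app t u _ _ => exact activeHead_ren r c h
  | proj i t _ => exact activeHead_ren r c h
  | _ => exact Iff.rfl

theorem valueLE_ren {t : Tm} (r c : ℕ → ℕ) {T : Ty} :
    ValueLE N (t.ren r c) T ↔ ValueLE N t T := by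
  induction t generalizing r c T with
  | pair u v hu hv =>
    cases T <;> first | exact Iff.rfl | exact and_congr (hu r c) (hv r c)
  | case A B t u v _ hu hv => exact and_congr (hu _ _) (hv _ _)
  | _ => exact Iff.rfl

theorem principal_ren {t : Tm} (r c : ℕ → ℕ) {T : Ty} :
    Principal N (t.ren r c) T ↔ Principal N t T := by
  cases t <;> exact Iff.rfl

/-- The channel hypothesis is restricted to channels that occur, so that a session binder can be
removed around a term not using its channel. Only `R' (c k) → R k` is needed, because fewer
constrained channels mean fewer conditions. -/
theorem Tame.ren {t : Tm} {A : Ty} {r c : ℕ → ℕ} (ht : Tame τ M R β Δ Γ t A)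
    (hr : ∀ n, Γ' (r n) = Γ n)
    (hc : ∀ k, HasChan k t → Δ' (c k) = Δ k ∧ (R' (c k) → R k) ∧ β' (c k) = β k) :
    Tame τ M R' β' Δ' Γ' (t.ren r c) A := by
  induction t generalizing Γ Γ' A r with
  | var n => exact (hr n).trans ht
  | tt => exact ht
  | lam B u hu =>
    obtain ⟨C, rfl, h⟩ := ht
    exact ⟨C, rfl, hu h (cons_liftRen hr B) hc⟩
  | app t u iht ihu =>
    obtain ⟨B, h1, h2, h3⟩ := ht
    exact ⟨B, iht h1 hr fun k hk => hc k (.inl hk), (principal_ren r c).2 h2,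
      ihu h3 hr fun k hk => hc k (.inr hk)⟩
  | pair t u iht ihu =>
    obtain ⟨B, C, rfl, h1, h3⟩ := ht
    exact ⟨B, C, rfl, iht h1 hr fun k hk => hc k (.inl hk), ihu h3 hr fun k hk => hc k (.inr hk)⟩
  | proj i u hu =>
    cases i <;> obtain ⟨B, h1, h2⟩ := ht <;> exact ⟨B, hu h1 hr hc, (principal_ren r c).2 h2⟩
  | inj i C u hu =>
    cases i <;> obtain ⟨B, rfl, h1⟩ := ht <;> exact ⟨B, rfl, hu h1 hr hc⟩
  | case A B t u v iht ihu ihv =>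
    obtain ⟨h1, h2, h3, h4⟩ := ht
    exact ⟨iht h1 hr fun k hk => hc k (.inl hk), (principal_ren r c).2 h2,
      ihu h3 (cons_liftRen hr _) fun k hk => hc k (.inr (.inl hk)),
      ihv h4 (cons_liftRen hr _) fun k hk => hc k (.inr (.inr hk))⟩
  | efq P u hu =>
    obtain ⟨h1, h2, h3, h4⟩ := ht
    exact ⟨h1, h2, hu h3 hr hc, (principal_ren r c).2 h4⟩
  | chan k u hu =>
    obtain ⟨h1, h2, h3⟩ := ht
    obtain ⟨e1, e2, e3⟩ := hc k (.inl rfl)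
    have hcu := fun l hl => hc l (.inr hl)
    refine ⟨by rw [e1]; exact h1, by rw [e1]; exact hu h2 hr hcu, fun hR => ?_⟩
    rw [e1, e3, valueLE_ren, isValue_ren r c fun l hl => (hcu l hl).2.2]
    exact h3 (e2 hR)
  | par => exact ht.elim
  | ses => exact ht.elim

theorem Tame.weaken {t : Tm} {A : Ty} (B : Ty) (ht : Tame τ M R β Δ Γ t A) :
    Tame τ M R β Δ (cons B Γ) (t.ren Nat.succ id) A :=
  ht.ren (fun _ => rfl) fun _ _ => ⟨rfl, id, rfl⟩

theorem Tame.mono {τ' M' : ℕ} (hτ : τ ≤ τ') (hM : M ≤ M') {t : Tm} {A : Ty}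
    (ht : Tame τ M R β Δ Γ t A) : Tame τ' M' R β Δ Γ t A := by
  induction t generalizing Γ A with
  | var n => exact ht
  | tt => exact ht
  | lam B u hu =>
    obtain ⟨C, rfl, h⟩ := ht
    exact ⟨C, rfl, hu h⟩
  | app t u iht ihu =>
    obtain ⟨B, h1, h2, h3⟩ := ht
    exact ⟨B, iht h1, h2.mono hτ, ihu h3⟩
  | pair t u iht ihu =>
    obtain ⟨B, C, rfl, h1, h3⟩ := ht
    exact ⟨B, C, rfl, iht h1, ihu h3⟩
  | proj i u hu => cases i <;> obtain ⟨B, h1, h2⟩ := ht <;> exact ⟨B, hu h1, h2.mono hτ⟩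
  | inj i C u hu => cases i <;> obtain ⟨B, rfl, h1⟩ := ht <;> exact ⟨B, rfl, hu h1⟩
  | case A B t u v iht ihu ihv =>
    obtain ⟨h1, h2, h3, h4⟩ := ht
    exact ⟨iht h1, h2.mono hτ, ihu h3, ihv h4⟩
  | efq P u hu =>
    obtain ⟨h1, h2, h3, h4⟩ := ht
    exact ⟨h1, h2, hu h3, h4.mono hτ⟩
  | chan k u hu =>
    obtain ⟨h1, h2, h3⟩ := ht
    exact ⟨h1, hu h2, fun hR => ⟨fun hb => ((h3 hR).1 hb).mono hM, (h3 hR).2⟩⟩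
  | par => exact ht.elim
  | ses => exact ht.elim

theorem Tame.simple {t : Tm} {A : Ty} (ht : Tame τ M R β Δ Γ t A) : Simple t := by
  induction t generalizing Γ A with
  | var n => trivial
  | tt => trivial
  | lam B u hu => obtain ⟨C, rfl, h⟩ := ht; exact hu h
  | app t u iht ihu => obtain ⟨B, h1, h2, h3⟩ := ht; exact ⟨iht h1, ihu h3⟩
  | pair t u iht ihu => obtain ⟨B, C, rfl, h1, h3⟩ := ht; exact ⟨iht h1, ihu h3⟩
  | proj i u hu => cases i <;> obtain ⟨B, h1, h2⟩ := ht <;> exact hu h1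
  | inj i C u hu => cases i <;> obtain ⟨B, rfl, h1⟩ := ht <;> exact hu h1
  | case A B t u v iht ihu ihv => obtain ⟨h1, h2, h3, h4⟩ := ht; exact ⟨iht h1, ihu h3, ihv h4⟩
  | efq P u hu => exact hu ht.2.2.1
  | chan k u hu => exact hu ht.2.1
  | par => exact ht.elim
  | ses => exact ht.elim

theorem Tame.hasType (Ax : Finset DisjAxiom) {t : Tm} {A : Ty} (ht : Tame τ M R β Δ Γ t A) :
    HasType Ax Γ Δ t A := by
  induction t generalizing Γ A with
  | var n => cases ht; exact .var _ _ _
  | tt => cases ht; exact .tt _ _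
  | lam B u hu => obtain ⟨C, rfl, h⟩ := ht; exact .lam (hu h)
  | app t u iht ihu => obtain ⟨B, h1, h2, h3⟩ := ht; exact .app (iht h1) (ihu h3)
  | pair t u iht ihu => obtain ⟨B, C, rfl, h1, h3⟩ := ht; exact .pair (iht h1) (ihu h3)
  | proj i u hu =>
    cases i <;> obtain ⟨B, h1, h2⟩ := ht
    · exact .fst (hu h1)
    · exact .snd (hu h1)
  | inj i C u hu =>
    cases i <;> obtain ⟨B, rfl, h1⟩ := ht
    · exact .inl (hu h1)
    · exact .inr (hu h1)
  | case A B t u v iht ihu ihv => obtain ⟨h1, h2, h3, h4⟩ := ht; exact .case (iht h1) (ihu h3) (ihv h4)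
  | efq P u hu => obtain ⟨rfl, h2, h3, h4⟩ := ht; exact .efq h2 (hu h3)
  | chan k u hu => obtain ⟨rfl, h2, h3⟩ := ht; exact .chan k (hu h2)
  | par => exact ht.elim
  | ses => exact ht.elim

/-- The components of a term are typed by subformulas of its type, and branches of a case
distinction by the type itself. -/
theorem Tame.valueLE_rank {t : Tm} {A : Ty} (ht : Tame τ M R β Δ Γ t A) (hA : A.rank ≤ N) :
    ValueLE N t A := by
  induction t generalizing Γ A with
  | lam B u hu => exact hA
  | inj => exact hA
  | pair t u iht ihu =>
    obtain ⟨B, C, rfl, h1, h3⟩ := ht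
    simp only [Ty.rank] at hA
    exact ⟨iht h1 (by omega), ihu h3 (by omega)⟩
  | case A B t u v iht ihu ihv => obtain ⟨h1, h2, h3, h4⟩ := ht; exact ⟨ihu h3 hA, ihv h4 hA⟩
  | _ => trivial


/-! ### Closure of reduction under term constructors -/

/-- Finitely many applications of the rules `S` inside a term. -/
abbrev Reduces (S : (ℕ → Bool) → Tm → Tm → Prop) (α : ℕ → Bool) : Tm → Tm → Prop :=
  Relation.ReflTransGen (Inside S α)

section Closure

variable {S : (ℕ → Bool) → Tm → Tm → Prop} {α : ℕ → Bool} {t t' u u' v v' : Tm}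

theorem Reduces.frame (F : Frame) (h : Reduces S α t t') :
    Reduces S α (F.plug t) (F.plug t') :=
  h.lift F.plug fun _ _ => Inside.frame F

theorem Reduces.root (h : S α t t') : Reduces S α t t' := .single (.root h)

theorem Reduces.lam (A : Ty) (h : Reduces S α t t') : Reduces S α (.lam A t) (.lam A t') :=
  h.frame (.lam A)

theorem Reduces.app (h : Reduces S α t t') (h' : Reduces S α u u') :
    Reduces S α (.app t u) (.app t' u') :=
  (h.frame (.elim (.arg u))).trans (h'.frame (.appR t'))

theorem Reduces.pair (h : Reduces S α t t') (h' : Reduces S α u u') :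
    Reduces S α (.pair t u) (.pair t' u') :=
  (h.frame (.pairL u)).trans (h'.frame (.pairR t'))

theorem Reduces.proj (i : Bool) (h : Reduces S α t t') : Reduces S α (.proj i t) (.proj i t') :=
  h.frame (.elim (.proj i))

theorem Reduces.inj (i : Bool) (C : Ty) (h : Reduces S α t t') :
    Reduces S α (.inj i C t) (.inj i C t') :=
  h.frame (.inj i C)

theorem Reduces.case (A B : Ty) (h : Reduces S α t t') (h' : Reduces S α u u')
    (h'' : Reduces S α v v') : Reduces S α (.case A B t u v) (.case A B t' u' v') :=
  ((h.frame (.elim (.case A B u v))).trans (h'.frame (.caseL A B t' v))).trans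
    (h''.frame (.caseR A B t' u'))

theorem Reduces.efq (P : Ty) (h : Reduces S α t t') : Reduces S α (.efq P t) (.efq P t') :=
  h.frame (.elim (.efq P))

theorem Reduces.chan (k : ℕ) (h : Reduces S α t t') : Reduces S α (.chan k t) (.chan k t') :=
  h.frame (.chan k)

theorem Reduces.par (h : Reduces S α t t') (h' : Reduces S α u u') :
    Reduces S α (.par t u) (.par t' u') :=
  Relation.ReflTransGen.trans (h.lift (fun x => Tm.par x u) fun _ _ => Inside.parL u)
    (h'.lift (fun x => Tm.par t' x) fun _ _ => Inside.parR t')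

theorem Reduces.ses_update {ax : DisjAxiom} (s : ℕ → Ty) {act : Bool} (us : Fin ax.m → Tm)
    (i : Fin ax.m) (h : Reduces S (cons act α) (us i) t') :
    Reduces S α (.ses ax s act us) (.ses ax s act (Function.update us i t')) := by
  induction h with
  | refl => rw [Function.update_eq_self]
  | @tail b c _ h2 ih =>
    refine ih.tail ?_
    have := Inside.ses (R := S) (α := α) ax s act (Function.update us i b) i (t' := c) (by simpa using h2)
    simpa using this

theorem Reduces.ses {ax : DisjAxiom} (s : ℕ → Ty) {act : Bool} {us us' : Fin ax.m → Tm}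
    (h : ∀ i, Reduces S (cons act α) (us i) (us' i)) :
    Reduces S α (.ses ax s act us) (.ses ax s act us') := by
  -- A step changes a single process, so the processes are reduced one after another; `J` is the set
  -- of those already done.
  have key : ∀ J : Finset (Fin ax.m),
      Reduces S α (.ses ax s act us) (.ses ax s act (fun i => if i ∈ J then us' i else us i)) := by
    intro J
    induction J using Finset.induction_on with
    | empty => simpa using Relation.ReflTransGen.refl
    | insert j J hj ih =>
      refine ih.trans ?_
      have := Reduces.ses_update (S := S) (α := α) s (act := act)
        (fun i => if i ∈ J then us' i else us i) j (t' := us' j) (by simpa [hj] using h j)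
      convert this using 2
      funext i
      by_cases hij : i = j
      · subst hij; simp
      · simp [Function.update, hij]
  simpa using key Finset.univ

theorem Inside.imp {S' : (ℕ → Bool) → Tm → Tm → Prop}
    (h : Inside S α t t') (hS : ∀ α t t', S α t t' → Reduces S' α t t') : Reduces S' α t t' := by
  induction h with
  | root h => exact hS _ _ _ h
  | frame F _ ih => exact ih.frame F
  | parL u _ ih => exact ih.par .refl
  | parR u _ ih => exact Reduces.par .refl ih
  | ses ax s act us i _ ih => exact Reduces.ses_update s us i ih

theorem Reduces.imp {S' : (ℕ → Bool) → Tm → Tm → Prop}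
    (h : Reduces S α t t') (hS : ∀ α t t', S α t t' → Reduces S' α t t') : Reduces S' α t t' := by
  induction h with
  | refl => exact .refl
  | tail _ h2 ih => exact ih.trans (h2.imp hS)

theorem Inside.eq_of_simple (h : Inside S α t t') (ht : Simple t)
    (hS : ∀ α t t', S α t t' → ¬ Simple t) : False := by
  induction h with
  | root h => exact hS _ _ _ h ht
  | frame F _ ih =>
    apply ih
    rcases F with (ξ | ξ | ξ | ξ) | _ | _ | _ | _ | _ | _ | _ | _ <;>
      simp_all [Frame.plug, Elim.plug, Simple]
  | parL => exact ht
  | parR => exact ht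
  | ses => exact ht

end Closure

/-! ### Normalization of simply typed terms by hereditary substitution -/

section Normalization

variable {τ M N : ℕ} {R R' : ℕ → Prop} {β β' : ℕ → Bool} {Δ Δ' : ℕ → Ty × Ty} {Γ Γ' : ℕ → Ty}
  {α : ℕ → Bool}

/-- Intuitionistic normal terms whose messages on the channels in `R` have values of rank at most
`M`. -/
abbrev NF (M : ℕ) (R : ℕ → Prop) (Δ : ℕ → Ty × Ty) : (ℕ → Ty) → Tm → Ty → Prop :=
  Tame 0 M R (fun _ => true) Δ

/-- Intuitionistic reduction in finitely many steps. -/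
abbrev IntReduces (α : ℕ → Bool) : Tm → Tm → Prop := Reduces (fun _ => IntRule) α

theorem intReduces_perm (A B t u v) (ξ : Elim) : IntReduces α (ξ.plug (.case A B t u v))
    (.case A B t ((ξ.ren Nat.succ id).plug u) ((ξ.ren Nat.succ id).plug v)) :=
  .root (.inr (.perm A B t u v ξ))

/-- Substitution of terms with values of rank at most `N` in a normal term can be normalized. -/
def SubNormalizes (M : ℕ) (R : ℕ → Prop) (Δ : ℕ → Ty × Ty) (α : ℕ → Bool) (N : ℕ) : Prop :=
  ∀ (u : Tm) (Γ Γ' : ℕ → Ty) (e : ℕ → Tm) (B : Ty), NF M R Δ Γ u B →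
    (∀ n, NF M R Δ Γ' (e n) (Γ n) ∧ ValueLE N (e n) (Γ n)) →
    ∃ r, IntReduces α (u.sub e) r ∧ NF M R Δ Γ' r B ∧
      ∀ N', N ≤ N' → ValueLE N' u B → ValueLE N' r B

theorem cons_inst (h : SubNormalizes M R Δ α N) {u t : Tm} {A B : Ty}
    (hu : NF M R Δ (cons A Γ) u B) (ht : NF M R Δ Γ t A) (hA : ValueLE N t A) :
    ∃ r, IntReduces α (u.inst t) r ∧ NF M R Δ Γ r B ∧
      ∀ N', N ≤ N' → ValueLE N' u B → ValueLE N' r B := by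
  refine h u _ Γ (cons t Tm.var) B hu fun n => ?_
  cases n with
  | zero => exact ⟨ht, hA⟩
  | succ n => exact ⟨rfl, by simp [cons, ValueLE]⟩

/-- If the function is an abstraction of rank at most `N`, its argument and result types have rank
at most `N - 1`. The substitution is then available by the inductive hypothesis, and the result has
values of rank at most `N - 1`. A case distinction passes the argument to its branches; any other
function gives a neutral application. -/
theorem nf_app (hS : ∀ N' < N, SubNormalizes M R Δ α N') (hN : N ≤ M + 1) {t u : Tm} {A B : Ty}
    (ht : NF M R Δ Γ t (.imp A B)) (htN : ValueLE N t (.imp A B)) (hu : NF M R Δ Γ u A) :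
    ∃ r, IntReduces α (.app t u) r ∧ NF M R Δ Γ r B ∧ ValueLE (N - 1) r B := by
  induction t generalizing Γ u with
  | lam A' b _ =>
    obtain ⟨C, hC, hb⟩ := ht
    cases hC
    simp only [ValueLE, Ty.rank] at htN
    obtain ⟨N, rfl⟩ : ∃ N', N = N' + 1 := ⟨N - 1, by omega⟩
    obtain ⟨r, h1, h2, h3⟩ := cons_inst (hS N (by omega)) hb hu (hu.valueLE_rank (by omega))
    exact ⟨r, .head (.root (.inl (.beta _ _ _))) h1, h2,
      h3 _ le_rfl (hb.valueLE_rank (by omega))⟩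
  | case A' B' s p q _ ihp ihq =>
    obtain ⟨h1, h2, h3, h4⟩ := ht
    obtain ⟨p', hp1, hp2, hp3⟩ := ihp h3 htN.1 (hu.weaken _)
    obtain ⟨q', hq1, hq2, hq3⟩ := ihq h4 htN.2 (hu.weaken _)
    exact ⟨.case A' B' s p' q', (intReduces_perm A' B' s p q (.arg u)).trans (Reduces.case _ _ .refl hp1 hq1),
      ⟨h1, h2, hp2, hq2⟩, hp3, hq3⟩
  | tt => cases ht
  | pair => obtain ⟨_, _, h, _⟩ := ht; cases h
  | inj i => cases i <;> obtain ⟨_, h, _⟩ := ht <;> cases h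
  | efq => obtain ⟨rfl, h, _⟩ := ht; exact h.elim
  | par => exact ht.elim
  | ses => exact ht.elim
  | _ => exact ⟨_, .refl, ⟨A, ht, trivial, hu⟩, trivial⟩

theorem nf_fst {t : Tm} {A B : Ty} (ht : NF M R Δ Γ t (.and A B)) :
    ∃ r, IntReduces α (.proj false t) r ∧ NF M R Δ Γ r A ∧
      ∀ N, ValueLE N t (.and A B) → ValueLE N r A := by
  induction t generalizing Γ with
  | pair u v =>
    obtain ⟨_, _, h, h1, h2⟩ := ht
    cases h
    exact ⟨u, .root (.inr (.fst u v)), h1, fun N h => h.1⟩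
  | case A' B' s p q _ ihp ihq =>
    obtain ⟨h1, h2, h3, h4⟩ := ht
    obtain ⟨p', hp1, hp2, hp3⟩ := ihp h3
    obtain ⟨q', hq1, hq2, hq3⟩ := ihq h4
    exact ⟨.case A' B' s p' q',
      (intReduces_perm A' B' s p q (.proj false)).trans (Reduces.case _ _ .refl hp1 hq1),
      ⟨h1, h2, hp2, hq2⟩, fun N h => ⟨hp3 N h.1, hq3 N h.2⟩⟩
  | lam => obtain ⟨_, h, _⟩ := ht; cases h
  | tt => cases ht
  | inj i => cases i <;> obtain ⟨_, h, _⟩ := ht <;> cases h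
  | efq => obtain ⟨rfl, h, _⟩ := ht; exact h.elim
  | par => exact ht.elim
  | ses => exact ht.elim
  | _ => exact ⟨_, .refl, ⟨B, ht, trivial⟩, fun _ _ => trivial⟩

theorem nf_snd {t : Tm} {A B : Ty} (ht : NF M R Δ Γ t (.and A B)) :
    ∃ r, IntReduces α (.proj true t) r ∧ NF M R Δ Γ r B ∧
      ∀ N, ValueLE N t (.and A B) → ValueLE N r B := by
  induction t generalizing Γ with
  | pair u v =>
    obtain ⟨_, _, h, h1, h2⟩ := ht
    cases h
    exact ⟨v, .root (.inr (.snd u v)), h2, fun N h => h.2⟩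
  | case A' B' s p q _ ihp ihq =>
    obtain ⟨h1, h2, h3, h4⟩ := ht
    obtain ⟨p', hp1, hp2, hp3⟩ := ihp h3
    obtain ⟨q', hq1, hq2, hq3⟩ := ihq h4
    exact ⟨.case A' B' s p' q',
      (intReduces_perm A' B' s p q (.proj true)).trans (Reduces.case _ _ .refl hp1 hq1),
      ⟨h1, h2, hp2, hq2⟩, fun N h => ⟨hp3 N h.1, hq3 N h.2⟩⟩
  | lam => obtain ⟨_, h, _⟩ := ht; cases h
  | tt => cases ht
  | inj i => cases i <;> obtain ⟨_, h, _⟩ := ht <;> cases h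
  | efq => obtain ⟨rfl, h, _⟩ := ht; exact h.elim
  | par => exact ht.elim
  | ses => exact ht.elim
  | _ => exact ⟨_, .refl, ⟨A, ht, trivial⟩, fun _ _ => trivial⟩

/-- Ex falso concludes only atoms other than `⊥`, so it is never itself the head of an elimination;
here this rules out one ex falso directly over another. -/
theorem nf_efq {t : Tm} {P : Ty} (hP : P.IsEfqAtom) (ht : NF M R Δ Γ t .bot) :
    ∃ r, IntReduces α (.efq P t) r ∧ NF M R Δ Γ r P ∧ ∀ N, ValueLE N r P := by
  induction t generalizing Γ with
  | case A' B' s p q _ ihp ihq =>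
    obtain ⟨h1, h2, h3, h4⟩ := ht
    obtain ⟨p', hp1, hp2, hp3⟩ := ihp h3
    obtain ⟨q', hq1, hq2, hq3⟩ := ihq h4
    exact ⟨.case A' B' s p' q',
      (intReduces_perm A' B' s p q (.efq P)).trans (Reduces.case _ _ .refl hp1 hq1),
      ⟨h1, h2, hp2, hq2⟩, fun N => ⟨hp3 N, hq3 N⟩⟩
  | lam => obtain ⟨_, h, _⟩ := ht; cases h
  | tt => cases ht
  | pair => obtain ⟨_, _, h, _⟩ := ht; cases h
  | inj i => cases i <;> obtain ⟨_, h, _⟩ := ht <;> cases h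
  | efq => obtain ⟨rfl, h, _⟩ := ht; exact h.elim
  | par => exact ht.elim
  | ses => exact ht.elim
  | _ => exact ⟨_, .refl, ⟨rfl, hP, ht, trivial⟩, fun _ => trivial⟩

/-- An injection of rank at most `N` injects a term of rank at most `N - 1`, which may be
substituted into a branch. If the scrutinee is a case distinction, the whole elimination is pushed
into its branches by a permutation. -/
theorem nf_case (hS : ∀ N' < N, SubNormalizes M R Δ α N') {t u v : Tm} {A B C : Ty}
    (ht : NF M R Δ Γ t (.or A B)) (htN : ValueLE N t (.or A B))
    (hu : NF M R Δ (cons A Γ) u C) (hv : NF M R Δ (cons B Γ) v C) :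
    ∃ r, IntReduces α (.case A B t u v) r ∧ NF M R Δ Γ r C ∧
      ∀ N', N ≤ N' + 1 → ValueLE N' u C → ValueLE N' v C → ValueLE N' r C := by
  induction t generalizing Γ u v with
  | inj i D s _ =>
    simp only [ValueLE, Ty.rank] at htN
    obtain ⟨N, rfl⟩ : ∃ N', N = N' + 1 := ⟨N - 1, by omega⟩
    cases i <;> obtain ⟨_, h, hs⟩ := ht <;> cases h
    · obtain ⟨r, h1, h2, h3⟩ := cons_inst (hS N (by omega)) hu hs (hs.valueLE_rank (by omega))
      exact ⟨r, .head (.root (.inl (.caseL _ _ _ _ _ _))) h1, h2,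
        fun N' h h' _ => h3 _ (by omega) h'⟩
    · obtain ⟨r, h1, h2, h3⟩ := cons_inst (hS N (by omega)) hv hs (hs.valueLE_rank (by omega))
      exact ⟨r, .head (.root (.inl (.caseR _ _ _ _ _ _))) h1, h2,
        fun N' h _ h' => h3 _ (by omega) h'⟩
  | case A' B' s p q _ ihp ihq =>
    obtain ⟨h1, h2, h3, h4⟩ := ht
    have hw : ∀ D E w, NF M R Δ (cons E Γ) w C →
        NF M R Δ (cons E (cons D Γ)) (w.ren (liftRen Nat.succ) id) C := fun D E w hw =>
      hw.ren (cons_liftRen (fun _ => rfl) E) fun _ _ => ⟨rfl, id, rfl⟩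
    obtain ⟨p', hp1, hp2, hp3⟩ := ihp h3 htN.1 (hw _ _ _ hu) (hw _ _ _ hv)
    obtain ⟨q', hq1, hq2, hq3⟩ := ihq h4 htN.2 (hw _ _ _ hu) (hw _ _ _ hv)
    exact ⟨.case A' B' s p' q',
      (intReduces_perm A' B' s p q (.case A B u v)).trans (Reduces.case _ _ .refl hp1 hq1),
      ⟨h1, h2, hp2, hq2⟩, fun N' h h' h'' =>
      ⟨hp3 N' h ((valueLE_ren _ _).2 h') ((valueLE_ren _ _).2 h''),
        hq3 N' h ((valueLE_ren _ _).2 h') ((valueLE_ren _ _).2 h'')⟩⟩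
  | lam => obtain ⟨_, h, _⟩ := ht; cases h
  | tt => cases ht
  | pair => obtain ⟨_, _, h, _⟩ := ht; cases h
  | efq => obtain ⟨rfl, h, _⟩ := ht; exact h.elim
  | par => exact ht.elim
  | ses => exact ht.elim
  | _ => exact ⟨_, .refl, ⟨ht, trivial, hu, hv⟩, fun _ _ h h' => ⟨h, h'⟩⟩

/-- Hereditary substitution: induction on the rank bound of the substituted values, and inside it on
the term. In a normal term the head of an elimination is neutral, so a redex arises only from
substituted values and has rank at most `N`; contracting it calls substitution at a smaller bound.
The assumption `N ≤ M` keeps the messages below `M`. -/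
theorem subNormalizes (hN : N ≤ M) : SubNormalizes M R Δ α N := by
  induction N using Nat.strong_induction_on with
  | _ N IH =>
  have hS : ∀ N' < N, SubNormalizes M R Δ α N' := fun N' h => IH N' h (by omega)
  intro u
  have lift : ∀ {Γ Γ' : ℕ → Ty} {e : ℕ → Tm},
      (∀ n, NF M R Δ Γ' (e n) (Γ n) ∧ ValueLE N (e n) (Γ n)) → ∀ A n,
      NF M R Δ (cons A Γ') ((cons (.var 0) fun n => (e n).ren Nat.succ id : ℕ → Tm) n)
        (cons A Γ n) ∧
      ValueLE N ((cons (.var 0) fun n => (e n).ren Nat.succ id : ℕ → Tm) n) (cons A Γ n) := by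
    intro Γ Γ' e he A n
    cases n with
    | zero => exact ⟨rfl, by simp [cons, ValueLE]⟩
    | succ n => exact ⟨(he n).1.weaken A, (valueLE_ren _ _).2 (he n).2⟩
  induction u with
  | var n =>
    intro Γ Γ' e B hu he
    cases hu
    exact ⟨e n, .refl, (he n).1, fun N' h _ => (he n).2.mono h⟩
  | tt => exact fun Γ Γ' e B hu _ => ⟨.tt, .refl, hu, fun _ _ h => h⟩
  | lam A u ih =>
    rintro Γ Γ' e _ ⟨C, rfl, hu⟩ he
    obtain ⟨r, h1, h2, _⟩ := ih _ _ _ _ hu (lift he A)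
    exact ⟨.lam A r, h1.lam A, ⟨C, rfl, h2⟩, fun _ _ h => h⟩
  | app t u iht ihu =>
    rintro Γ Γ' e B ⟨A, ht, hp, hu⟩ he
    obtain ⟨t', t1, t2, t3⟩ := iht _ _ _ _ ht he
    obtain ⟨u', u1, u2, u3⟩ := ihu _ _ _ _ hu he
    obtain ⟨r, r1, r2, r3⟩ := nf_app hS (by omega) t2
      (t3 N le_rfl (hp.valueLE.mono (Nat.zero_le _))) u2
    exact ⟨r, (t1.app u1).trans r1, r2, fun N' h _ => r3.mono (by omega)⟩
  | pair t u iht ihu =>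
    rintro Γ Γ' e _ ⟨A, B, rfl, ht, hu⟩ he
    obtain ⟨t', t1, t2, t3⟩ := iht _ _ _ _ ht he
    obtain ⟨u', u1, u2, u3⟩ := ihu _ _ _ _ hu he
    exact ⟨.pair t' u', t1.pair u1, ⟨A, B, rfl, t2, u2⟩,
      fun N' h h' => ⟨t3 N' h h'.1, u3 N' h h'.2⟩⟩
  | proj i t ih =>
    cases i <;> rintro Γ Γ' e B ⟨A, ht, hp⟩ he <;> obtain ⟨t', t1, t2, t3⟩ := ih _ _ _ _ ht he
    · obtain ⟨r, r1, r2, r3⟩ := nf_fst (α := α) t2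
      exact ⟨r, (t1.proj _).trans r1, r2,
        fun N' h _ => r3 _ (t3 N' h (hp.valueLE.mono (Nat.zero_le _)))⟩
    · obtain ⟨r, r1, r2, r3⟩ := nf_snd (α := α) t2
      exact ⟨r, (t1.proj _).trans r1, r2,
        fun N' h _ => r3 _ (t3 N' h (hp.valueLE.mono (Nat.zero_le _)))⟩
  | inj i C u ih =>
    cases i <;> rintro Γ Γ' e _ ⟨B, rfl, hu⟩ he <;> obtain ⟨r, h1, h2, _⟩ := ih _ _ _ _ hu he <;>
      exact ⟨.inj _ C r, h1.inj _ C, ⟨B, rfl, h2⟩, fun _ _ h => h⟩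
  | case A B t u v iht ihu ihv =>
    rintro Γ Γ' e C ⟨ht, hp, hu, hv⟩ he
    obtain ⟨t', t1, t2, t3⟩ := iht _ _ _ _ ht he
    obtain ⟨u', u1, u2, u3⟩ := ihu _ _ _ _ hu (lift he A)
    obtain ⟨v', v1, v2, v3⟩ := ihv _ _ _ _ hv (lift he B)
    obtain ⟨r, r1, r2, r3⟩ := nf_case hS t2 (t3 N le_rfl (hp.valueLE.mono (Nat.zero_le _))) u2 v2
    exact ⟨r, (Reduces.case A B t1 u1 v1).trans r1, r2,
      fun N' h h' => r3 N' (by omega) (u3 N' h h'.1) (v3 N' h h'.2)⟩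
  | efq P t ih =>
    rintro Γ Γ' e _ ⟨rfl, hP, ht, hp⟩ he
    obtain ⟨t', t1, t2, t3⟩ := ih _ _ _ _ ht he
    obtain ⟨r, r1, r2, r3⟩ := nf_efq (α := α) hP t2
    exact ⟨r, (t1.efq _).trans r1, r2, fun N' _ _ => r3 N'⟩
  | chan k t ih =>
    rintro Γ Γ' e _ ⟨rfl, ht, hs⟩ he
    obtain ⟨t', t1, t2, t3⟩ := ih _ _ _ _ ht he
    exact ⟨.chan k t', t1.chan k, ⟨rfl, t2, fun h =>
      ⟨fun _ => t3 M hN ((hs h).1 rfl), fun h => (Bool.noConfusion h)⟩⟩, fun _ _ _ => trivial⟩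
  | par => exact fun _ _ _ _ h => h.elim
  | ses => exact fun _ _ _ _ h => h.elim

end Normalization


section

variable {τ M N : ℕ} {R R' : ℕ → Prop} {β β' : ℕ → Bool} {Δ Δ' : ℕ → Ty × Ty} {Γ Γ' : ℕ → Ty}
  {α : ℕ → Bool}

theorem NF.mono {M' : ℕ} (h : M ≤ M') {t : Tm} {A : Ty} (ht : NF M R Δ Γ t A) :
    NF M' R Δ Γ t A :=
  Tame.mono le_rfl h ht

/-! ### Normal forms of typed terms and the drop of the rank bound -/

/-- Normalization by induction on the typing derivation, each new redex being handled by hereditary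
substitution at the rank of its own type. The bound `M` on messages is not controlled: it only has
to be finite to start the descent. -/
theorem HasType.exists_nf {Ax : Finset DisjAxiom} {t : Tm} {A : Ty} (ht : HasType Ax Γ Δ t A)
    (hs : Simple t) (R : ℕ → Prop) (α : ℕ → Bool) :
    ∃ M t', IntReduces α t t' ∧ NF M R Δ Γ t' A := by
  induction ht with
  | var => exact ⟨0, _, .refl, rfl⟩
  | tt => exact ⟨0, _, .refl, rfl⟩
  | lam _ ih =>
    obtain ⟨M, t', h1, h2⟩ := ih hs
    exact ⟨M, _, h1.lam _, _, rfl, h2⟩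
  | @app Γ Δ A B t u _ _ iht ihu =>
    obtain ⟨M, t', t1, t2⟩ := iht hs.1
    obtain ⟨M', u', u1, u2⟩ := ihu hs.2
    -- A common bound for both subterms and the rank of the new redex; splitting this reflexive
    -- inequality yields the three estimates.
    have hM : max M (max M' (A.imp B).rank) ≤ max M (max M' (A.imp B).rank) := le_rfl
    simp only [max_le_iff] at hM
    obtain ⟨r, r1, r2, _⟩ := nf_app (N := (A.imp B).rank) (α := α)
      (fun N' h => subNormalizes (by omega)) (by omega) (t2.mono hM.1)
      (t2.valueLE_rank le_rfl) (u2.mono hM.2.1)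
    exact ⟨_, r, (t1.app u1).trans r1, r2⟩
  | pair _ _ iht ihu =>
    obtain ⟨M, t', t1, t2⟩ := iht hs.1
    obtain ⟨M', u', u1, u2⟩ := ihu hs.2
    exact ⟨max M M', _, t1.pair u1, _, _, rfl, t2.mono (le_max_left _ _), u2.mono (le_max_right _ _)⟩
  | fst _ ih =>
    obtain ⟨M, t', h1, h2⟩ := ih hs
    obtain ⟨r, r1, r2, _⟩ := nf_fst (α := α) h2
    exact ⟨M, r, (h1.proj _).trans r1, r2⟩
  | snd _ ih =>
    obtain ⟨M, t', h1, h2⟩ := ih hs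
    obtain ⟨r, r1, r2, _⟩ := nf_snd (α := α) h2
    exact ⟨M, r, (h1.proj _).trans r1, r2⟩
  | inl _ ih =>
    obtain ⟨M, t', h1, h2⟩ := ih hs
    exact ⟨M, _, h1.inj _ _, _, rfl, h2⟩
  | inr _ ih =>
    obtain ⟨M, t', h1, h2⟩ := ih hs
    exact ⟨M, _, h1.inj _ _, _, rfl, h2⟩
  | @case Γ Δ A B C t u v _ _ _ iht ihu ihv =>
    obtain ⟨M, t', t1, t2⟩ := iht hs.1
    obtain ⟨M', u', u1, u2⟩ := ihu hs.2.1
    obtain ⟨M'', v', v1, v2⟩ := ihv hs.2.2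
    have hM : max (max M M') (max M'' (A.or B).rank) ≤ max (max M M') (max M'' (A.or B).rank) :=
      le_rfl
    simp only [max_le_iff] at hM
    obtain ⟨r, r1, r2, _⟩ := nf_case (N := (A.or B).rank) (α := α)
      (fun N' h => subNormalizes (by omega)) (t2.mono hM.1.1) (t2.valueLE_rank le_rfl)
      (u2.mono hM.1.2) (v2.mono hM.2.1)
    exact ⟨_, r, (Reduces.case A B t1 u1 v1).trans r1, r2⟩
  | efq hP _ ih =>
    obtain ⟨M, t', h1, h2⟩ := ih hs
    obtain ⟨r, r1, r2, _⟩ := nf_efq (α := α) hP h2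
    exact ⟨M, r, (h1.efq _).trans r1, r2⟩
  | @chan Γ Δ t k _ ih =>
    obtain ⟨M, t', h1, h2⟩ := ih hs
    exact ⟨max M (Δ k).1.rank, _, h1.chan k, rfl, h2.mono (le_max_left _ _), fun _ =>
      ⟨fun _ => h2.valueLE_rank (le_max_right _ _), fun h => Bool.noConfusion h⟩⟩
  | par => exact hs.elim
  | ses => exact hs.elim

/-- At a conjunction type a principal term is neutral: abstractions and injections are excluded by
the type, pairs and case distinctions by `Principal`. So it satisfies every value bound. -/
theorem Principal.valueLE_of_and {t : Tm} {A B : Ty} (ht : Tame τ M R β Δ Γ t (.and A B))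
    (h : Principal N t (.and A B)) (N' : ℕ) : ValueLE N' t (.and A B) := by
  cases t with
  | lam => obtain ⟨_, h, _⟩ := ht; cases h
  | inj i => cases i <;> obtain ⟨_, h, _⟩ := ht <;> cases h
  | pair => exact h.elim
  | case => exact h.elim
  | _ => trivial

/-- The rank drop. Redexes of rank at most `τ + 1` release only values of rank at most `τ`, and the
messages on bound channels, all of them inactive, had no values before. So every bound `N ≥ τ` on
values survives normalization, and the messages end up below `τ`. -/
theorem Tame.exists_nf {t : Tm} {A : Ty} (ht : Tame (τ + 1) M R β Δ Γ t A)
    (hR : ∀ k, R k → β k = false) (α : ℕ → Bool) :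
    ∃ t', IntReduces α t t' ∧ NF τ R Δ Γ t' A ∧ ∀ N, τ ≤ N → ValueLE N t A → ValueLE N t' A := by
  have hS : ∀ N' < τ + 1, SubNormalizes τ R Δ α N' := fun N' h => subNormalizes (by omega)
  induction t generalizing Γ A with
  | var n => exact ⟨_, .refl, ht, fun _ _ h => h⟩
  | tt => exact ⟨_, .refl, ht, fun _ _ h => h⟩
  | lam B u ih =>
    obtain ⟨C, rfl, h⟩ := ht
    obtain ⟨t', h1, h2, h3⟩ := ih h
    exact ⟨_, h1.lam _, ⟨_, rfl, h2⟩, fun _ _ h => h⟩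
  | app t u iht ihu =>
    obtain ⟨B, ht, hp, hu⟩ := ht
    obtain ⟨t', t1, t2, t3⟩ := iht ht
    obtain ⟨u', u1, u2, u3⟩ := ihu hu
    obtain ⟨r, r1, r2, r3⟩ := nf_app hS le_rfl t2 (t3 _ (by omega) hp.valueLE) u2
    exact ⟨r, (t1.app u1).trans r1, r2, fun N h _ => r3.mono h⟩
  | pair t u iht ihu =>
    obtain ⟨B, C, rfl, ht, hu⟩ := ht
    obtain ⟨t', t1, t2, t3⟩ := iht ht
    obtain ⟨u', u1, u2, u3⟩ := ihu hu
    exact ⟨_, t1.pair u1, ⟨_, _, rfl, t2, u2⟩, fun N h h' => ⟨t3 N h h'.1, u3 N h h'.2⟩⟩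
  | proj i u hu =>
    cases i <;> obtain ⟨B, h1, h2⟩ := ht <;> obtain ⟨t', t1, t2, t3⟩ := hu h1
    · obtain ⟨r, r1, r2, r3⟩ := nf_fst (α := α) t2
      exact ⟨r, (t1.proj _).trans r1, r2, fun N h _ => r3 N (t3 N h (h2.valueLE_of_and h1 N))⟩
    · obtain ⟨r, r1, r2, r3⟩ := nf_snd (α := α) t2
      exact ⟨r, (t1.proj _).trans r1, r2, fun N h _ => r3 N (t3 N h (h2.valueLE_of_and h1 N))⟩
  | inj i C u hu =>
    cases i <;> obtain ⟨B, rfl, h1⟩ := ht <;> obtain ⟨t', t1, t2, t3⟩ := hu h1 <;>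
      exact ⟨_, t1.inj _ _, ⟨_, rfl, t2⟩, fun _ _ h => h⟩
  | case A B t u v iht ihu ihv =>
    obtain ⟨ht, hp, hu, hv⟩ := ht
    obtain ⟨t', t1, t2, t3⟩ := iht ht
    obtain ⟨u', u1, u2, u3⟩ := ihu hu
    obtain ⟨v', v1, v2, v3⟩ := ihv hv
    obtain ⟨r, r1, r2, r3⟩ := nf_case hS t2 (t3 _ (by omega) hp.valueLE) u2 v2
    exact ⟨r, (Reduces.case _ _ t1 u1 v1).trans r1, r2, fun N h h' =>
      r3 N (by omega) (u3 N h h'.1) (v3 N h h'.2)⟩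
  | efq P u hu =>
    obtain ⟨rfl, hP, h1, h2⟩ := ht
    obtain ⟨t', t1, t2, t3⟩ := hu h1
    obtain ⟨r, r1, r2, r3⟩ := nf_efq (α := α) hP t2
    exact ⟨r, (t1.efq _).trans r1, r2, fun N _ _ => r3 N⟩
  | chan k u hu =>
    obtain ⟨rfl, h1, h2⟩ := ht
    obtain ⟨t', t1, t2, t3⟩ := hu h1
    -- The message was not a value, hence satisfies the bound `τ` vacuously before normalization and
    -- genuinely afterwards.
    exact ⟨_, t1.chan k, ⟨rfl, t2, fun h => ⟨fun _ =>
      t3 τ le_rfl (valueLE_of_not_isValue ((h2 h).2 (hR k h)) _), fun h => Bool.noConfusion h⟩⟩,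
      fun _ _ _ => trivial⟩
  | par => exact ht.elim
  | ses => exact ht.elim

/-! ### Tame terms and reduction -/

/-- Extension of an environment by the values for several bound indices. -/
def extend {X : Type} : List X → (ℕ → X) → ℕ → X
  | [], f => f
  | x :: l, f => cons x (extend l f)

theorem extend_append {X : Type} (l l' : List X) (f : ℕ → X) :
    extend (l ++ l') f = extend l (extend l' f) := by
  induction l with
  | nil => rfl
  | cons x l ih => simp only [List.cons_append, extend, ih]

theorem Tame.of_frame {F : Frame} {t : Tm} {A : Ty} (h : Tame τ M R β Δ Γ (F.plug t) A) :
    ∃ B, Tame τ M R β Δ (extend F.binds Γ) t B := by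
  rcases F with (ξ | (_ | _) | ξ | ξ) | _ | _ | (_ | _) | _ | _ | _ | _ | _
  · obtain ⟨_, h, _⟩ := h; exact ⟨_, h⟩
  · obtain ⟨_, h, _⟩ := h; exact ⟨_, h⟩
  · obtain ⟨_, h, _⟩ := h; exact ⟨_, h⟩
  · exact ⟨_, h.1⟩
  · exact ⟨_, h.2.2.1⟩
  · obtain ⟨_, _, _, h⟩ := h; exact ⟨_, h⟩
  · obtain ⟨_, _, h⟩ := h; exact ⟨_, h⟩
  · obtain ⟨_, _, h⟩ := h; exact ⟨_, h⟩
  · obtain ⟨_, _, h⟩ := h; exact ⟨_, h⟩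
  · obtain ⟨_, _, _, h, _⟩ := h; exact ⟨_, h⟩
  · obtain ⟨_, _, _, _, h⟩ := h; exact ⟨_, h⟩
  · exact ⟨_, h.2.2.1⟩
  · exact ⟨_, h.2.2.2⟩
  · exact ⟨_, h.2.1⟩

theorem Tame.of_plug {K : Ctx} {t : Tm} {A : Ty} (h : Tame τ M R β Δ Γ (K.plug t) A) :
    ∃ B, Tame τ M R β Δ (extend K.binds Γ) t B := by
  induction K generalizing Γ A with
  | nil => exact ⟨A, h⟩
  | cons F K ih =>
    obtain ⟨B, hB⟩ := Tame.of_frame (F := F) (t := Ctx.plug K t) h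
    rw [Ctx.binds, extend_append]
    exact ih hB

theorem Tame.not_structRule {t t' : Tm} {A : Ty} (h : Tame τ M R β Δ Γ t A) : ¬ StructRule t t' := by
  intro hs
  cases hs with
  | fst => obtain ⟨_, _, h⟩ := h; exact h
  | snd => obtain ⟨_, _, h⟩ := h; exact h
  | perm A B t u v ξ =>
    rcases ξ with _ | (_ | _) | _ | _
    · obtain ⟨_, _, h, _⟩ := h; exact h
    · obtain ⟨_, _, h⟩ := h; exact h
    · obtain ⟨_, _, h⟩ := h; exact h
    · exact h.2.1
    · exact h.2.2.2

/-- The principal type of a logical redex is an implication or a disjunction and has rank at least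
one, so the bound zero leaves no such redex. -/
theorem Tame.not_logicalRule {t t' : Tm} {A : Ty} (h : Tame 0 M R β Δ Γ t A) : ¬ LogicalRule t t' := by
  intro hs
  cases hs with
  | beta => obtain ⟨_, _, h, _⟩ := h; simp [Principal, Ty.rank] at h
  | caseL => have h := h.2.1; simp [Principal, Ty.rank] at h
  | caseR => have h := h.2.1; simp [Principal, Ty.rank] at h

theorem Tame.not_inside {S : (ℕ → Bool) → Tm → Tm → Prop} {t t' : Tm} {A : Ty}
    (h : Tame τ M R β Δ Γ t A)
    (hS : ∀ {α t t' Γ A}, Tame τ M R β Δ Γ t A → ¬ S α t t') : ¬ Inside S α t t' := by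
  intro hs
  induction hs generalizing Γ A with
  | root h' => exact hS h h'
  | frame F _ ih => obtain ⟨B, h⟩ := h.of_frame; exact ih h
  | parL => exact h
  | parR => exact h
  | ses => exact h

theorem Tame.not_structStep {t t' : Tm} {A : Ty} (h : Tame τ M R β Δ Γ t A) :
    ¬ StructStep α t t' :=
  h.not_inside fun h => h.not_structRule

theorem NF.not_intStep {t t' : Tm} {A : Ty} (h : NF M R Δ Γ t A) :
    ¬ Inside (fun _ => IntRule) α t t' :=
  Tame.not_inside h fun h h' => h'.elim (Tame.not_logicalRule h) (Tame.not_structRule h)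

end


section

variable {τ M N : ℕ} {R R' : ℕ → Prop} {β β' : ℕ → Bool} {Δ Δ' : ℕ → Ty × Ty} {Γ Γ' : ℕ → Ty}
  {α : ℕ → Bool}

/-! ### Counting the occurrences of a channel -/

/-- The number of occurrences of the channel with index `k` in a simply typed term. -/
def chanCount (k : ℕ) : Tm → ℕ
  | .lam _ u => chanCount k u
  | .app t u => chanCount k t + chanCount k u
  | .pair u v => chanCount k u + chanCount k v
  | .proj _ u => chanCount k u
  | .inj _ _ u => chanCount k u
  | .case _ _ t u v => chanCount k t + (chanCount k u + chanCount k v)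
  | .efq _ u => chanCount k u
  | .chan l t => (if l = k then 1 else 0) + chanCount k t
  | _ => 0

theorem chanCount_ren {k k' : ℕ} {r c : ℕ → ℕ} (h : ∀ l, c l = k' ↔ l = k) (t : Tm) :
    chanCount k' (t.ren r c) = chanCount k t := by
  induction t generalizing r with
  | par => rfl
  | ses => rfl
  | _ => simp_all [Tm.ren, chanCount]

theorem chanCount_eq_zero {k : ℕ} {t : Tm} (ht : Simple t) :
    chanCount k t = 0 ↔ ¬ HasChan k t := by
  induction t with
  | par => exact ht.elim
  | ses => exact ht.elim
  | _ => simp_all [Simple, HasChan, chanCount]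

theorem chanCount_sub {k : ℕ} {u : Tm} {e : ℕ → Tm} (hu : chanCount k u = 0)
    (he : ∀ n, HasVar n u → chanCount k (e n) = 0) : chanCount k (u.sub e) = 0 := by
  have lift : ∀ {u : Tm} {e : ℕ → Tm}, (∀ n, HasVar (n + 1) u → chanCount k (e n) = 0) →
      ∀ n, HasVar n u →
      chanCount k ((cons (.var 0) fun n => (e n).ren Nat.succ id : ℕ → Tm) n) = 0 := by
    intro u e he n hn
    cases n with
    | zero => rfl
    | succ n => exact (chanCount_ren (c := id) (fun _ => Iff.rfl) _).trans (he n hn)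
  induction u generalizing e with
  | var n => exact he n rfl
  | lam A u ih => exact ih hu (lift he)
  | case A B t u v iht ihu ihv =>
    simp only [chanCount, Nat.add_eq_zero_iff] at hu
    simp only [Tm.sub, chanCount, Nat.add_eq_zero_iff]
    exact ⟨iht hu.1 fun n h => he n (.inl h), ihu hu.2.1 (lift fun n h => he n (.inr (.inl h))),
      ihv hu.2.2 (lift fun n h => he n (.inr (.inr h)))⟩
  | par => rfl
  | ses => rfl
  | _ => simp_all [Tm.sub, chanCount, HasVar]

/-! ### Eliminations up to projections and permutations -/

/-- Projections and case permutations in finitely many steps. -/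
abbrev StructReduces (α : ℕ → Bool) : Tm → Tm → Prop := Reduces (fun _ => StructRule) α

theorem structReduces_perm (A B t u v) (ξ : Elim) : StructReduces α (ξ.plug (.case A B t u v))
    (.case A B t ((ξ.ren Nat.succ id).plug u) ((ξ.ren Nat.succ id).plug v)) :=
  .root (.perm A B t u v ξ)

/-- Unlike `nf_app`, this keeps the application redexes, whose ranks `htN` bounds by `τ`, and only
performs permutations. These copy `u` into several branches; since `u` has no occurrence of `k`, the
number of occurrences does not grow. -/
theorem tame_app {k : ℕ} {t u : Tm} {A B : Ty} (ht : Tame τ M R β Δ Γ t (.imp A B))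
    (htN : ValueLE τ t (.imp A B)) (hu : Tame τ M R β Δ Γ u A) (hk : chanCount k u = 0) :
    ∃ r, StructReduces α (.app t u) r ∧ Tame τ M R β Δ Γ r B ∧ (∀ N, ValueLE N r B) ∧
      chanCount k r ≤ chanCount k t := by
  induction t generalizing Γ u with
  | case A' B' s p q _ ihp ihq =>
    obtain ⟨h1, h2, h3, h4⟩ := ht
    have hk' : chanCount k (u.ren Nat.succ id) = 0 := by
      rwa [chanCount_ren (c := id) fun _ => Iff.rfl]
    obtain ⟨p', hp1, hp2, hp3, hp4⟩ := ihp h3 htN.1 (hu.weaken _) hk'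
    obtain ⟨q', hq1, hq2, hq3, hq4⟩ := ihq h4 htN.2 (hu.weaken _) hk'
    exact ⟨.case A' B' s p' q',
      (structReduces_perm A' B' s p q (.arg u)).trans (Reduces.case _ _ .refl hp1 hq1),
      ⟨h1, h2, hp2, hq2⟩, fun N => ⟨hp3 N, hq3 N⟩, by simp only [chanCount]; omega⟩
  | tt => cases ht
  | pair => obtain ⟨_, _, h, _⟩ := ht; cases h
  | inj i => cases i <;> obtain ⟨_, h, _⟩ := ht <;> cases h
  | efq => obtain ⟨rfl, h, _⟩ := ht; exact h.elim
  | par => exact ht.elim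
  | ses => exact ht.elim
  | lam => exact ⟨_, .refl, ⟨A, ht, htN, hu⟩, fun _ => trivial, (by simp [chanCount, hk])⟩
  | _ => exact ⟨_, .refl, ⟨A, ht, trivial, hu⟩, fun _ => trivial, (by simp [chanCount, hk])⟩

theorem tame_fst {k : ℕ} {t : Tm} {A B : Ty} (ht : Tame τ M R β Δ Γ t (.and A B)) :
    ∃ r, StructReduces α (.proj false t) r ∧ Tame τ M R β Δ Γ r A ∧
      (∀ N, ValueLE N t (.and A B) → ValueLE N r A) ∧ chanCount k r ≤ chanCount k t := by
  induction t generalizing Γ with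
  | pair u v =>
    obtain ⟨_, _, h, h1, h2⟩ := ht
    cases h
    exact ⟨u, .root (.fst u v), h1, fun N h => h.1, by simp [chanCount]⟩
  | case A' B' s p q _ ihp ihq =>
    obtain ⟨h1, h2, h3, h4⟩ := ht
    obtain ⟨p', hp1, hp2, hp3, hp4⟩ := ihp h3
    obtain ⟨q', hq1, hq2, hq3, hq4⟩ := ihq h4
    exact ⟨.case A' B' s p' q',
      (structReduces_perm A' B' s p q (.proj false)).trans (Reduces.case _ _ .refl hp1 hq1),
      ⟨h1, h2, hp2, hq2⟩, fun N h => ⟨hp3 N h.1, hq3 N h.2⟩, by simp only [chanCount]; omega⟩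
  | lam => obtain ⟨_, h, _⟩ := ht; cases h
  | tt => cases ht
  | inj i => cases i <;> obtain ⟨_, h, _⟩ := ht <;> cases h
  | efq => obtain ⟨rfl, h, _⟩ := ht; exact h.elim
  | par => exact ht.elim
  | ses => exact ht.elim
  | _ => exact ⟨_, .refl, ⟨B, ht, trivial⟩, fun _ _ => trivial, le_rfl⟩

theorem tame_snd {k : ℕ} {t : Tm} {A B : Ty} (ht : Tame τ M R β Δ Γ t (.and A B)) :
    ∃ r, StructReduces α (.proj true t) r ∧ Tame τ M R β Δ Γ r B ∧
      (∀ N, ValueLE N t (.and A B) → ValueLE N r B) ∧ chanCount k r ≤ chanCount k t := by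
  induction t generalizing Γ with
  | pair u v =>
    obtain ⟨_, _, h, h1, h2⟩ := ht
    cases h
    exact ⟨v, .root (.snd u v), h2, fun N h => h.2, by simp [chanCount]⟩
  | case A' B' s p q _ ihp ihq =>
    obtain ⟨h1, h2, h3, h4⟩ := ht
    obtain ⟨p', hp1, hp2, hp3, hp4⟩ := ihp h3
    obtain ⟨q', hq1, hq2, hq3, hq4⟩ := ihq h4
    exact ⟨.case A' B' s p' q',
      (structReduces_perm A' B' s p q (.proj true)).trans (Reduces.case _ _ .refl hp1 hq1),
      ⟨h1, h2, hp2, hq2⟩, fun N h => ⟨hp3 N h.1, hq3 N h.2⟩, by simp only [chanCount]; omega⟩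
  | lam => obtain ⟨_, h, _⟩ := ht; cases h
  | tt => cases ht
  | inj i => cases i <;> obtain ⟨_, h, _⟩ := ht <;> cases h
  | efq => obtain ⟨rfl, h, _⟩ := ht; exact h.elim
  | par => exact ht.elim
  | ses => exact ht.elim
  | _ => exact ⟨_, .refl, ⟨A, ht, trivial⟩, fun _ _ => trivial, le_rfl⟩

theorem tame_efq {k : ℕ} {t : Tm} {P : Ty} (hP : P.IsEfqAtom) (ht : Tame τ M R β Δ Γ t .bot) :
    ∃ r, StructReduces α (.efq P t) r ∧ Tame τ M R β Δ Γ r P ∧ (∀ N, ValueLE N r P) ∧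
      chanCount k r ≤ chanCount k t := by
  induction t generalizing Γ with
  | case A' B' s p q _ ihp ihq =>
    obtain ⟨h1, h2, h3, h4⟩ := ht
    obtain ⟨p', hp1, hp2, hp3, hp4⟩ := ihp h3
    obtain ⟨q', hq1, hq2, hq3, hq4⟩ := ihq h4
    exact ⟨.case A' B' s p' q',
      (structReduces_perm A' B' s p q (.efq P)).trans (Reduces.case _ _ .refl hp1 hq1),
      ⟨h1, h2, hp2, hq2⟩, fun N => ⟨hp3 N, hq3 N⟩, by simp only [chanCount]; omega⟩
  | lam => obtain ⟨_, h, _⟩ := ht; cases h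
  | tt => cases ht
  | pair => obtain ⟨_, _, h, _⟩ := ht; cases h
  | inj i => cases i <;> obtain ⟨_, h, _⟩ := ht <;> cases h
  | efq => obtain ⟨rfl, h, _⟩ := ht; exact h.elim
  | par => exact ht.elim
  | ses => exact ht.elim
  | _ => exact ⟨_, .refl, ⟨rfl, hP, ht, trivial⟩, fun _ => trivial, le_rfl⟩

/-- The branches are copied by the permutations, so again they must be free of `k`. Injection
redexes are left in place, bounded by `htN`. -/
theorem tame_case {k : ℕ} {t u v : Tm} {A B C : Ty} (ht : Tame τ M R β Δ Γ t (.or A B))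
    (htN : ValueLE τ t (.or A B)) (hu : Tame τ M R β Δ (cons A Γ) u C)
    (hv : Tame τ M R β Δ (cons B Γ) v C) (hku : chanCount k u = 0) (hkv : chanCount k v = 0) :
    ∃ r, StructReduces α (.case A B t u v) r ∧ Tame τ M R β Δ Γ r C ∧
      (∀ N, ValueLE N u C → ValueLE N v C → ValueLE N r C) ∧ chanCount k r ≤ chanCount k t := by
  induction t generalizing Γ u v with
  | inj => exact ⟨_, .refl, ⟨ht, htN, hu, hv⟩, fun _ h h' => ⟨h, h'⟩, by simp [chanCount, hku, hkv]⟩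
  | case A' B' s p q _ ihp ihq =>
    obtain ⟨h1, h2, h3, h4⟩ := ht
    have hw : ∀ D E w, Tame τ M R β Δ (cons E Γ) w C →
        Tame τ M R β Δ (cons E (cons D Γ)) (w.ren (liftRen Nat.succ) id) C := fun D E w hw =>
      hw.ren (cons_liftRen (fun _ => rfl) E) fun _ _ => ⟨rfl, id, rfl⟩
    have hk : ∀ {w}, chanCount k w = 0 → chanCount k (w.ren (liftRen Nat.succ) id) = 0 := by
      intro w hw
      rwa [chanCount_ren (c := id) fun _ => Iff.rfl]
    obtain ⟨p', hp1, hp2, hp3, hp4⟩ :=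
      ihp h3 htN.1 (hw _ _ _ hu) (hw _ _ _ hv) (hk hku) (hk hkv)
    obtain ⟨q', hq1, hq2, hq3, hq4⟩ :=
      ihq h4 htN.2 (hw _ _ _ hu) (hw _ _ _ hv) (hk hku) (hk hkv)
    exact ⟨.case A' B' s p' q',
      (structReduces_perm A' B' s p q (.case A B u v)).trans (Reduces.case _ _ .refl hp1 hq1),
      ⟨h1, h2, hp2, hq2⟩, fun N h' h'' =>
      ⟨hp3 N ((valueLE_ren _ _).2 h') ((valueLE_ren _ _).2 h''),
        hq3 N ((valueLE_ren _ _).2 h') ((valueLE_ren _ _).2 h'')⟩,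
      by simp only [chanCount]; omega⟩
  | lam => obtain ⟨_, h, _⟩ := ht; cases h
  | tt => cases ht
  | pair => obtain ⟨_, _, h, _⟩ := ht; cases h
  | efq => obtain ⟨rfl, h, _⟩ := ht; exact h.elim
  | par => exact ht.elim
  | ses => exact ht.elim
  | _ =>
    exact ⟨_, .refl, ⟨ht, trivial, hu, hv⟩, fun _ h h' => ⟨h, h'⟩, by simp [chanCount, hku, hkv]⟩

theorem tupleProj_succ (n q : ℕ) (t : Tm) :
    tupleProj (n + 1) (q + 1) t = tupleProj n q (.proj true t) := by
  simp [tupleProj]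

theorem tame_tupleProj {k : ℕ} {l : List Ty} {q : ℕ} (hq : q < l.length) {t : Tm}
    (ht : Tame τ M R β Δ Γ t (Ty.conj l)) :
    ∃ r, StructReduces α (tupleProj l.length q t) r ∧ Tame τ M R β Δ Γ r l[q] ∧
      (∀ N, ValueLE N t (Ty.conj l) → ValueLE N r l[q]) ∧ chanCount k r ≤ chanCount k t := by
  induction l generalizing q t with
  | nil => simp at hq
  | cons A l ih =>
    cases l with
    | nil =>
      obtain rfl : q = 0 := by simpa using hq
      exact ⟨t, .refl, ht, fun _ h => h, le_rfl⟩
    | cons B l =>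
      cases q with
      | zero => exact tame_fst ht
      | succ q =>
        obtain ⟨r, h1, h2, h3, h4⟩ := tame_snd (α := α) (k := k) ht
        have hq' : q < (B :: l).length := by simpa using hq
        obtain ⟨r', h1', h2', h3', h4'⟩ := ih hq' h2
        refine ⟨r', ?_, h2', fun N h => h3' N (h3 N h), h4'.trans h4⟩
        -- The innermost second projection is contracted first; the remaining projections then
        -- belong to the tail of the tuple.
        rw [List.length_cons, tupleProj_succ]
        refine Relation.ReflTransGen.trans ?_ h1'
        generalize (B :: l).length = n
        have it : ∀ q {t t'}, StructReduces α t t' →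
            StructReduces α ((Tm.proj true)^[q] t) ((Tm.proj true)^[q] t') := by
          intro q
          induction q with
          | zero => exact fun h => h
          | succ q ih => exact fun h => ih (h.proj true)
        unfold tupleProj
        split
        · exact it q h1
        · exact (it q h1).proj false

/-! ### Substitution of inert terms -/

/-- Projections of variables and of inactive channel applications. -/
def Inert (β : ℕ → Bool) : Tm → Prop
  | .var _ => True
  | .chan k _ => β k = false
  | .proj _ t => Inert β t
  | _ => False

theorem Inert.not_activeHead {t : Tm} (h : Inert β t) : ¬ ActiveHead β t := by
  induction t with
  | chan k t => simp_all [Inert, ActiveHead]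
  | proj i t ih => exact ih h
  | var => exact id
  | _ => exact h.elim

theorem Inert.not_isValue {t : Tm} (h : Inert β t) : ¬ IsValue β t := by
  cases t <;> first | exact h.not_activeHead | exact h.elim

theorem Inert.valueLE {t : Tm} (h : Inert β t) (T : Ty) : ValueLE N t T :=
  valueLE_of_not_isValue h.not_isValue T

theorem Inert.principal {t : Tm} (h : Inert β t) (T : Ty) : Principal N t T := by
  cases t <;> trivial

theorem Inert.ren {t : Tm} (h : Inert β t) (r : ℕ → ℕ) : Inert β (t.ren r id) := by
  induction t with
  | proj i t ih => exact ih h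
  | _ => exact h

theorem Inert.cons {u : Tm} {e : ℕ → Tm} (he : ∀ n, HasVar (n + 1) u → Inert β (e n)) :
    ∀ n, HasVar n u → Inert β ((LamAx.cons (.var 0) fun n => (e n).ren Nat.succ id : ℕ → Tm) n) := by
  intro n hn
  cases n with
  | zero => trivial
  | succ n => exact (he n hn).ren _

theorem ValueLE.sub {u : Tm} {e : ℕ → Tm} {T : Ty} (h : ValueLE N u T)
    (he : ∀ n, HasVar n u → Inert β (e n)) : ValueLE N (u.sub e) T := by
  induction u generalizing e T with
  | var n => exact (he n rfl).valueLE T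
  | pair u v hu hv =>
    cases T <;> first
    | trivial
    | exact ⟨hu h.1 fun n hn => he n (.inl hn), hv h.2 fun n hn => he n (.inr hn)⟩
  | case A B t u v _ hu hv =>
    exact ⟨hu h.1 (Inert.cons fun n hn => he n (.inr (.inl hn))),
      hv h.2 (Inert.cons fun n hn => he n (.inr (.inr hn)))⟩
  | _ => exact h

theorem Principal.sub {u : Tm} {e : ℕ → Tm} {T : Ty} (h : Principal N u T)
    (he : ∀ n, HasVar n u → Inert β (e n)) : Principal N (u.sub e) T := by
  cases u with
  | var n => exact (he n rfl).principal T
  | _ => exact h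

theorem ActiveHead.of_sub {u : Tm} {e : ℕ → Tm} (h : ActiveHead β (u.sub e))
    (he : ∀ n, HasVar n u → Inert β (e n)) : ActiveHead β u := by
  induction u generalizing e with
  | var n => exact ((he n rfl).not_activeHead h).elim
  | app t u ih _ => exact ih h fun n hn => he n (.inl hn)
  | proj i t ih => exact ih h fun n hn => he n hn
  | case A B t u v ih _ _ => exact ih h fun n hn => he n (.inl hn)
  | efq P t ih => exact ih h fun n hn => he n hn
  | _ => exact h

theorem IsValue.of_sub {u : Tm} {e : ℕ → Tm} (h : IsValue β (u.sub e))
    (he : ∀ n, HasVar n u → Inert β (e n)) : IsValue β u := by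
  induction u generalizing e with
  | var n => exact ((he n rfl).not_isValue h).elim
  | pair u v hu hv =>
    exact h.imp (fun h => hu h fun n hn => he n (.inl hn))
      (fun h => hv h fun n hn => he n (.inr hn))
  | app t u => exact ActiveHead.of_sub (u := .app t u) h he
  | proj i t => exact ActiveHead.of_sub (u := .proj i t) h he
  | _ => exact h

/-- Inert terms are neither values nor heads of redexes, so they can replace variables without
creating a redex or turning a message into a value. No normalization is needed after this
substitution. -/
theorem Tame.sub {u : Tm} {e : ℕ → Tm} {A : Ty} (hu : Tame τ M R β Δ Γ u A)
    (he : ∀ n, HasVar n u → Tame τ M R β Δ Γ' (e n) (Γ n)) (hi : ∀ n, HasVar n u → Inert β (e n)) :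
    Tame τ M R β Δ Γ' (u.sub e) A := by
  have lift : ∀ {Γ Γ' : ℕ → Ty} {u : Tm} {e : ℕ → Tm},
      (∀ n, HasVar (n + 1) u → Tame τ M R β Δ Γ' (e n) (Γ n)) → ∀ B n, HasVar n u →
      Tame τ M R β Δ (cons B Γ') ((cons (.var 0) fun n => (e n).ren Nat.succ id : ℕ → Tm) n)
        (cons B Γ n) := by
    intro Γ Γ' u e he B n hn
    cases n with
    | zero => rfl
    | succ n => exact (he n hn).weaken B
  induction u generalizing e Γ Γ' A with
  | var n => cases hu; exact he n rfl
  | tt => exact hu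
  | lam B u ih =>
    obtain ⟨C, rfl, h⟩ := hu
    exact ⟨C, rfl, ih h (lift he B) (Inert.cons hi)⟩
  | app t u iht ihu =>
    obtain ⟨B, h1, h2, h3⟩ := hu
    have hi1 := fun n hn => hi n (.inl hn)
    exact ⟨B, iht h1 (fun n hn => he n (.inl hn)) hi1, h2.sub hi1,
      ihu h3 (fun n hn => he n (.inr hn)) fun n hn => hi n (.inr hn)⟩
  | pair t u iht ihu =>
    obtain ⟨B, C, rfl, h1, h3⟩ := hu
    exact ⟨B, C, rfl, iht h1 (fun n hn => he n (.inl hn)) fun n hn => hi n (.inl hn),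
      ihu h3 (fun n hn => he n (.inr hn)) fun n hn => hi n (.inr hn)⟩
  | proj i u ih =>
    cases i <;> obtain ⟨B, h1, h2⟩ := hu <;> exact ⟨B, ih h1 he hi, h2.sub hi⟩
  | inj i C u ih => cases i <;> obtain ⟨B, rfl, h1⟩ := hu <;> exact ⟨B, rfl, ih h1 he hi⟩
  | case A B t u v iht ihu ihv =>
    obtain ⟨h1, h2, h3, h4⟩ := hu
    have hi1 := fun n hn => hi n (.inl hn)
    exact ⟨iht h1 (fun n hn => he n (.inl hn)) hi1, h2.sub hi1,
      ihu h3 (lift (fun n hn => he n (.inr (.inl hn))) _)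
        (Inert.cons fun n hn => hi n (.inr (.inl hn))),
      ihv h4 (lift (fun n hn => he n (.inr (.inr hn))) _)
        (Inert.cons fun n hn => hi n (.inr (.inr hn)))⟩
  | efq P u ih =>
    obtain ⟨h1, h2, h3, h4⟩ := hu
    exact ⟨h1, h2, ih h3 he hi, h4.sub hi⟩
  | chan k u ih =>
    obtain ⟨h1, h2, h3⟩ := hu
    exact ⟨h1, ih h2 he hi, fun h => ⟨fun hb => ((h3 h).1 hb).sub hi,
      fun hb hv => (h3 h).2 hb (hv.of_sub hi)⟩⟩
  | par => exact hu.elim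
  | ses => exact hu.elim

theorem Inert.tupleProj {t : Tm} (h : Inert β t) (n q : ℕ) : Inert β (tupleProj n q t) := by
  have it : ∀ q {t}, Inert β t → Inert β ((Tm.proj true)^[q] t) := by
    intro q
    induction q with
    | zero => exact fun h => h
    | succ q ih => exact fun h => ih h
  unfold LamAx.tupleProj
  split <;> exact it q h

theorem Tame.tupleProj {l : List Ty} {q : ℕ} (hq : q < l.length) {t : Tm} (hi : Inert β t)
    (ht : Tame τ M R β Δ Γ t (Ty.conj l)) :
    Tame τ M R β Δ Γ (LamAx.tupleProj l.length q t) l[q] := by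
  induction l generalizing q t with
  | nil => simp at hq
  | cons A l ih =>
    cases l with
    | nil =>
      obtain rfl : q = 0 := by simpa using hq
      exact ht
    | cons B l =>
      cases q with
      | zero => exact ⟨_, ht, hi.principal _⟩
      | succ q =>
        rw [List.length_cons, tupleProj_succ]
        exact ih (t := .proj true t) (by simpa using hq) hi ⟨_, ht, hi.principal _⟩

theorem chanCount_tupleProj (k n q : ℕ) (t : Tm) :
    chanCount k (tupleProj n q t) = chanCount k t := by
  have it : ∀ q t, chanCount k ((Tm.proj true)^[q] t) = chanCount k t := by
    intro q
    induction q with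
    | zero => exact fun _ => rfl
    | succ q ih => exact fun t => ih (.proj true t)
  unfold tupleProj
  split
  · exact it q t
  · exact it q t

end


section

variable {τ M N : ℕ} {R R' : ℕ → Prop} {β β' : ℕ → Bool} {Δ Δ' : ℕ → Ty × Ty} {Γ Γ' : ℕ → Ty}
  {α : ℕ → Bool}

/-! ### Replacing the rightmost application of the active channel -/

/-- Search from the right: descend into the last subterm that contains the channel, and stop at an
application whose argument does not contain it. -/
theorem exists_rightmostSend {u : Tm} (hu : Simple u) (h : HasChan 0 u) :
    ∃ K t, RightmostSend u K t := by
  have key : ∀ u : Tm, Simple u → HasChan 0 u → ∃ (K : Ctx) (t : Tm), u = K.plug (.chan 0 t) ∧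
      ¬ HasChan 0 t ∧ ∀ F ∈ K, ¬ F.HasChanRight 0 := by
    have step : ∀ (F : Frame) (u : Tm), ¬ F.HasChanRight 0 →
        (∃ (K : Ctx) (t : Tm), u = K.plug (.chan 0 t) ∧ ¬ HasChan 0 t ∧
          ∀ F ∈ K, ¬ F.HasChanRight 0) →
        ∃ (K : Ctx) (t : Tm), F.plug u = K.plug (.chan 0 t) ∧ ¬ HasChan 0 t ∧
          ∀ F ∈ K, ¬ F.HasChanRight 0 := by
      rintro F _ hF ⟨K, t, rfl, h1, h2⟩
      exact ⟨F :: K, t, rfl, h1, by simpa [hF] using h2⟩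
    intro u hu h
    induction u with
    | var => exact h.elim
    | tt => exact h.elim
    | lam A u ih => exact step (.lam A) u id (ih hu h)
    | app t u iht ihu =>
      by_cases h' : HasChan 0 u
      · exact step (.appR t) u id (ihu hu.2 h')
      · exact step (.elim (.arg u)) t h' (iht hu.1 (h.resolve_right h'))
    | pair t u iht ihu =>
      by_cases h' : HasChan 0 u
      · exact step (.pairR t) u id (ihu hu.2 h')
      · exact step (.pairL u) t h' (iht hu.1 (h.resolve_right h'))
    | proj i u ih => exact step (.elim (.proj i)) u id (ih hu h)
    | inj i C u ih => exact step (.inj i C) u id (ih hu h)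
    | case A B t u v iht ihu ihv =>
      by_cases hv : HasChan 0 v
      · exact step (.caseR A B t u) v id (ihv hu.2.2 hv)
      · by_cases hu' : HasChan 0 u
        · exact step (.caseL A B t v) u hv (ihu hu.2.1 hu')
        · exact step (.elim (.case A B u v)) t (fun h => h.elim hu' hv)
            (iht hu.1 (h.resolve_right fun h => h.elim hu' hv))
    | efq P u ih => exact step (.elim (.efq P)) u id (ih hu h)
    | chan k t ih =>
      by_cases h' : HasChan 0 t
      · exact step (.chan k) t id (ih hu h')
      · obtain rfl := h.resolve_right h'
        exact ⟨[], t, rfl, h', by simp⟩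
    | par => exact hu.elim
    | ses => exact hu.elim
  obtain ⟨K, t, h1, h2, h3⟩ := key u hu h
  exact ⟨K, t, h1, hu, h2, h3⟩

/-- What is preserved when `h : A` becomes `r` by the replacement of an application of an active
channel. -/
structure Replaces (τ : ℕ) (β β' : ℕ → Bool) (h r : Tm) (A : Ty) : Prop where
  valueLE : ∀ N, τ ≤ N → ValueLE N h A → ValueLE N r A
  isValue : IsValue β' r → IsValue β h
  activeHead : ActiveHead β' r → ActiveHead β h
  principal : ActiveHead β h ∨ (Principal τ h A → Principal τ r A)
  count : chanCount 0 r < chanCount 0 h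

/-- The effect of one reception, by induction on the context. The hole either stays the head of the
surrounding eliminations, in which case the term was headed by the active channel and the projection
and permutation redexes created there are removed at once, or it is no longer in head position and
enclosing eliminations stay as they were. Redexes of the first kind have rank at most `τ` because of
the value bound on `r`. As no frame has the channel to the right of its hole, nothing that
permutations duplicate contains it, and one occurrence is lost. -/
theorem exists_replaces {c : ℕ → ℕ}
    (hc : ∀ k, Δ' (c k) = Δ k ∧ (R' (c k) → R k) ∧ β' (c k) = β k) (hc0 : ∀ l, c l = 0 ↔ l = 0)
    (hβ : β 0 = true) {K : Ctx} {t r : Tm} {A : Ty}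
    (hK : Tame τ τ R β Δ Γ (K.plug (.chan 0 t)) A) (hr : ∀ F ∈ K, ¬ F.HasChanRight 0)
    (h1 : Tame τ τ R' β' Δ' (extend K.binds Γ) r (Δ 0).2) (h2 : ValueLE τ r (Δ 0).2)
    (h3 : chanCount 0 r = 0) :
    ∃ r', StructReduces α ((K.renChan c).plug r) r' ∧ Tame τ τ R' β' Δ' Γ r' A ∧
      Replaces τ β β' (K.plug (.chan 0 t)) r' A := by
  have hren : ∀ {Γ u B}, Tame τ τ R β Δ Γ u B → Tame τ τ R' β' Δ' Γ (u.ren id c) B :=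
    fun hu => hu.ren (fun _ => rfl) fun k _ => hc k
  have hren' : ∀ {Γ D u B}, Tame τ τ R β Δ (cons D Γ) u B →
      Tame τ τ R' β' Δ' (cons D Γ) (u.ren (liftRen id) c) B :=
    fun hu => hu.ren (cons_liftRen (fun _ => rfl) _) fun k _ => hc k
  have hcnt : ∀ {u r}, chanCount 0 (u.ren r c) = chanCount 0 u := chanCount_ren hc0 _
  have hcnt0 : ∀ {Γ u B r}, Tame τ τ R β Δ Γ u B → ¬ HasChan 0 u → chanCount 0 (u.ren r c) = 0 :=
    fun hu h => hcnt.trans ((chanCount_eq_zero hu.simple).2 h)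
  induction K generalizing Γ A with
  | nil =>
    obtain ⟨rfl, -, -⟩ := hK
    -- The replaced term is an application of an active channel, hence already a value with an
    -- active head; whatever is received, these properties cannot be new.
    exact ⟨r, .refl, h1, fun N hN _ => h2.mono hN, fun _ => hβ, fun _ => hβ, .inl hβ,
      by simp [Ctx.plug, chanCount, h3]⟩
  | cons F K ih =>
    rw [Ctx.binds, extend_append] at h1
    have hF := hr F (by simp)
    have hr' : ∀ F ∈ K, ¬ F.HasChanRight 0 := fun F h => hr F (by simp [h])
    change Tame τ τ R β Δ Γ (F.plug (Ctx.plug K (.chan 0 t))) A at hK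
    change ∃ r', StructReduces α ((F.renChan c).plug (Ctx.plug (Ctx.renChan c K) r)) r' ∧ _ ∧
      Replaces τ β β' (F.plug (Ctx.plug K (.chan 0 t))) r' A
    rcases F with (u | (_ | _) | ⟨D, E, u, v⟩ | P) | w | D | ⟨_ | _, D⟩ | w | w | ⟨D, E, s, v⟩ | ⟨D, E, s, u⟩ | k
    · obtain ⟨B, hK, hp, hu⟩ := hK
      obtain ⟨x, x1, x2, x3⟩ := ih hK hr' h1
      have x1' := x1.frame (.elim (.arg (u.ren id c)))
      -- On the left the hole is in head position and the elimination may form a new redex with what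
      -- was received; on the right the elimination is as principal as before.
      rcases x3.principal with ha | ha
      · obtain ⟨y, y1, y2, y3, y4⟩ := tame_app (α := α) x2 (x3.valueLE τ le_rfl hp.valueLE) (hren hu)
          (hcnt0 hu hF)
        exact ⟨y, x1'.trans y1, y2, fun N _ _ => y3 N, fun _ => ha, fun _ => ha, .inl ha,
          lt_of_lt_of_le (y4.trans_lt x3.count) (Nat.le_add_right _ _)⟩
      · exact ⟨_, x1', ⟨B, x2, ha hp, hren hu⟩, fun N _ _ => trivial, x3.activeHead, x3.activeHead,
          .inr fun _ => trivial, add_lt_add_of_lt_of_le x3.count hcnt.le⟩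
    · obtain ⟨B, hK, hp⟩ := hK
      obtain ⟨x, x1, x2, x3⟩ := ih hK hr' h1
      have x1' := x1.frame (.elim (.proj false))
      rcases x3.principal with ha | ha
      · obtain ⟨y, y1, y2, y3, y4⟩ := tame_fst (α := α) (k := 0) x2
        exact ⟨y, x1'.trans y1, y2,
          fun N h _ => y3 N (x3.valueLE N h (hp.valueLE_of_and hK N)), fun _ => ha, fun _ => ha,
          .inl ha, y4.trans_lt x3.count⟩
      · exact ⟨_, x1', ⟨B, x2, ha hp⟩, fun N _ _ => trivial, x3.activeHead, x3.activeHead,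
          .inr fun _ => trivial, x3.count⟩
    · obtain ⟨B, hK, hp⟩ := hK
      obtain ⟨x, x1, x2, x3⟩ := ih hK hr' h1
      have x1' := x1.frame (.elim (.proj true))
      rcases x3.principal with ha | ha
      · obtain ⟨y, y1, y2, y3, y4⟩ := tame_snd (α := α) (k := 0) x2
        exact ⟨y, x1'.trans y1, y2,
          fun N h _ => y3 N (x3.valueLE N h (hp.valueLE_of_and hK N)), fun _ => ha, fun _ => ha,
          .inl ha, y4.trans_lt x3.count⟩
      · exact ⟨_, x1', ⟨B, x2, ha hp⟩, fun N _ _ => trivial, x3.activeHead, x3.activeHead,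
          .inr fun _ => trivial, x3.count⟩
    · obtain ⟨hK, hp, hu, hv⟩ := hK
      obtain ⟨x, x1, x2, x3⟩ := ih hK hr' h1
      have x1' := x1.frame (.elim (.case D E (u.ren (liftRen id) c) (v.ren (liftRen id) c)))
      rcases x3.principal with ha | ha
      · obtain ⟨y, y1, y2, y3, y4⟩ := tame_case (α := α) x2 (x3.valueLE τ le_rfl hp.valueLE)
          (hren' hu) (hren' hv) (hcnt0 hu fun h => hF (.inl h)) (hcnt0 hv fun h => hF (.inr h))
        exact ⟨y, x1'.trans y1, y2,
          fun N _ h => y3 N ((valueLE_ren _ _).2 h.1) ((valueLE_ren _ _).2 h.2),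
          fun _ => trivial, fun _ => ha, .inl ha,
          lt_of_lt_of_le (y4.trans_lt x3.count) (Nat.le_add_right _ _)⟩
      · exact ⟨_, x1', ⟨x2, ha hp, hren' hu, hren' hv⟩,
          fun N _ h => ⟨(valueLE_ren _ _).2 h.1, (valueLE_ren _ _).2 h.2⟩, fun _ => trivial,
          x3.activeHead, .inr fun h => h, add_lt_add_of_lt_of_le x3.count
            (add_le_add hcnt.le hcnt.le)⟩
    · obtain ⟨rfl, hP, hK, hp⟩ := hK
      obtain ⟨x, x1, x2, x3⟩ := ih hK hr' h1
      have x1' := x1.frame (.elim (.efq A))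
      rcases x3.principal with ha | ha
      · obtain ⟨y, y1, y2, y3, y4⟩ := tame_efq (α := α) (k := 0) hP x2
        exact ⟨y, x1'.trans y1, y2, fun N _ _ => y3 N, fun _ => trivial, fun _ => ha,
          .inl ha, y4.trans_lt x3.count⟩
      · exact ⟨_, x1', ⟨rfl, hP, x2, ha hp⟩, fun N _ _ => trivial, fun _ => trivial, x3.activeHead,
          .inr fun _ => trivial, x3.count⟩
    · obtain ⟨B, hw, hp, hK⟩ := hK
      obtain ⟨x, x1, x2, x3⟩ := ih hK hr' h1
      have hact : ActiveHead β' (w.ren id c) → ActiveHead β w :=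
        (activeHead_ren id c fun k _ => (hc k).2.2).1
      exact ⟨_, x1.frame (.appR (w.ren id c)), ⟨B, hren hw, (principal_ren _ _).2 hp, x2⟩,
        fun N _ _ => trivial, hact, hact,
        .inr fun _ => trivial, add_lt_add_of_le_of_lt hcnt.le x3.count⟩
    · obtain ⟨C, rfl, hK⟩ := hK
      obtain ⟨x, x1, x2, x3⟩ := ih hK hr' h1
      exact ⟨_, x1.lam D, ⟨C, rfl, x2⟩, fun N _ h => h, fun _ => trivial, id, .inr fun h => h,
        x3.count⟩
    · obtain ⟨C, rfl, hK⟩ := hK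
      obtain ⟨x, x1, x2, x3⟩ := ih hK hr' h1
      exact ⟨_, x1.inj _ D, ⟨C, rfl, x2⟩, fun N _ h => h, fun _ => trivial, id, .inr fun h => h,
        x3.count⟩
    · obtain ⟨C, rfl, hK⟩ := hK
      obtain ⟨x, x1, x2, x3⟩ := ih hK hr' h1
      exact ⟨_, x1.inj _ D, ⟨C, rfl, x2⟩, fun N _ h => h, fun _ => trivial, id, .inr fun h => h,
        x3.count⟩
    · obtain ⟨B, C, rfl, hK, hw⟩ := hK
      obtain ⟨x, x1, x2, x3⟩ := ih hK hr' h1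
      exact ⟨_, x1.frame (.pairL (w.ren id c)), ⟨B, C, rfl, x2, hren hw⟩,
        fun N hN h => ⟨x3.valueLE N hN h.1, (valueLE_ren _ _).2 h.2⟩,
        Or.imp x3.isValue (isValue_ren id c fun k _ => (hc k).2.2).1, id, .inr fun h => h,
        add_lt_add_of_lt_of_le x3.count hcnt.le⟩
    · obtain ⟨B, C, rfl, hw, hK⟩ := hK
      obtain ⟨x, x1, x2, x3⟩ := ih hK hr' h1
      exact ⟨_, x1.frame (.pairR (w.ren id c)), ⟨B, C, rfl, hren hw, x2⟩,
        fun N hN h => ⟨(valueLE_ren _ _).2 h.1, x3.valueLE N hN h.2⟩,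
        Or.imp (isValue_ren id c fun k _ => (hc k).2.2).1 x3.isValue, id, .inr fun h => h,
        add_lt_add_of_le_of_lt hcnt.le x3.count⟩
    · obtain ⟨hs, hp, hK, hv⟩ := hK
      obtain ⟨x, x1, x2, x3⟩ := ih hK hr' h1
      exact ⟨_, x1.frame (.caseL D E (s.ren id c) (v.ren id c)), ⟨hren hs, (principal_ren _ _).2 hp, x2, hren hv⟩,
        fun N hN h => ⟨x3.valueLE N hN h.1, (valueLE_ren _ _).2 h.2⟩, fun _ => trivial,
        (activeHead_ren id c fun k _ => (hc k).2.2).1, .inr fun h => h,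
        add_lt_add_of_le_of_lt hcnt.le (add_lt_add_of_lt_of_le x3.count hcnt.le)⟩
    · obtain ⟨hs, hp, hu, hK⟩ := hK
      obtain ⟨x, x1, x2, x3⟩ := ih hK hr' h1
      exact ⟨_, x1.frame (.caseR D E (s.ren id c) (u.ren id c)), ⟨hren hs, (principal_ren _ _).2 hp, hren hu, x2⟩,
        fun N hN h => ⟨(valueLE_ren _ _).2 h.1, x3.valueLE N hN h.2⟩, fun _ => trivial,
        (activeHead_ren id c fun k _ => (hc k).2.2).1, .inr fun h => h,
        add_lt_add_of_le_of_lt hcnt.le (add_lt_add_of_le_of_lt hcnt.le x3.count)⟩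
    · obtain ⟨rfl, hK, hs⟩ := hK
      obtain ⟨x, x1, x2, x3⟩ := ih hK hr' h1
      obtain ⟨e1, e2, e3⟩ := hc k
      have hact : ActiveHead β' (.chan (c k) x) → ActiveHead β (.chan k (Ctx.plug K (.chan 0 t))) := by
        simp [ActiveHead, e3]
      refine ⟨_, x1.frame (.chan (c k)), ⟨by rw [e1], by rw [e1]; exact x2, fun h => ?_⟩,
        fun N _ _ => trivial, hact, hact, .inr fun h => h,
        add_lt_add_of_le_of_lt (by simp [hc0]) x3.count⟩
      rw [e1, e3]
      -- An enclosing active channel needs the value bound; for an inactive one, a value after the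
      -- replacement would have been a value before it.
      exact ⟨fun hb => x3.valueLE τ le_rfl ((hs (e2 h)).1 hb),
        fun hb hv => (hs (e2 h)).2 hb (x3.isValue hv)⟩

end


section

variable {τ M N : ℕ} {R R' : ℕ → Prop} {β β' : ℕ → Bool} {Δ Δ' : ℕ → Ty × Ty} {Γ Γ' : ℕ → Ty}
  {α : ℕ → Bool}

/-! ### Cross reductions -/

theorem extend_of_lt {l : List Ty} {n : ℕ} (h : n < l.length) (f : ℕ → Ty) :
    extend l f n = l.getD n .top := by
  induction l generalizing n with
  | nil => simp at h
  | cons x l ih =>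
    cases n with
    | zero => rfl
    | succ n => simpa [extend, cons] using ih (by simpa using h)

theorem extend_add {X : Type} (l : List X) (f : ℕ → X) (n : ℕ) :
    extend l f (n + l.length) = f n := by
  induction l with
  | nil => rfl
  | cons x l ih => exact ih

theorem HasVar.of_ren {n : ℕ} {t : Tm} {r c : ℕ → ℕ} (hr : ∀ n, r n = n)
    (h : HasVar n (t.ren r c)) : HasVar n t := by
  have lift : ∀ {r : ℕ → ℕ}, (∀ n, r n = n) → ∀ n, liftRen r n = n := by
    intro r hr n
    cases n with
    | zero => rfl
    | succ n => simp [liftRen, cons, hr]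
  induction t generalizing n r c with
  | var k => exact (hr k).symm.trans h
  | tt => exact h
  | lam A u ih => exact ih (lift hr) h
  | app t u iht ihu => exact h.imp (iht hr) (ihu hr)
  | pair t u iht ihu => exact h.imp (iht hr) (ihu hr)
  | proj i u ih => exact ih hr h
  | inj i C u ih => exact ih hr h
  | case A B t u v iht ihu ihv => exact h.imp (iht hr) (Or.imp (ihu (lift hr)) (ihv (lift hr)))
  | efq P u ih => exact ih hr h
  | chan k u ih => exact ih hr h
  | par t u iht ihu => exact h.imp (iht hr) (ihu hr)
  | ses ax s act us ih => exact h.imp fun i => ih i hr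

theorem Tame.tuple {ts : List Tm} {As : List Ty} (h : List.Forall₂ (Tame τ M R β Δ Γ) ts As) :
    Tame τ M R β Δ Γ (LamAx.tuple ts) (Ty.conj As) := by
  induction h with
  | nil => rfl
  | cons h1 h2 ih =>
    cases h2 with
    | nil => exact h1
    | cons h3 h4 => exact ⟨_, _, rfl, h1, ih⟩

theorem not_isValue_tuple {ts : List Tm} (h : ∀ t ∈ ts, ¬ IsValue β t) : ¬ IsValue β (tuple ts) := by
  induction ts with
  | nil => exact id
  | cons t ts ih =>
    cases ts with
    | nil => exact h t (by simp)
    | cons u ts => exact fun hv => hv.elim (h t (by simp)) (ih fun x hx => h x (by simp [hx]))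

theorem chanCount_tuple {k : ℕ} {ts : List Tm} (h : ∀ t ∈ ts, chanCount k t = 0) :
    chanCount k (tuple ts) = 0 := by
  induction ts with
  | nil => rfl
  | cons t ts ih =>
    cases ts with
    | nil => exact h t (by simp)
    | cons u ts =>
      exact Nat.add_eq_zero_iff.2 ⟨h t (by simp), ih fun x hx => h x (by simp [hx])⟩

theorem DisjAxiom.mem_of_source {ax : DisjAxiom} {p : ℕ} {j : Fin ax.m} (h : ax.source p = some j) :
    p ∈ ax.ante j := by
  simpa using List.find?_some h

/-- Distinctness of the variables in the antecedents makes the sending disjunct unique, so the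
search by `find?` cannot return another one. -/
theorem DisjAxiom.Admissible.source_eq {ax : DisjAxiom} (hax : ax.Admissible) {p : ℕ} {j : Fin ax.m}
    (h : p ∈ ax.ante j) : ax.source p = some j := by
  cases hs : ax.source p with
  | none =>
    have := List.find?_eq_none.1 hs j (List.mem_finRange j)
    simp [h] at this
  | some i =>
    by_contra hij
    exact hax.disjoint i j (fun h => hij (by rw [h])) (DisjAxiom.mem_of_source hs) h

theorem mem_captured {K : Ctx} {t : Tm} {n : ℕ} :
    n ∈ captured K t ↔ n < K.binds.length ∧ HasVar n t := by
  simp [captured]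

section

variable {ax : DisjAxiom} {s : ℕ → Ty} {K : Fin ax.m → Ctx}
  {t : Fin ax.m → Tm}

theorem crossAssign_of_mem (hax : ax.Admissible) {i : Fin ax.m} {p : ℕ} (h : p ∈ ax.ante i) :
    crossAssign ax s K t p = capturedTy (K i) (t i) := by
  simp [crossAssign, hax.source_eq h]

theorem map_crossAssign (hax : ax.Admissible) (i : Fin ax.m) :
    (ax.ante i).map (crossAssign ax s K t) =
      List.replicate (ax.ante i).length (capturedTy (K i) (t i)) := by
  rw [List.eq_replicate_iff]
  refine ⟨by simp, fun A hA => ?_⟩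
  obtain ⟨p, hp, rfl⟩ := List.mem_map.1 hA
  exact crossAssign_of_mem hax hp

/-- All conjuncts of the antecedent are now interpreted by the type of `⟨yᵢ⟩`, so the tuple of
copies has the right type. Its components are variables or `tt`, never values, which is why the new
channel may be inactive. -/
theorem tame_crossLink (hax : ax.Admissible) {i : Fin ax.m}
    (hΔ : Δ 1 = (ax.dom (crossAssign ax s K t) i, ax.cod (crossAssign ax s K t) i))
    (hβ : β 1 = false) :
    Tame τ M R β Δ (extend (K i).binds Γ) (crossLink ax K t i)
      (ax.cod (crossAssign ax s K t) i) := by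
  have hv : Tame τ M R β Δ (extend (K i).binds Γ) (tuple ((captured (K i) (t i)).map Tm.var))
      (capturedTy (K i) (t i)) := by
    refine Tame.tuple ?_
    rw [List.forall₂_map_left_iff, List.forall₂_map_right_iff, List.forall₂_same]
    exact fun n hn => extend_of_lt (mem_captured.1 hn).1 Γ
  refine ⟨by rw [hΔ], ?_, fun _ => ⟨fun h => by simp [hβ] at h, fun _ => ?_⟩⟩
  · rw [hΔ, DisjAxiom.dom, map_crossAssign hax]
    refine Tame.tuple ?_
    generalize (ax.ante i).length = n
    induction n with
    | zero => exact .nil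
    | succ n ih => exact .cons hv ih
  · refine not_isValue_tuple fun x hx => ?_
    rw [(List.mem_replicate.1 hx).2]
    refine not_isValue_tuple fun y hy => ?_
    obtain ⟨n, _, rfl⟩ := List.mem_map.1 hy
    exact id

theorem chanCount_crossLink (i : Fin ax.m) : chanCount 0 (crossLink ax K t i) = 0 := by
  refine Nat.add_eq_zero_iff.2 ⟨rfl, chanCount_tuple fun x hx => ?_⟩
  rw [(List.mem_replicate.1 hx).2]
  refine chanCount_tuple fun y hy => ?_
  obtain ⟨n, _, rfl⟩ := List.mem_map.1 hy
  rfl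

theorem liftRen_succ_eq_zero (l : ℕ) : liftRen Nat.succ l = 0 ↔ l = 0 := by
  cases l <;> simp [liftRen, cons]

/-- By `hcod` the link of process `i` has the type of the tuple `⟨yⱼ⟩`, so its projections replace
the variables captured at the sender. They are inert because `b` is inactive, so the message keeps
its value bound and gains no redex; it contains no `a`, as it comes from a rightmost occurrence. -/
theorem tame_crossMessage (hax : ax.Admissible) {i j : Fin ax.m} {A : Ty}
    (hΔ : Δ 1 = (ax.dom (crossAssign ax s K t) i, ax.cod (crossAssign ax s K t) i))
    (hβ : β 1 = false)
    (hc : ∀ k, HasChan k (t j) → Δ (liftRen Nat.succ k) = Δ' k ∧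
      (R (liftRen Nat.succ k) → R' k) ∧ β (liftRen Nat.succ k) = β' k)
    (hcod : ax.cod (crossAssign ax s K t) i = capturedTy (K j) (t j))
    (ht : Tame τ M R' β' Δ' (extend (K j).binds Γ) (t j) A) (ht0 : ¬ HasChan 0 (t j)) :
    Tame τ M R β Δ (extend (K i).binds Γ) (crossMessage ax K t i j) A ∧
      (∀ N, ValueLE N (t j) A → ValueLE N (crossMessage ax K t i j) A) ∧
      chanCount 0 (crossMessage ax K t i j) = 0 := by
  have hl : Inert β (crossLink ax K t i) := hβ
  have hi : ∀ n, HasVar n ((t j).ren id (liftRen Nat.succ)) → Inert β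
      (if n < (K j).binds.length then
        tupleProj (captured (K j) (t j)).length ((captured (K j) (t j)).idxOf n)
          (crossLink ax K t i)
      else .var (n - (K j).binds.length + (K i).binds.length)) := by
    intro n _
    split
    · exact hl.tupleProj _ _
    · trivial
  refine ⟨(ht.ren (fun _ => rfl) hc).sub ?_ hi, fun N h => ((valueLE_ren _ _).2 h).sub hi, ?_⟩
  · intro n hn
    have hn' : HasVar n (t j) := hn.of_ren fun _ => rfl
    split
    · next h =>
      have hmem : n ∈ captured (K j) (t j) := mem_captured.2 ⟨h, hn'⟩
      have hlink := tame_crossLink (τ := τ) (M := M) (R := R) (Γ := Γ) hax hΔ hβ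
      rw [hcod] at hlink
      have hq : (captured (K j) (t j)).idxOf n <
          ((captured (K j) (t j)).map fun n => (K j).binds.getD n .top).length := by
        rw [List.length_map]
        exact List.idxOf_lt_length_iff.2 hmem
      have := Tame.tupleProj hq hl hlink
      rw [List.length_map, List.getElem_map, List.getElem_idxOf] at this
      rwa [extend_of_lt h]
    · next h =>
      -- A variable free in the whole process: its index is shifted from the depth of the sender's
      -- hole to that of the receiver's.
      obtain ⟨m, rfl⟩ := Nat.exists_eq_add_of_le' (not_lt.1 h)
      rw [Nat.add_sub_cancel, extend_add]
      exact extend_add _ _ _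
  · refine chanCount_sub ?_ fun n hn => ?_
    · rw [chanCount_ren liftRen_succ_eq_zero]
      exact (chanCount_eq_zero ht.simple).2 ht0
    · split
      · rw [chanCount_tupleProj, chanCount_crossLink]
      · rfl

/-- If the succedent is not a conjunct of any antecedent, its interpretation does not change and the
link itself is received. Otherwise the message is received and its projection to the right conjunct
is reduced. -/
theorem exists_crossReceived (hax : ax.Admissible) {i : Fin ax.m} {Δ' : Fin ax.m → ℕ → Ty × Ty}
    (hΔ : Δ 1 = (ax.dom (crossAssign ax s K t) i, ax.cod (crossAssign ax s K t) i))
    (hβ : β 1 = false)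
    (hc : ∀ j k, HasChan k (t j) → Δ (liftRen Nat.succ k) = Δ' j k ∧
      (R (liftRen Nat.succ k) → R' k) ∧ β (liftRen Nat.succ k) = β' k)
    (ht : ∀ j, Tame τ M R' β' (Δ' j) (extend (K j).binds Γ) (t j) (ax.dom s j) ∧
      ValueLE τ (t j) (ax.dom s j) ∧ ¬ HasChan 0 (t j)) :
    ∃ r, StructReduces α (crossReceived ax K t i) r ∧
      Tame τ M R β Δ (extend (K i).binds Γ) r (ax.cod s i) ∧ ValueLE τ r (ax.cod s i) ∧
      chanCount 0 r = 0 := by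
  have hlink := tame_crossLink (τ := τ) (M := M) (R := R) (Γ := Γ) hax hΔ hβ
  have hl : Inert β (crossLink ax K t i) := hβ
  have link : ax.cod (crossAssign ax s K t) i = ax.cod s i → ∃ r,
      StructReduces α (crossLink ax K t i) r ∧
      Tame τ M R β Δ (extend (K i).binds Γ) r (ax.cod s i) ∧ ValueLE τ r (ax.cod s i) ∧
      chanCount 0 r = 0 := fun h =>
    ⟨_, .refl, h ▸ hlink, hl.valueLE _, chanCount_crossLink i⟩
  unfold crossReceived
  cases hs : ax.succ i with
  | top => exact link (by simp [DisjAxiom.cod, hs, Atom.inst])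
  | bot => exact link (by simp [DisjAxiom.cod, hs, Atom.inst])
  | var p =>
    have hcod : ∀ s, ax.cod s i = s p := fun s => by simp [DisjAxiom.cod, hs, Atom.inst]
    cases hp : ax.source p with
    | none => simpa only [hp] using link (by simp [hcod, crossAssign, hp])
    | some j =>
      obtain ⟨h1, h2, h3⟩ := ht j
      have hmem := DisjAxiom.mem_of_source hp
      obtain ⟨m1, m2, m3⟩ := tame_crossMessage hax hΔ hβ (hc j)
        (by rw [hcod, crossAssign_of_mem hax hmem]) h1 h3
      have hq : (ax.ante j).idxOf p < ((ax.ante j).map s).length := by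
        rw [List.length_map]
        exact List.idxOf_lt_length_iff.2 hmem
      obtain ⟨r, r1, r2, r3, r4⟩ := tame_tupleProj (α := α) (k := 0) hq m1
      rw [List.getElem_map, List.getElem_idxOf] at r2 r3
      rw [List.length_map] at r1
      rw [hcod]
      simp only [hp]
      exact ⟨r, r1, r2, r3 τ (m2 τ h2), by omega⟩

/-- In each of the new active sessions exactly one process receives, losing an occurrence of the
channel, and the others are merely reindexed. So every inner session has a smaller total count,
while the bound `τ` is kept. -/
theorem exists_crossResult (hax : ax.Admissible) {us : Fin ax.m → Tm} {A : Ty}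
    (hus : ∀ i, Tame τ τ (cons True R) (cons true β) (cons (ax.dom s i, ax.cod s i) Δ) Γ (us i) A)
    (hsend : ∀ i, RightmostSend (us i) (K i) (t i)) (α : ℕ → Bool) :
    ∃ us' : Fin ax.m → Fin ax.m → Tm,
      Reduces (fun _ => StructRule) α (crossResult ax s K t)
        (.ses ax (crossAssign ax s K t) false fun i => .ses ax s true (us' i)) ∧
      (∀ i k, Tame τ τ (cons True (cons True R)) (cons true (cons false β))
        (cons (ax.dom s k, ax.cod s k) (cons (ax.dom (crossAssign ax s K t) i,
          ax.cod (crossAssign ax s K t) i) Δ)) Γ (us' i k) A) ∧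
      ∀ i, ∑ k, chanCount 0 (us' i k) < ∑ k, chanCount 0 (us k) := by
  have hsplit : ∀ j, Tame τ τ (cons True R) (cons true β) (cons (ax.dom s j, ax.cod s j) Δ)
      (extend (K j).binds Γ) (t j) (ax.dom s j) ∧ ValueLE τ (t j) (ax.dom s j) ∧
      ¬ HasChan 0 (t j) := by
    intro j
    have h := hus j
    rw [(hsend j).1] at h
    obtain ⟨B, -, h1, h2⟩ := h.of_plug
    exact ⟨h1, (h2 trivial).1 rfl, (hsend j).2.2.1⟩
  have key : ∀ i k, ∃ r, StructReduces (cons true (cons false α))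
      (if k = i then ((K i).renChan (liftRen Nat.succ)).plug (crossReceived ax K t i)
        else ((K k).plug (.chan 0 (t k))).ren id (liftRen Nat.succ)) r ∧
      Tame τ τ (cons True (cons True R)) (cons true (cons false β))
        (cons (ax.dom s k, ax.cod s k) (cons (ax.dom (crossAssign ax s K t) i,
          ax.cod (crossAssign ax s K t) i) Δ)) Γ r A ∧
      chanCount 0 r ≤ chanCount 0 (us k) ∧
      (k = i → chanCount 0 r < chanCount 0 (us k)) := by
    intro i k
    have hc : ∀ (x y : Ty × Ty) l, (cons x (cons y Δ)) (liftRen Nat.succ l) = cons x Δ l ∧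
        (cons True (cons True R) (liftRen Nat.succ l) → cons True R l) ∧
        (cons true (cons false β) : ℕ → Bool) (liftRen Nat.succ l) = cons true β l := by
      intro x y l
      cases l with
      | zero => exact ⟨rfl, id, rfl⟩
      | succ l => exact ⟨rfl, id, rfl⟩
    by_cases hk : k = i
    · subst hk
      obtain ⟨r, r1, r2, r3, r4⟩ := exists_crossReceived (α := cons true (cons false α))
        (τ := τ) (M := τ) (R := cons True (cons True R)) (β := cons true (cons false β))
        (Δ := cons (ax.dom s k, ax.cod s k) (cons (ax.dom (crossAssign ax s K t) k,
          ax.cod (crossAssign ax s K t) k) Δ)) (i := k) hax rfl rfl (by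
            intro j l hl
            -- Channel `0` has different types in the processes `j` and `k`. The message may move
            -- between them only because it does not use that channel.
            obtain ⟨l, rfl⟩ : ∃ l', l = l' + 1 := by
              cases l with
              | zero => exact ((hsplit j).2.2 hl).elim
              | succ l => exact ⟨l, rfl⟩
            exact ⟨rfl, id, rfl⟩) hsplit
      have h := hus k
      rw [(hsend k).1] at h
      obtain ⟨r', h1, h2, h3⟩ := exists_replaces (α := cons true (cons false α)) (hc _ _)
        liftRen_succ_eq_zero rfl h (hsend k).2.2.2 r2 r3 r4
      have hcount := h3.count
      rw [← (hsend k).1] at hcount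
      rw [if_pos rfl]
      refine ⟨r', Relation.ReflTransGen.trans ?_ h1, h2, hcount.le, fun _ => hcount⟩
      have plug : ∀ (K : Ctx) {x y}, StructReduces (cons true (cons false α)) x y →
          StructReduces (cons true (cons false α)) (K.plug x) (K.plug y) := by
        intro K x y hxy
        induction K with
        | nil => exact hxy
        | cons F K ih => exact ih.frame F
      exact plug _ r1
    · rw [if_neg hk, ← (hsend k).1]
      exact ⟨_, .refl, (hus k).ren (fun _ => rfl) fun l _ => hc _ _ l,
        (chanCount_ren liftRen_succ_eq_zero _).le, fun h => (hk h).elim⟩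
  choose us' h1 h2 h3 h4 using key
  exact ⟨us', Reduces.ses _ fun i => Reduces.ses _ fun k => h1 i k, h2, fun i =>
    Finset.sum_lt_sum (fun k _ => h3 i k) ⟨i, Finset.mem_univ i, h4 i i rfl⟩⟩

end

end


/-! ### Trees of simply typed terms -/

/-- Parallel forms with admitted sessions and leaves in `L`. The first argument of `L` collects the
channels that are bound above the leaf, the second one gives the active channels. -/
inductive Tree (Ax : Finset DisjAxiom)
    (L : (ℕ → Prop) → (ℕ → Bool) → (ℕ → Ty × Ty) → Tm → Prop) :
    (ℕ → Prop) → (ℕ → Bool) → (ℕ → Ty × Ty) → Tm → Prop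
  | leaf {R β Δ t} : L R β Δ t → Tree Ax L R β Δ t
  | par {R β Δ u v} : Tree Ax L R β Δ u → Tree Ax L R β Δ v → Tree Ax L R β Δ (.par u v)
  | ses {R β Δ ax s act us} : ax ∈ Ax →
      (∀ i, Tree Ax L (cons True R) (cons act β) (cons (ax.dom s i, ax.cod s i) Δ) (us i)) →
      Tree Ax L R β Δ (.ses ax s act us)

section

variable {τ M N : ℕ} {R R' : ℕ → Prop} {β β' : ℕ → Bool} {Δ Δ' : ℕ → Ty × Ty} {Γ Γ' : ℕ → Ty}
  {α : ℕ → Bool} {Ax : Finset DisjAxiom} {A : Ty}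
  {L L' : (ℕ → Prop) → (ℕ → Bool) → (ℕ → Ty × Ty) → Tm → Prop}

theorem Tree.par_inv (hL : ∀ {R β Δ t}, L R β Δ t → Simple t) {u v : Tm}
    (h : Tree Ax L R β Δ (.par u v)) : Tree Ax L R β Δ u ∧ Tree Ax L R β Δ v := by
  cases h with
  | leaf h => exact (hL h).elim
  | par h h' => exact ⟨h, h'⟩

theorem Tree.ses_inv (hL : ∀ {R β Δ t}, L R β Δ t → Simple t) {ax s act us}
    (h : Tree Ax L R β Δ (.ses ax s act us)) : ax ∈ Ax ∧
      ∀ i, Tree Ax L (cons True R) (cons act β) (cons (ax.dom s i, ax.cod s i) Δ) (us i) := by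
  cases h with
  | leaf h => exact (hL h).elim
  | ses h h' => exact ⟨h, h'⟩

theorem Frame.plug_ne_par (F : Frame) (t u v : Tm) : F.plug t ≠ .par u v := by
  rcases F with (_ | _ | _ | _) | _ | _ | _ | _ | _ | _ | _ | _ <;> exact Tm.noConfusion

theorem Frame.plug_ne_ses (F : Frame) (t : Tm) (ax s act us) : F.plug t ≠ .ses ax s act us := by
  rcases F with (_ | _ | _ | _) | _ | _ | _ | _ | _ | _ | _ | _ <;> exact Tm.noConfusion

theorem Tree.leaf_inv {F : Frame} {t : Tm} (h : Tree Ax L R β Δ (F.plug t)) :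
    L R β Δ (F.plug t) := by
  generalize hu : F.plug t = u at h
  cases h with
  | leaf h => exact h
  | par => exact (F.plug_ne_par _ _ _ hu).elim
  | ses => exact (F.plug_ne_ses _ _ _ _ _ hu).elim

theorem Tree.imp (hL : ∀ {R β Δ t}, L R β Δ t → L' R β Δ t) {t : Tm} (h : Tree Ax L R β Δ t) :
    Tree Ax L' R β Δ t := by
  induction h with
  | leaf h => exact .leaf (hL h)
  | par _ _ ih ih' => exact .par ih ih'
  | ses h _ ih => exact .ses h ih

theorem Tree.parallelForm (hL : ∀ {R β Δ t}, L R β Δ t → Simple t) {t : Tm}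
    (h : Tree Ax L R β Δ t) : ParallelForm t := by
  induction h with
  | leaf h => exact .simple (hL h)
  | par _ _ ih ih' => exact .par ih ih'
  | ses _ _ ih => exact .ses ih

theorem Tree.hasType {t : Tm} (h : Tree Ax L R β Δ t)
    (hL : ∀ {R β Δ t}, L R β Δ t → HasType Ax Γ Δ t A) : HasType Ax Γ Δ t A := by
  induction h with
  | leaf h => exact hL h
  | par _ _ ih ih' => exact .par ih ih'
  | ses h _ ih => exact .ses h ih

theorem ParallelForm.tree {t : Tm} (h : ParallelForm t) (ht : HasType Ax Γ Δ t A) :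
    Tree Ax (fun _ _ Δ t => Simple t ∧ HasType Ax Γ Δ t A) R β Δ t := by
  induction h generalizing R β Δ with
  | simple h => exact .leaf ⟨h, ht⟩
  | par _ _ ih ih' =>
    cases ht with
    | par h h' => exact .par (ih h) (ih' h')
  | ses _ ih =>
    cases ht with
    | ses h h' => exact .ses h fun i => ih i (h' i)

theorem Tree.reduces {S : (ℕ → Bool) → Tm → Tm → Prop}
    (hL : ∀ {R β Δ t}, L R β Δ t → ∃ t', Reduces S β t t' ∧ L' R β Δ t') {t : Tm}
    (h : Tree Ax L R β Δ t) : ∃ t', Reduces S β t t' ∧ Tree Ax L' R β Δ t' := by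
  induction h with
  | leaf h =>
    obtain ⟨t', h1, h2⟩ := hL h
    exact ⟨t', h1, .leaf h2⟩
  | par _ _ ih ih' =>
    obtain ⟨u, h1, h2⟩ := ih
    obtain ⟨v, h1', h2'⟩ := ih'
    exact ⟨_, h1.par h1', .par h2 h2'⟩
  | ses h _ ih =>
    choose us' h1 h2 using ih
    exact ⟨_, Reduces.ses _ h1, .ses h h2⟩

theorem Tree.not_inside {S : (ℕ → Bool) → Tm → Tm → Prop}
    (hL : ∀ {R β Δ t}, L R β Δ t → Simple t)
    (hS : ∀ {R β Δ α t t'}, L R β Δ t → ¬ Inside S α t t')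
    (hpar : ∀ {α u v t'}, ¬ S α (.par u v) t') (hses : ∀ {α ax s act us t'}, ¬ S α (.ses ax s act us) t')
    {t t' : Tm} (h : Tree Ax L R β Δ t) : ¬ Inside S α t t' := by
  intro hs
  induction hs generalizing R β Δ with
  | root h' =>
    cases h with
    | leaf h => exact hS h (.root h')
    | par => exact hpar h'
    | ses => exact hses h'
  | frame F h' _ => exact hS h.leaf_inv (.frame F h')
  | parL u _ ih => exact ih (h.par_inv hL).1
  | parR u _ ih => exact ih (h.par_inv hL).2
  | ses ax s act us i _ ih => exact ih ((h.ses_inv hL).2 i)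

theorem Elim.plug_ne_par (ξ : Elim) (t u v : Tm) : ξ.plug t ≠ .par u v :=
  (Frame.elim ξ).plug_ne_par t u v

theorem Elim.plug_ne_ses (ξ : Elim) (t : Tm) (ax s act us) : ξ.plug t ≠ .ses ax s act us :=
  (Frame.elim ξ).plug_ne_ses t ax s act us

theorem not_structRule_par {u v t' : Tm} : ¬ StructRule (.par u v) t' := by
  generalize h : Tm.par u v = t
  rintro (_ | _ | ⟨_, _, _, _, _, ξ⟩)
  · cases h
  · cases h
  · exact ξ.plug_ne_par _ _ _ h.symm

theorem not_structRule_ses {ax s act us t'} : ¬ StructRule (.ses ax s act us) t' := by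
  generalize h : Tm.ses ax s act us = t
  rintro (_ | _ | ⟨_, _, _, _, _, ξ⟩)
  · cases h
  · cases h
  · exact ξ.plug_ne_ses _ _ _ _ _ h.symm

theorem Tree.not_structStep (hL : ∀ {R β Δ t}, L R β Δ t → ∃ R β M, Tame τ M R β Δ Γ t A) {t t' : Tm}
    (h : Tree Ax L R β Δ t) : ¬ StructStep α t t' := by
  refine h.not_inside (fun h => ?_) (fun h => ?_) not_structRule_par not_structRule_ses
  · obtain ⟨_, _, _, h⟩ := hL h; exact h.simple
  · obtain ⟨_, _, _, h⟩ := hL h; exact h.not_structStep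

theorem Tree.not_intStep (h : Tree Ax (fun R _ Δ t => NF M R Δ Γ t A) R β Δ t) {t' : Tm} :
    ¬ Inside (fun _ => IntRule) α t t' := by
  refine h.not_inside (fun h => Tame.simple h) (fun h => NF.not_intStep h) ?_ ?_
  · rintro _ _ _ _ (h | h)
    · cases h
    · exact not_structRule_par h
  · rintro _ _ _ _ _ _ (h | h)
    · cases h
    · exact not_structRule_ses h

/-! ### The intuitionistic phase -/

theorem Tree.exists_bound {t : Tm} (h : Tree Ax (fun R _ Δ t => ∃ M, NF M R Δ Γ t A) R β Δ t) :
    ∃ M, Tree Ax (fun R _ Δ t => NF M R Δ Γ t A) R β Δ t := by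
  induction h with
  | leaf h => exact h.imp fun _ h => .leaf h
  | par _ _ ih ih' =>
    obtain ⟨M, h⟩ := ih
    obtain ⟨M', h'⟩ := ih'
    exact ⟨max M M', .par (h.imp (NF.mono (le_max_left _ _))) (h'.imp (NF.mono (le_max_right _ _)))⟩
  | ses h _ ih =>
    choose M hM using ih
    exact ⟨Finset.univ.sup M, .ses h fun i => (hM i).imp (NF.mono (Finset.le_sup (Finset.mem_univ i)))⟩

theorem ParallelForm.exists_nf {t : Tm} (h : ParallelForm t) (ht : HasType Ax Γ Δ t A) :
    ∃ M t', Exhaust (Inside (fun _ => IntRule) β) t t' ∧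
      Tree Ax (fun R _ Δ t => NF M R Δ Γ t A) R β Δ t' := by
  obtain ⟨t', h1, h2⟩ := Tree.reduces (S := fun _ => IntRule)
    (L' := fun R _ Δ t => ∃ M, NF M R Δ Γ t A) (fun {R β Δ t} h => by
      obtain ⟨M, t', h1, h2⟩ := h.2.exists_nf h.1 R β
      exact ⟨t', h1, M, h2⟩) (h.tree (R := R) (β := β) ht)
  obtain ⟨M, h2⟩ := h2.exists_bound
  exact ⟨M, t', ⟨h1, fun _ => h2.not_intStep⟩, h2⟩

/-- The leaves between two phases of communication. -/
abbrev Comm (τ : ℕ) (Γ : ℕ → Ty) (A : Ty) (R : ℕ → Prop) (β : ℕ → Bool) (Δ : ℕ → Ty × Ty) (t : Tm) :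
    Prop :=
  Tame τ τ R β Δ Γ t A

theorem Comm.simple {t : Tm} (h : Comm τ Γ A R β Δ t) : Simple t := Tame.simple h

theorem Tree.with_inactive {t : Tm} (h : Tree Ax L R β Δ t) (ht : NoActive t)
    (hR : ∀ k, R k → β k = false) :
    Tree Ax (fun R β Δ t => L R β Δ t ∧ ∀ k, R k → β k = false) R β Δ t := by
  induction h with
  | leaf h => exact .leaf ⟨h, hR⟩
  | par _ _ ih ih' => exact .par (ih ht.1 hR) (ih' ht.2 hR)
  | ses h _ ih =>
    obtain ⟨rfl, ht⟩ := ht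
    refine .ses h fun i => ih i (ht i) fun k => ?_
    cases k with
    | zero => exact fun _ => rfl
    | succ k => exact hR k

theorem Tree.exists_nf {t : Tm} (h : Tree Ax (Comm (τ + 1) Γ A) R β Δ t) (ht : NoActive t)
    (hR : ∀ k, R k → β k = false) :
    ∃ t', Exhaust (Inside (fun _ => IntRule) β) t t' ∧
      Tree Ax (fun R _ Δ t => NF τ R Δ Γ t A) R β Δ t' := by
  obtain ⟨t', h1, h2⟩ := (h.with_inactive ht hR).reduces (S := fun _ => IntRule)
    (L' := fun R _ Δ t => NF τ R Δ Γ t A) (fun {R β Δ t} h => by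
      obtain ⟨t', h1, h2, _⟩ := h.1.exists_nf h.2 β
      exact ⟨t', h1, h2⟩)
  exact ⟨t', ⟨h1, fun _ => h2.not_intStep⟩, h2⟩

/-! ### The activation phase -/

/-- The number of inactive sessions of a parallel form. -/
def inactiveCount : Tm → ℕ
  | .par u v => inactiveCount u + inactiveCount v
  | .ses _ _ act us => (if act then 0 else 1) + ∑ i, inactiveCount (us i)
  | _ => 0

/-- Applies to leaves satisfying `NF`, which bounds messages as if all channels were active and so
ignores the actual marks. This makes the invariant stable under activation. -/
theorem Tree.change_active (hL : ∀ {R β β' Δ t}, L R β Δ t → L R β' Δ t) {t : Tm}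
    (h : Tree Ax L R β Δ t) : Tree Ax L R β' Δ t := by
  induction h generalizing β' with
  | leaf h => exact .leaf (hL h)
  | par _ _ ih ih' => exact .par ih ih'
  | ses h _ ih => exact .ses h fun i => ih i

theorem Tree.actStep (hL : ∀ {R β Δ t}, L R β Δ t → Simple t)
    (hL' : ∀ {R β β' Δ t}, L R β Δ t → L R β' Δ t) {t t' : Tm}
    (h : Tree Ax L R β Δ t) (hs : Inside ActRule α t t') :
    Tree Ax L R β Δ t' ∧ inactiveCount t' < inactiveCount t := by
  induction hs generalizing R β Δ with
  | root h' =>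
    cases h' with
    | act ax s us _ =>
      obtain ⟨h1, h2⟩ := h.ses_inv hL
      exact ⟨.ses h1 fun i => (h2 i).change_active (L := L) hL', by simp [inactiveCount]⟩
  | frame F h' _ =>
    exact ((Inside.frame F h').eq_of_simple (hL h.leaf_inv) fun _ _ _ h => by cases h; exact id).elim
  | parL u _ ih =>
    obtain ⟨h1, h2⟩ := h.par_inv hL
    exact ⟨.par (ih h1).1 h2, by simpa [inactiveCount] using (ih h1).2⟩
  | parR u _ ih =>
    obtain ⟨h1, h2⟩ := h.par_inv hL
    exact ⟨.par h1 (ih h2).1, by simpa [inactiveCount] using (ih h2).2⟩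
  | @ses α t' ax s act us i _ ih =>
    obtain ⟨h1, h2⟩ := h.ses_inv hL
    obtain ⟨h3, h4⟩ := ih (h2 i)
    refine ⟨.ses h1 fun k => ?_, ?_⟩
    · by_cases hk : k = i
      · subst hk; simpa using h3
      · simpa [hk] using h2 k
    · simp only [inactiveCount, add_lt_add_iff_left]
      refine Finset.sum_lt_sum (fun k _ => ?_) ⟨i, Finset.mem_univ i, by simpa using h4⟩
      by_cases hk : k = i
      · subst hk; simpa using h4.le
      · simp [hk]

/-- The bound holds on all channels in `R`, active or not; the absence of activable occurrences adds
that the inactive ones carry no values. -/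
theorem Tame.of_not_activable {t : Tm} (h : NF M R Δ Γ t A)
    (hβ : ∀ k, R k → β k = false → ¬ Activable β k t) : Tame 0 M R β Δ Γ t A := by
  induction t generalizing Γ A with
  | var n => exact h
  | tt => exact h
  | lam B u hu => obtain ⟨C, rfl, h⟩ := h; exact ⟨C, rfl, hu h hβ⟩
  | app t u iht ihu =>
    obtain ⟨B, h1, h2, h3⟩ := h
    exact ⟨B, iht h1 fun k hR hk hv => hβ k hR hk (.inl hv), h2,
      ihu h3 fun k hR hk hv => hβ k hR hk (.inr hv)⟩
  | pair t u iht ihu =>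
    obtain ⟨B, C, rfl, h1, h3⟩ := h
    exact ⟨B, C, rfl, iht h1 fun k hR hk hv => hβ k hR hk (.inl hv),
      ihu h3 fun k hR hk hv => hβ k hR hk (.inr hv)⟩
  | proj i u hu => cases i <;> obtain ⟨B, h1, h2⟩ := h <;> exact ⟨B, hu h1 hβ, h2⟩
  | inj i C u hu => cases i <;> obtain ⟨B, rfl, h1⟩ := h <;> exact ⟨B, rfl, hu h1 hβ⟩
  | case A B t u v iht ihu ihv =>
    obtain ⟨h1, h2, h3, h4⟩ := h
    exact ⟨iht h1 fun k hR hk hv => hβ k hR hk (.inl hv), h2,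
      ihu h3 fun k hR hk hv => hβ k hR hk (.inr (.inl hv)),
      ihv h4 fun k hR hk hv => hβ k hR hk (.inr (.inr hv))⟩
  | efq P u hu =>
    obtain ⟨h1, h2, h3, h4⟩ := h
    exact ⟨h1, h2, hu h3 hβ, h4⟩
  | chan k u hu =>
    obtain ⟨h1, h2, h3⟩ := h
    exact ⟨h1, hu h2 fun k hR hk hv => hβ k hR hk (.inr hv), fun hR =>
      ⟨fun _ => (h3 hR).1 rfl, fun hk hv => hβ k hR hk (.inl ⟨rfl, hv⟩)⟩⟩
  | par => exact h.elim
  | ses => exact h.elim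

/-- If an inactive channel bound in the tree carried a value, the activation rule would apply at its
session. The condition `hβ` transports this information down to the leaves. -/
theorem Tree.comm_of_exhausted {t : Tm} (h : Tree Ax (fun R _ Δ t => NF τ R Δ Γ t A) R β Δ t)
    (hs : ∀ t', ¬ Inside ActRule β t t') (hβ : ∀ k, R k → β k = false → ¬ Activable β k t) :
    Tree Ax (Comm τ Γ A) R β Δ t := by
  induction h with
  | leaf h => exact .leaf ((Tame.of_not_activable h hβ).mono (Nat.zero_le _) le_rfl)
  | par _ _ ih ih' =>
    exact .par (ih (fun _ h => hs _ (.parL _ h)) fun k hR hk hv => hβ k hR hk (.inl hv))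
      (ih' (fun _ h => hs _ (.parR _ h)) fun k hR hk hv => hβ k hR hk (.inr hv))
  | ses h _ ih =>
    refine .ses h fun i => ih i (fun _ h => hs _ (.ses _ _ _ _ i h)) fun k => ?_
    cases k with
    | zero =>
      intro _ hact hv
      cases hact
      exact hs _ (.root (.act _ _ _ ⟨i, hv⟩))
    | succ k => exact fun hR hk hv => hβ k hR hk ⟨i, hv⟩

theorem Tree.exists_activated {t : Tm} (h : Tree Ax (fun R _ Δ t => NF τ R Δ Γ t A) R β Δ t)
    (hR : ∀ k, ¬ R k) :
    ∃ t', Exhaust (Inside ActRule β) t t' ∧ Tree Ax (Comm τ Γ A) R β Δ t' := by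
  have key : ∀ n t, inactiveCount t = n → Tree Ax (fun R _ Δ t => NF τ R Δ Γ t A) R β Δ t →
      ∃ t', Exhaust (Inside ActRule β) t t' ∧
        Tree Ax (fun R _ Δ t => NF τ R Δ Γ t A) R β Δ t' := by
    intro n
    induction n using Nat.strong_induction_on with
    | _ n IH =>
    intro t hn h
    by_cases hs : ∃ t', Inside ActRule β t t'
    · obtain ⟨t', hs⟩ := hs
      obtain ⟨h1, h2⟩ := h.actStep (L := fun R _ Δ t => NF τ R Δ Γ t A) (fun h => Tame.simple h) (fun h => h) hs
      obtain ⟨t'', h3, h4⟩ := IH _ (hn ▸ h2) t' rfl h1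
      exact ⟨t'', ⟨.head hs h3.1, h3.2⟩, h4⟩
    · exact ⟨t, ⟨.refl, fun t' h => hs ⟨t', h⟩⟩, h⟩
  obtain ⟨t', h1, h2⟩ := key _ t rfl h
  exact ⟨t', h1, h2.comm_of_exhausted h1.2 fun k h => (hR k h).elim⟩

end


section

variable {τ M N : ℕ} {R R' : ℕ → Prop} {β β' : ℕ → Bool} {Δ Δ' : ℕ → Ty × Ty} {Γ Γ' : ℕ → Ty}
  {α : ℕ → Bool} {Ax : Finset DisjAxiom} {A : Ty}

/-! ### The communication phase -/

theorem HasChan.ren {k : ℕ} {t : Tm} (h : HasChan k t) (r c : ℕ → ℕ) :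
    HasChan (c k) (t.ren r c) := by
  induction t generalizing k r c with
  | var => exact h
  | tt => exact h
  | lam A u ih => exact ih h _ _
  | app t u iht ihu => exact h.imp (fun h => iht h _ _) (fun h => ihu h _ _)
  | pair t u iht ihu => exact h.imp (fun h => iht h _ _) (fun h => ihu h _ _)
  | proj i u ih => exact ih h _ _
  | inj i C u ih => exact ih h _ _
  | case A B t u v iht ihu ihv =>
    exact h.imp (fun h => iht h _ _) (Or.imp (fun h => ihu h _ _) (fun h => ihv h _ _))
  | efq P u ih => exact ih h _ _
  | chan l u ih => exact h.imp (fun h => by rw [h]) (fun h => ih h _ _)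
  | par t u iht ihu => exact h.imp (fun h => iht h _ _) (fun h => ihu h _ _)
  | ses ax s act us ih =>
    exact h.imp fun i h =>
      show HasChan (liftRen c (k + 1)) _ from ih i h r (liftRen c)

theorem NoActive.ren {t : Tm} (h : NoActive t) (r c : ℕ → ℕ) : NoActive (t.ren r c) := by
  induction t generalizing r c with
  | var => exact h
  | tt => exact h
  | lam A u ih => exact ih h _ _
  | app t u iht ihu => exact ⟨iht h.1 _ _, ihu h.2 _ _⟩
  | pair t u iht ihu => exact ⟨iht h.1 _ _, ihu h.2 _ _⟩
  | proj i u ih => exact ih h _ _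
  | inj i C u ih => exact ih h _ _
  | case A B t u v iht ihu ihv => exact ⟨iht h.1 _ _, ihu h.2.1 _ _, ihv h.2.2 _ _⟩
  | efq P u ih => exact ih h _ _
  | chan l u ih => exact ih h _ _
  | par t u iht ihu => exact ⟨iht h.1 _ _, ihu h.2 _ _⟩
  | ses ax s act us ih => exact ⟨h.1, fun i => ih i (h.2 i) _ _⟩

theorem Simple.noActive {t : Tm} (h : Simple t) : NoActive t := by
  induction t with
  | par => exact h.elim
  | ses => exact h.elim
  | _ => simp_all [Simple, NoActive]

theorem Tree.ren {t : Tm} {c : ℕ → ℕ} (h : Tree Ax (Comm τ Γ A) R β Δ t)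
    (hc : ∀ k, HasChan k t → Δ' (c k) = Δ k ∧ (R' (c k) → R k) ∧ β' (c k) = β k) :
    Tree Ax (Comm τ Γ A) R' β' Δ' (t.ren id c) := by
  induction h generalizing R' β' Δ' c with
  | leaf h => exact .leaf (Tame.ren h (fun _ => rfl) hc)
  | par _ _ ih ih' =>
    exact .par (ih fun k hk => hc k (.inl hk)) (ih' fun k hk => hc k (.inr hk))
  | ses h _ ih =>
    refine .ses h fun i => ih i fun k hk => ?_
    cases k with
    | zero => exact ⟨rfl, id, rfl⟩
    | succ k => exact hc k ⟨i, hk⟩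

theorem Tree.lift {t : Tm} {x y : Ty × Ty} {a b : Bool}
    (h : Tree Ax (Comm τ Γ A) (cons True R) (cons a β) (cons x Δ) t) :
    Tree Ax (Comm τ Γ A) (cons True (cons True R)) (cons a (cons b β)) (cons x (cons y Δ))
      (t.ren id (liftRen Nat.succ)) := by
  refine h.ren fun k _ => ?_
  cases k <;> exact ⟨rfl, id, rfl⟩

theorem Tree.swap {t : Tm} {x y : Ty × Ty} {a b : Bool}
    (h : Tree Ax (Comm τ Γ A) (cons True (cons True R)) (cons b (cons a β)) (cons y (cons x Δ)) t) :
    Tree Ax (Comm τ Γ A) (cons True (cons True R)) (cons a (cons b β)) (cons x (cons y Δ))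
      (t.ren id swapRen) := by
  refine h.ren fun k _ => ?_
  rcases k with _ | _ | k <;> exact ⟨rfl, id, rfl⟩

theorem Tree.erase {t : Tm} {x : Ty × Ty} {a : Bool}
    (h : Tree Ax (Comm τ Γ A) (cons True R) (cons a β) (cons x Δ) t) (h0 : ¬ HasChan 0 t) :
    Tree Ax (Comm τ Γ A) R β Δ (t.ren id Nat.pred) := by
  refine h.ren fun k hk => ?_
  cases k with
  | zero => exact (h0 hk).elim
  | succ k => exact ⟨rfl, id, rfl⟩

/-- The side reduction strategy in finitely many steps. -/
abbrev SideReduces (α : ℕ → Bool) : Tm → Tm → Prop := Reduces SideRule α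

/-- `t` reduces by the side reduction strategy to a tree without active sessions. -/
def Communicates (Ax : Finset DisjAxiom) (τ : ℕ) (Γ : ℕ → Ty) (A : Ty) (R : ℕ → Prop)
    (β : ℕ → Bool) (Δ : ℕ → Ty × Ty) (t : Tm) : Prop :=
  ∃ t', SideReduces β t t' ∧ Tree Ax (Comm τ Γ A) R β Δ t' ∧ NoActive t'

theorem Communicates.head {t u : Tm} (h : SideReduces β t u)
    (hu : Communicates Ax τ Γ A R β Δ u) : Communicates Ax τ Γ A R β Δ t := by
  obtain ⟨t', h1, h2⟩ := hu
  exact ⟨t', h.trans h1, h2⟩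

theorem Communicates.par {u v : Tm} (hu : Communicates Ax τ Γ A R β Δ u)
    (hv : Communicates Ax τ Γ A R β Δ v) : Communicates Ax τ Γ A R β Δ (.par u v) := by
  obtain ⟨u', h1, h2, h3⟩ := hu
  obtain ⟨v', h1', h2', h3'⟩ := hv
  exact ⟨_, h1.par h1', .par h2 h2', h3, h3'⟩

theorem Communicates.ses {ax : DisjAxiom} {s : ℕ → Ty} {us : Fin ax.m → Tm} (hax : ax ∈ Ax)
    (h : ∀ i, Communicates Ax τ Γ A (cons True R) (cons false β)
      (cons (ax.dom s i, ax.cod s i) Δ) (us i)) :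
    Communicates Ax τ Γ A R β Δ (.ses ax s false us) := by
  choose us' h1 h2 h3 using h
  exact ⟨_, Reduces.ses _ h1, .ses hax h2, rfl, h3⟩

/-- Induction on the total number of occurrences of the active channel. If some process has none, it
alone is kept; otherwise all processes communicate, giving an inactive session of active sessions
with smaller totals. That the channel can simply disappear in this way makes the basic cross
reductions dispensable. -/
theorem communicates_simple (hAx : ∀ ax ∈ Ax, ax.Admissible) {ax : DisjAxiom} (hax : ax ∈ Ax)
    (n : ℕ) {R : ℕ → Prop} {β : ℕ → Bool} {Δ : ℕ → Ty × Ty} {s : ℕ → Ty} {us : Fin ax.m → Tm}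
    (hn : ∑ i, chanCount 0 (us i) = n)
    (hus : ∀ i, Comm τ Γ A (cons True R) (cons true β) (cons (ax.dom s i, ax.cod s i) Δ) (us i)) :
    Communicates Ax τ Γ A R β Δ (.ses ax s true us) := by
  induction n using Nat.strong_induction_on generalizing R β Δ s us with
  | _ n IH =>
  by_cases h : ∃ j, ¬ HasChan 0 (us j)
  · obtain ⟨j, hj⟩ := h
    exact ⟨(us j).ren id Nat.pred,
      .root (.erase (fun i => (hus i).simple.noActive) (.erase ax s true us [j] (by simp) (by simp)
        (by simpa using hj))), (Tree.leaf (hus j)).erase hj, (hus j).simple.noActive.ren _ _⟩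
  · push Not at h
    choose K t hsend using fun i => exists_rightmostSend (hus i).simple (h i)
    obtain ⟨us', h1, h2, h3⟩ := exists_crossResult (hAx ax hax) hus hsend β
    have hT : Tree Ax (Comm τ Γ A) R β Δ
        (.ses ax (crossAssign ax s K t) false fun i => .ses ax s true (us' i)) :=
      .ses hax fun i => .ses hax fun k => .leaf (h2 i k)
    refine .head (.root (.cross (.cross ax s us K t hsend) ⟨h1, fun _ =>
      hT.not_structStep fun h => ⟨_, _, _, h⟩⟩)) ?_
    exact .ses hax fun i => IH _ (hn ▸ h3 i) rfl (h2 i)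

/-- The number of parallel operators above the leaves of a parallel form. -/
def nodeCount : Tm → ℕ
  | .par u v => nodeCount u + nodeCount v + 1
  | .ses _ _ _ us => ∑ i, nodeCount (us i) + 1
  | _ => 0

theorem nodeCount_ren (t : Tm) (r c : ℕ → ℕ) : nodeCount (t.ren r c) = nodeCount t := by
  induction t generalizing r c with
  | par u v hu hv => simp [Tm.ren, nodeCount, hu, hv]
  | ses ax s act us ih => simp [Tm.ren, nodeCount, ih]
  | _ => rfl

/-- Induction on the number of parallel operators inside the processes. Moving one of them out of
the active session copies the session, but each copy contains only a proper part of the process it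
came from. -/
theorem communicates_ses (hAx : ∀ ax ∈ Ax, ax.Admissible) {ax : DisjAxiom} (hax : ax ∈ Ax)
    (n : ℕ) {R : ℕ → Prop} {β : ℕ → Bool} {Δ : ℕ → Ty × Ty} {s : ℕ → Ty} {us : Fin ax.m → Tm}
    (hn : ∑ i, nodeCount (us i) = n)
    (hus : ∀ i, Tree Ax (Comm τ Γ A) (cons True R) (cons true β)
      (cons (ax.dom s i, ax.cod s i) Δ) (us i)) (hna : ∀ i, NoActive (us i)) :
    Communicates Ax τ Γ A R β Δ (.ses ax s true us) := by
  induction n using Nat.strong_induction_on generalizing R β Δ s us with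
  | _ n IH =>
  by_cases h : ∀ i,
      Comm τ Γ A (cons True R) (cons true β) (cons (ax.dom s i, ax.cod s i) Δ) (us i)
  · exact communicates_simple hAx hax _ rfl h
  · push Not at h
    obtain ⟨i, hi⟩ := h
    have ht := hus i
    generalize hu : us i = u at ht
    cases ht with
    | leaf h => exact (hi (hu ▸ h)).elim
    | @par _ _ _ v w hv hw =>
      have hvw := hna i
      rw [hu] at hvw
      have upd : ∀ x, Tree Ax (Comm τ Γ A) (cons True R) (cons true β)
          (cons (ax.dom s i, ax.cod s i) Δ) x → NoActive x → nodeCount x < nodeCount (us i) →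
          Communicates Ax τ Γ A R β Δ (.ses ax s true (Function.update us i x)) := by
        intro x hx hx' hlt
        refine IH _ (hn ▸ Finset.sum_lt_sum (fun l _ => ?_)
          ⟨i, Finset.mem_univ i, by simpa using hlt⟩) rfl (fun l => ?_) (fun l => ?_)
        all_goals
          by_cases hl : l = i
          · subst hl; simp only [Function.update_self]; first | exact hlt.le | exact hx | exact hx'
          · simp only [Function.update_of_ne hl]; first | exact le_rfl | exact hus l | exact hna l
      refine .head (.root (.scope (.par ax s us i v w hu hna))) (.par ?_ ?_)
      · exact upd v hv hvw.1 (by rw [hu, nodeCount]; omega)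
      · exact upd w hw hvw.2 (by rw [hu, nodeCount]; omega)
    | @ses _ _ _ ax' s' act' ws hax' hws =>
      have hw := hna i
      rw [hu] at hw
      -- The inner session is inactive, as the processes contain no active session; it therefore
      -- becomes a harmless outer session.
      obtain ⟨rfl, hw⟩ := hw
      refine .head (.root (.scope (.ses ax s us i ax' s' false ws hu hna))) (.ses hax' fun k => ?_)
      have hk : nodeCount (ws k) < nodeCount (us i) := by
        rw [hu, nodeCount]
        exact Nat.lt_succ_of_le (Finset.single_le_sum (f := fun k => nodeCount (ws k))
          (fun _ _ => Nat.zero_le _) (Finset.mem_univ k))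
      refine IH _ (hn ▸ Finset.sum_lt_sum (fun l _ => ?_)
        ⟨i, Finset.mem_univ i, by simpa [nodeCount_ren] using hk⟩) rfl (fun l => ?_) (fun l => ?_)
      · split
        · next h => subst h; exact (hws k).swap
        · exact (hus l).lift
      · split
        · exact (hw k).ren _ _
        · exact (hna l).ren _ _
      · split
        · next h => subst h; rw [nodeCount_ren]; exact hk.le
        · rw [nodeCount_ren]

/-- Active sessions are eliminated from the inside out, so that the processes of the session treated
contain no active session, as the side strategy requires. -/
theorem Tree.communicates (hAx : ∀ ax ∈ Ax, ax.Admissible) {t : Tm}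
    (h : Tree Ax (Comm τ Γ A) R β Δ t) : Communicates Ax τ Γ A R β Δ t := by
  induction h with
  | leaf h => exact ⟨_, .refl, .leaf h, (Comm.simple h).noActive⟩
  | par _ _ ih ih' => exact ih.par ih'
  | @ses _ _ _ ax s act us h _ ih =>
    cases act with
    | false => exact .ses h ih
    | true =>
      choose us' h1 h2 h3 using ih
      exact .head (Reduces.ses _ h1) (communicates_ses hAx h _ rfl h2 h3)

/-! ### Removal of sessions with an idle process -/

/-- The channel of every session occurs in all its processes. -/
def Clean : Tm → Prop
  | .par u v => Clean u ∧ Clean v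
  | .ses _ _ _ us => ∀ i, HasChan 0 (us i) ∧ Clean (us i)
  | _ => True

theorem Clean.ren {t : Tm} (h : Clean t) (r c : ℕ → ℕ) : Clean (t.ren r c) := by
  induction t generalizing r c with
  | par u v hu hv => exact ⟨hu h.1 _ _, hv h.2 _ _⟩
  | ses ax s act us ih =>
    exact fun i => ⟨(h i).1.ren r (liftRen c), ih i (h i).2 _ _⟩
  | _ => trivial

theorem Simple.clean {t : Tm} (h : Simple t) : Clean t := by
  cases t <;> trivial

/-- Working from the inside, an idle process replaces its whole session. Every session that survives
uses its channel in all processes, so no erasing reduction remains. -/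
theorem Tree.exists_clean {t : Tm} (h : Tree Ax (Comm τ Γ A) R β Δ t) (ht : NoActive t) :
    ∃ t', SideReduces β t t' ∧ Tree Ax (Comm τ Γ A) R β Δ t' ∧ NoActive t' ∧ Clean t' := by
  induction h with
  | leaf h => exact ⟨_, .refl, .leaf h, ht, (Comm.simple h).clean⟩
  | par _ _ ih ih' =>
    obtain ⟨u, h1, h2, h3, h4⟩ := ih ht.1
    obtain ⟨v, h1', h2', h3', h4'⟩ := ih' ht.2
    exact ⟨_, h1.par h1', .par h2 h2', ⟨h3, h3'⟩, h4, h4'⟩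
  | @ses _ _ _ ax s act us h _ ih =>
    obtain ⟨rfl, ht⟩ := ht
    choose us' h1 h2 h3 h4 using fun i => ih i (ht i)
    by_cases hc : ∃ j, ¬ HasChan 0 (us' j)
    · obtain ⟨j, hj⟩ := hc
      exact ⟨(us' j).ren id Nat.pred, (Reduces.ses _ h1).trans
        (Reduces.root (.erase h3 (.erase ax s false us' [j] (by simp) (by simp) (by simpa using hj)))),
        (h2 j).erase hj, (h3 j).ren _ _, (h4 j).ren _ _⟩
    · push Not at hc
      exact ⟨_, Reduces.ses _ h1, .ses h h2, ⟨rfl, h3⟩, fun i => ⟨hc i, h4 i⟩⟩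

theorem not_eraseRule_of_clean {t t' : Tm} (h : Clean t) : ¬ EraseRule t t' := by
  rintro ⟨ax, s, act, us, l, hl, -, h'⟩
  obtain ⟨j, hj⟩ := List.exists_mem_of_ne_nil l hl
  exact h' j hj (h j).1

theorem not_scopeRule_of_noActive {t t' : Tm} (h : NoActive t) : ¬ ScopeRule t t' := by
  rintro (_ | _) <;> exact Bool.noConfusion h.1

theorem not_crossRule_of_noActive {t t' : Tm} (h : NoActive t) : ¬ CrossRule t t' := by
  rintro ⟨⟩
  exact Bool.noConfusion h.1

theorem not_sideRule {t t' : Tm} (h : NoActive t) (hc : Clean t) : ¬ SideRule α t t' := by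
  rintro (h' | ⟨h', _⟩ | ⟨_, h'⟩)
  · exact not_scopeRule_of_noActive h h'
  · exact not_crossRule_of_noActive h h'
  · exact not_eraseRule_of_clean hc h'

theorem Tree.not_sideStep {t t' : Tm} (h : Tree Ax (Comm τ Γ A) R β Δ t) (ht : NoActive t)
    (hc : Clean t) : ¬ Inside SideRule α t t' := by
  intro hs
  induction hs generalizing R β Δ with
  | root h' => exact not_sideRule ht hc h'
  | frame F h' _ =>
    refine (Inside.frame F h').eq_of_simple (Comm.simple h.leaf_inv) fun _ _ _ h hs => ?_
    exact not_sideRule hs.noActive hs.clean h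
  | parL u _ ih => exact ih (h.par_inv Comm.simple).1 ht.1 hc.1
  | parR u _ ih => exact ih (h.par_inv Comm.simple).2 ht.2 hc.2
  | ses ax s act us i _ ih => exact ih ((h.ses_inv Comm.simple).2 i) (ht.2 i) (hc i).2

end


section

variable {τ M N : ℕ} {R R' : ℕ → Prop} {β β' : ℕ → Bool} {Δ Δ' : ℕ → Ty × Ty} {Γ Γ' : ℕ → Ty}
  {α : ℕ → Bool} {Ax : Finset DisjAxiom} {A : Ty}

/-! ### Reaching parallel form -/

theorem HasType.ren {t : Tm} {r c : ℕ → ℕ} (ht : HasType Ax Γ Δ t A) (hr : ∀ n, Γ' (r n) = Γ n)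
    (hc : ∀ k, Δ' (c k) = Δ k) : HasType Ax Γ' Δ' (t.ren r c) A := by
  induction ht generalizing Γ' Δ' r c with
  | var Γ Δ n => rw [← hr n]; exact .var _ _ _
  | tt => exact .tt _ _
  | lam _ ih => exact .lam (ih (cons_liftRen hr _) hc)
  | app _ _ ih ih' => exact .app (ih hr hc) (ih' hr hc)
  | pair _ _ ih ih' => exact .pair (ih hr hc) (ih' hr hc)
  | fst _ ih => exact .fst (ih hr hc)
  | snd _ ih => exact .snd (ih hr hc)
  | inl _ ih => exact .inl (ih hr hc)
  | inr _ ih => exact .inr (ih hr hc)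
  | case _ _ _ ih ih' ih'' =>
    exact .case (ih hr hc) (ih' (cons_liftRen hr _) hc) (ih'' (cons_liftRen hr _) hc)
  | efq h _ ih => exact .efq h (ih hr hc)
  | chan k _ ih =>
    rw [← hc k] at ih ⊢
    exact .chan _ (ih hr hc)
  | par _ _ ih ih' => exact .par (ih hr hc) (ih' hr hc)
  | ses h _ ih => exact .ses h fun i => ih i hr (cons_liftRen hc _)

/-- Parallel operator permutations in finitely many steps. -/
abbrev PermReduces (α : ℕ → Bool) : Tm → Tm → Prop := Reduces (fun _ => PermRule) α

/-- `t : A` reduces by permutations to a parallel form of the same type. -/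
def ToParallel (Ax : Finset DisjAxiom) (α : ℕ → Bool) (Γ : ℕ → Ty) (Δ : ℕ → Ty × Ty) (t : Tm)
    (A : Ty) : Prop :=
  ∃ t', PermReduces α t t' ∧ ParallelForm t' ∧ HasType Ax Γ Δ t' A

theorem ToParallel.head {t u : Tm} (h : PermReduces α t u) (hu : ToParallel Ax α Γ Δ u A) :
    ToParallel Ax α Γ Δ t A := by
  obtain ⟨t', h1, h2⟩ := hu
  exact ⟨t', h.trans h1, h2⟩

theorem Simple.ren {t : Tm} (h : Simple t) (r c : ℕ → ℕ) : Simple (t.ren r c) := by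
  induction t generalizing r with
  | par => exact h.elim
  | ses => exact h.elim
  | _ => simp_all [Simple, Tm.ren]

theorem ParallelForm.ren {t : Tm} (h : ParallelForm t) (r c : ℕ → ℕ) :
    ParallelForm (t.ren r c) := by
  induction h generalizing r c with
  | simple h => exact .simple (h.ren r c)
  | par _ _ ih ih' => exact .par (ih r c) (ih' r c)
  | ses _ ih => exact .ses fun i => ih i r (liftRen c)

/-- Induction on the parallel form in the hole: each parallel operator is moved in front of the
frame until simply typed terms are reached, where `hS` takes over. The frame is shifted under every
session passed, so the invariant `P` on frames must be stable under the shift. -/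
theorem toParallel_plug {P : (ℕ → Ty × Ty) → Frame → Prop} {B C : Ty}
    (hP : ∀ {Δ F} x, P Δ F → P (cons x Δ) (F.renChan Nat.succ))
    (hS : ∀ {α Δ F u}, P Δ F → Simple u → HasType Ax Γ' Δ u B → ToParallel Ax α Γ Δ (F.plug u) C)
    {F : Frame} {t : Tm} (ht : ParallelForm t) (hF : P Δ F) (hB : HasType Ax Γ' Δ t B) :
    ToParallel Ax α Γ Δ (F.plug t) C := by
  induction ht generalizing Δ F α with
  | simple h => exact hS hF h hB
  | @par u v _ _ ih ih' =>
    cases hB with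
    | par hu hv =>
      obtain ⟨u', u1, u2, u3⟩ := ih hF hu (α := α)
      obtain ⟨v', v1, v2, v3⟩ := ih' hF hv (α := α)
      exact .head (.root (.par F u v)) ⟨_, u1.par v1, .par u2 v2, .par u3 v3⟩
  | @ses ax s act us _ ih =>
    cases hB with
    | ses hax hus =>
      choose us' h1 h2 h3 using fun i => ih i (hP _ hF) (hus i) (α := cons act α)
      exact .head (.root (.ses F ax s act us)) ⟨_, Reduces.ses _ h1, .ses h2, .ses hax h3⟩

theorem toParallel_plug_const {F : Frame} {B C : Ty} (hren : F.renChan Nat.succ = F)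
    (hS : ∀ {Δ u}, Simple u → HasType Ax Γ' Δ u B →
      Simple (F.plug u) ∧ HasType Ax Γ Δ (F.plug u) C)
    {t : Tm} (ht : ToParallel Ax α Γ' Δ t B) : ToParallel Ax α Γ Δ (F.plug t) C := by
  obtain ⟨t', h1, h2, h3⟩ := ht
  refine .head (h1.frame F) (toParallel_plug (P := fun _ F' => F' = F) ?_ ?_ h2 rfl h3)
  · rintro _ _ _ rfl
    exact hren
  · rintro _ _ _ u rfl hu hB
    exact ⟨_, .refl, .simple (hS hu hB).1, (hS hu hB).2⟩

theorem HasType.shift {t : Tm} (x : Ty × Ty) (ht : HasType Ax Γ Δ t A) :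
    HasType Ax Γ (cons x Δ) (t.ren id Nat.succ) A :=
  ht.ren (fun _ => rfl) fun _ => rfl

/-- For constructors with two arguments, the parallel operators of the left one are moved out first.
At each simply typed leaf of the left argument the same is then done for the right one. -/
theorem toParallel_plug_right {FL FR : Tm → Frame} {B C D : Ty}
    (hLR : ∀ t u, (FL u).plug t = (FR t).plug u)
    (hL : ∀ u, (FL u).renChan Nat.succ = FL (u.ren id Nat.succ))
    (hR : ∀ u, (FR u).renChan Nat.succ = FR (u.ren id Nat.succ))
    (hS : ∀ {Δ t u}, Simple t → HasType Ax Γ Δ t B → Simple u → HasType Ax Γ Δ u C →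
      Simple ((FR t).plug u) ∧ HasType Ax Γ Δ ((FR t).plug u) D)
    {t u : Tm} (ht : ToParallel Ax α Γ Δ t B) (hu : ToParallel Ax α Γ Δ u C) :
    ToParallel Ax α Γ Δ ((FL u).plug t) D := by
  obtain ⟨t', t1, t2, t3⟩ := ht
  obtain ⟨u', u1, u2, u3⟩ := hu
  have step : PermReduces α ((FL u).plug t') ((FL u').plug t') := by
    rw [hLR, hLR]
    exact u1.frame _
  refine .head ((t1.frame _).trans step) ?_
  refine toParallel_plug (P := fun Δ F => ∃ u, F = FL u ∧ ParallelForm u ∧ HasType Ax Γ Δ u C)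
    ?_ ?_ t2 ⟨u', rfl, u2, u3⟩ t3
  · rintro _ _ x ⟨u, rfl, h1, h2⟩
    exact ⟨_, hL u, h1.ren _ _, h2.shift x⟩
  · rintro α Δ _ t ⟨u, rfl, h1, h2⟩ ht hB
    rw [hLR]
    refine toParallel_plug (P := fun Δ F => ∃ t, F = FR t ∧ Simple t ∧ HasType Ax Γ Δ t B)
      ?_ ?_ h1 ⟨t, rfl, ht, hB⟩ h2
    · rintro _ _ x ⟨u, rfl, h1, h2⟩
      exact ⟨_, hR u, h1.ren _ _, h2.shift x⟩
    · rintro α Δ _ u ⟨t, rfl, ht, hB⟩ hu hC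
      exact ⟨_, .refl, .simple (hS ht hB hu hC).1, (hS ht hB hu hC).2⟩

/-- The same in three stages: scrutinee, left branch, right branch. The branches lie under a binder
but the channel permutations are not affected by it. -/
theorem toParallel_case {B C D : Ty} {t u v : Tm} (ht : ToParallel Ax α Γ Δ t (.or B C))
    (hu : ToParallel Ax α (cons B Γ) Δ u D) (hv : ToParallel Ax α (cons C Γ) Δ v D) :
    ToParallel Ax α Γ Δ (.case B C t u v) D := by
  have hren : ∀ {Γ E Δ w} x, HasType Ax (cons E Γ) Δ w D →
      HasType Ax (cons E Γ) (cons x Δ) (w.ren (liftRen id) Nat.succ) D := fun x h =>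
    h.ren (cons_liftRen (fun _ => rfl) _) fun _ => rfl
  obtain ⟨t', t1, t2, t3⟩ := ht
  obtain ⟨u', u1, u2, u3⟩ := hu
  obtain ⟨v', v1, v2, v3⟩ := hv
  refine .head (Reduces.case _ _ t1 u1 v1) ?_
  refine toParallel_plug (F := .elim (.case B C u' v')) (P := fun Δ F => ∃ u v,
    F = .elim (.case B C u v) ∧ (ParallelForm u ∧ HasType Ax (cons B Γ) Δ u D) ∧
      ParallelForm v ∧ HasType Ax (cons C Γ) Δ v D)
    ?_ ?_ t2 ⟨u', v', rfl, ⟨u2, u3⟩, v2, v3⟩ t3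
  · rintro _ _ x ⟨u, v, rfl, ⟨h1, h2⟩, h3, h4⟩
    exact ⟨_, _, rfl, ⟨h1.ren _ _, hren x h2⟩, h3.ren _ _, hren x h4⟩
  rintro α Δ _ t ⟨u, v, rfl, ⟨h1, h2⟩, h3, h4⟩ ht hB
  refine toParallel_plug (F := .caseL B C t v) (P := fun Δ F => ∃ t v,
    F = .caseL B C t v ∧ (Simple t ∧ HasType Ax Γ Δ t (.or B C)) ∧
      ParallelForm v ∧ HasType Ax (cons C Γ) Δ v D) (B := D)
    ?_ ?_ h1 ⟨t, v, rfl, ⟨ht, hB⟩, h3, h4⟩ h2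
  · rintro _ _ x ⟨t, v, rfl, ⟨h1, h2⟩, h3, h4⟩
    exact ⟨_, _, rfl, ⟨h1.ren _ _, h2.shift x⟩, h3.ren _ _, h4.shift x⟩
  rintro α Δ _ u ⟨t, v, rfl, ⟨h1, h2⟩, h3, h4⟩ hu hD
  refine toParallel_plug (F := .caseR B C t u) (P := fun Δ F => ∃ t u,
    F = .caseR B C t u ∧ (Simple t ∧ HasType Ax Γ Δ t (.or B C)) ∧
      Simple u ∧ HasType Ax (cons B Γ) Δ u D) (B := D)
    ?_ ?_ h3 ⟨t, u, rfl, ⟨h1, h2⟩, hu, hD⟩ h4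
  · rintro _ _ x ⟨t, u, rfl, ⟨h1, h2⟩, h3, h4⟩
    exact ⟨_, _, rfl, ⟨h1.ren _ _, h2.shift x⟩, h3.ren _ _, h4.shift x⟩
  rintro α Δ _ v ⟨t, u, rfl, ⟨h1, h2⟩, h3, h4⟩ hv hD
  exact ⟨_, .refl, .simple ⟨h1, h3, hv⟩, .case h2 h4 hD⟩

theorem HasType.toParallel {t : Tm} (ht : HasType Ax Γ Δ t A) (α : ℕ → Bool) :
    ToParallel Ax α Γ Δ t A := by
  induction ht generalizing α with
  | var => exact ⟨_, .refl, .simple trivial, .var _ _ _⟩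
  | tt => exact ⟨_, .refl, .simple trivial, .tt _ _⟩
  | @lam _ _ A _ _ _ ih =>
    exact toParallel_plug_const (F := .lam A) rfl (fun h h' => ⟨h, .lam h'⟩) (ih α)
  | app _ _ ih ih' =>
    exact toParallel_plug_right (FL := fun u => .elim (.arg u)) (FR := .appR) (fun _ _ => rfl)
      (fun _ => rfl) (fun _ => rfl) (fun h h' k k' => ⟨⟨h, k⟩, .app h' k'⟩) (ih α) (ih' α)
  | pair _ _ ih ih' =>
    exact toParallel_plug_right (FL := .pairL) (FR := .pairR) (fun _ _ => rfl)
      (fun _ => rfl) (fun _ => rfl) (fun h h' k k' => ⟨⟨h, k⟩, .pair h' k'⟩) (ih α) (ih' α)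
  | fst _ ih =>
    exact toParallel_plug_const (F := .elim (.proj false)) rfl (fun h h' => ⟨h, .fst h'⟩) (ih α)
  | snd _ ih =>
    exact toParallel_plug_const (F := .elim (.proj true)) rfl (fun h h' => ⟨h, .snd h'⟩) (ih α)
  | inl _ ih =>
    exact toParallel_plug_const (F := .inj false _) rfl (fun h h' => ⟨h, .inl h'⟩) (ih α)
  | inr _ ih =>
    exact toParallel_plug_const (F := .inj true _) rfl (fun h h' => ⟨h, .inr h'⟩) (ih α)
  | case _ _ _ ih ih' ih'' => exact toParallel_case (ih α) (ih' α) (ih'' α)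
  | efq hP _ ih =>
    exact toParallel_plug_const (F := .elim (.efq _)) rfl (fun h h' => ⟨h, .efq hP h'⟩) (ih α)
  | @chan Γ Δ t k _ ih =>
    obtain ⟨t', t1, t2, t3⟩ := ih α
    -- The index of the channel grows by one under each session, so the invariant records only that
    -- its type is unchanged.
    refine .head (t1.chan k) (toParallel_plug (F := .chan k)
      (P := fun Δ' F => ∃ l, F = .chan l ∧ Δ' l = Δ k) ?_ ?_ t2 ⟨k, rfl, rfl⟩ t3)
    · rintro _ _ x ⟨l, rfl, h⟩
      exact ⟨l + 1, rfl, h⟩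
    · rintro _ Δ' _ u ⟨l, rfl, h⟩ hu hB
      refine ⟨_, .refl, .simple hu, ?_⟩
      rw [← h] at hB ⊢
      exact .chan l hB
  | par _ _ ih ih' =>
    obtain ⟨u, u1, u2, u3⟩ := ih α
    obtain ⟨v, v1, v2, v3⟩ := ih' α
    exact ⟨_, u1.par v1, .par u2 v2, .par u3 v3⟩
  | @ses _ _ _ _ _ act _ h _ ih =>
    choose us' h1 h2 h3 using fun i => ih i (cons act α)
    exact ⟨_, Reduces.ses _ h1, .ses h2, .ses h h3⟩

/-! ### The master reduction strategy -/

theorem SideRule.steps {t t' : Tm} (h : SideRule α t t') : Steps α t t' := by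
  rcases h with h | ⟨h, h'⟩ | ⟨_, h⟩
  · exact .single (.root (.inr (.inl (.scope h))))
  · exact .head (.root (.inr (.inr (.inr (.inr (.inr h))))))
      (Reduces.imp h'.1 fun _ _ _ h => .root (.inl (.inr h)))
  · exact .single (.root (.inr (.inr (.inr (.inr (.inl h))))))

theorem Round.steps {t t' : Tm} (h : Round α t t') : Steps α t t' := by
  obtain ⟨u, v, h1, h2, h3, -⟩ := h
  refine Relation.ReflTransGen.trans (Reduces.imp h1.1 fun _ _ _ h => .root (.inl h)) ?_
  exact (Reduces.imp h2.1 fun _ _ _ h => .root (.inr (.inr (.inl h)))).trans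
    (Reduces.imp h3.1 fun _ _ _ h => h.steps)

theorem Master.steps {t t' : Tm} (h : Master α t t') : Steps α t t' := by
  obtain ⟨u, h1, -, h2⟩ := h
  refine Relation.ReflTransGen.trans (Reduces.imp h1 fun _ _ _ h => .root (.inr (.inl h))) ?_
  induction h2 with
  | refl => exact .refl
  | tail _ h ih => exact ih.trans h.steps

/-- The result of a round whose logical redexes have rank at most `τ`. -/
structure RoundForm (Ax : Finset DisjAxiom) (τ : ℕ) (Γ : ℕ → Ty) (A : Ty) (α : ℕ → Bool)
    (Δ : ℕ → Ty × Ty) (t : Tm) : Prop where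
  tree : Tree Ax (Comm τ Γ A) (fun _ => False) α Δ t
  noActive : NoActive t
  clean : Clean t

/-- The bound `τ` on messages after the intuitionistic phase becomes the bound on logical redexes
after the round, because communication turns values in messages into redexes. -/
theorem exists_round (hAx : ∀ ax ∈ Ax, ax.Admissible) {t u : Tm}
    (h : Exhaust (Inside (fun _ => IntRule) α) t u)
    (hu : Tree Ax (fun R _ Δ t => NF τ R Δ Γ t A) (fun _ => False) α Δ u) :
    ∃ t', Round α t t' ∧ RoundForm Ax τ Γ A α Δ t' := by
  obtain ⟨v, v1, v2⟩ := hu.exists_activated fun _ => id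
  obtain ⟨w, w1, w2, w3⟩ := v2.communicates hAx
  obtain ⟨t', h1, h2, h3, h4⟩ := w2.exists_clean w3
  exact ⟨t', ⟨u, v, h, v1, ⟨w1.trans h1, fun _ => h2.not_sideStep h3 h4⟩, h3⟩, h2, h3, h4⟩

/-! ### Normality at bound zero -/

theorem Tame.not_activable {k : ℕ} {t : Tm} (h : Tame τ M R β Δ Γ t A) (hR : R k) (hβ : β k = false) :
    ¬ Activable β k t := by
  induction t generalizing Γ A with
  | var n => exact id
  | tt => exact id
  | lam B u hu => obtain ⟨C, rfl, h⟩ := h; exact hu h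
  | app t u iht ihu => obtain ⟨B, h1, h2, h3⟩ := h; exact fun h => h.elim (iht h1) (ihu h3)
  | pair t u iht ihu => obtain ⟨B, C, rfl, h1, h3⟩ := h; exact fun h => h.elim (iht h1) (ihu h3)
  | proj i u hu => cases i <;> obtain ⟨B, h1, h2⟩ := h <;> exact hu h1
  | inj i C u hu => cases i <;> obtain ⟨B, rfl, h1⟩ := h <;> exact hu h1
  | case A B t u v iht ihu ihv =>
    obtain ⟨h1, h2, h3, h4⟩ := h
    exact fun h => h.elim (iht h1) fun h => h.elim (ihu h3) (ihv h4)
  | efq P u hu => exact hu h.2.2.1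
  | chan l u hu =>
    obtain ⟨h1, h2, h3⟩ := h
    rintro (⟨rfl, hv⟩ | hv)
    · exact (h3 hR).2 hβ hv
    · exact hu h2 hv
  | par => exact h.elim
  | ses => exact h.elim

theorem Tree.not_activable {k : ℕ} {t : Tm} (h : Tree Ax (Comm τ Γ A) R β Δ t) (hR : R k)
    (hβ : β k = false) : ¬ Activable β k t := by
  induction h generalizing k with
  | leaf h => exact Tame.not_activable h hR hβ
  | par _ _ ih ih' => exact fun h => h.elim (ih hR hβ) (ih' hR hβ)
  | ses _ _ ih => exact fun ⟨i, h⟩ => ih i (k := k + 1) hR hβ h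

theorem not_intRule_par {u v t' : Tm} : ¬ IntRule (.par u v) t' := by
  rintro (h | h)
  · cases h
  · exact not_structRule_par h

theorem not_intRule_ses {ax s act us t'} : ¬ IntRule (.ses ax s act us) t' := by
  rintro (h | h)
  · cases h
  · exact not_structRule_ses h

theorem Tree.not_permRule {t t' : Tm} (h : Tree Ax (Comm τ Γ A) R β Δ t) (ht : NoActive t) :
    ¬ PermRule t t' := by
  rintro (⟨F⟩ | ⟨F⟩ | h')
  · obtain ⟨B, hB⟩ := Tame.of_frame h.leaf_inv
    exact hB
  · obtain ⟨B, hB⟩ := Tame.of_frame h.leaf_inv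
    exact hB
  · exact not_scopeRule_of_noActive ht h'

theorem Tame.not_rule {t t' : Tm} (h : Tame 0 M R β Δ Γ t A) : ¬ Rule α t t' := by
  rintro (h' | (⟨F⟩ | ⟨F⟩ | ⟨⟨⟩⟩) | ⟨⟨⟩⟩ | ⟨⟨⟩⟩ | ⟨⟨⟩⟩ | ⟨⟨⟩⟩)
  · exact h'.elim h.not_logicalRule h.not_structRule
  · exact h.of_frame.elim fun _ h => h
  · exact h.of_frame.elim fun _ h => h
  all_goals exact h

/-- Each part of the invariant excludes some rules: the bound zero the intuitionistic ones, the
absence of values on inactive channels activation, `NoActive` the scope permutations and both cross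
reductions with messages, and `Clean` erasure. -/
theorem Tree.not_rule {t t' : Tm} (h : Tree Ax (Comm 0 Γ A) R β Δ t) (ht : NoActive t)
    (hc : Clean t) : ¬ Rule β t t' := by
  rintro (h' | h' | h' | h' | h' | h')
  · cases h with
    | leaf h => exact h'.elim (Tame.not_logicalRule h) (Tame.not_structRule h)
    | par => exact not_intRule_par h'
    | ses => exact not_intRule_ses h'
  · exact h.not_permRule ht h'
  · obtain ⟨ax, s, us, ⟨i, hi⟩⟩ := h'
    exact ((h.ses_inv Comm.simple).2 i).not_activable (k := 0) trivial rfl hi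
  · obtain ⟨⟩ := h'
    exact Bool.noConfusion ht.1
  · exact not_eraseRule_of_clean hc h'
  · exact not_crossRule_of_noActive ht h'

theorem Tree.normal {t : Tm} (h : Tree Ax (Comm 0 Γ A) R β Δ t) (ht : NoActive t) (hc : Clean t) :
    Normal β t := by
  intro t' hs
  induction hs generalizing R Δ with
  | root h' => exact h.not_rule ht hc h'
  | frame F h' _ => exact Tame.not_inside h.leaf_inv (fun h => h.not_rule) (.frame F h')
  | parL u _ ih => exact ih (h.par_inv Comm.simple).1 ht.1 hc.1
  | parR u _ ih => exact ih (h.par_inv Comm.simple).2 ht.2 hc.2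
  | ses ax s act us i _ ih => exact ih ((h.ses_inv Comm.simple).2 i) (ht.2 i) (hc i).2

/-- Since no session is active after a round, the rank drop applies and the next round ends one
bound lower. So `τ` further rounds suffice. -/
theorem RoundForm.exists_normal (hAx : ∀ ax ∈ Ax, ax.Admissible) {t : Tm}
    (h : RoundForm Ax τ Γ A α Δ t) :
    ∃ t', Relation.ReflTransGen (Round α) t t' ∧ RoundForm Ax 0 Γ A α Δ t' := by
  induction τ generalizing t with
  | zero => exact ⟨t, .refl, h⟩
  | succ τ ih =>
    obtain ⟨u, h1, h2⟩ := h.tree.exists_nf h.noActive fun _ h => h.elim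
    obtain ⟨t', h3, h4⟩ := exists_round hAx h1 h2
    obtain ⟨t'', h5, h6⟩ := ih h4
    exact ⟨t'', .head h3 h5, h6⟩

end

end LamAx

theorem mainTheorem1 (Ax : Finset LamAx.DisjAxiom) (hAx : ∀ ax ∈ Ax, ax.Admissible)
    (α : ℕ → Bool) (Γ : ℕ → LamAx.Ty) (Δ : ℕ → LamAx.Ty × LamAx.Ty) (t : LamAx.Tm) (A : LamAx.Ty)
    (ht : LamAx.HasType Ax Γ Δ t A) :
    ∃ t' : LamAx.Tm, LamAx.Master α t t' ∧ LamAx.Steps α t t' ∧ LamAx.HasType Ax Γ Δ t' A ∧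
      LamAx.ParallelForm t' ∧ LamAx.Normal α t' := by
  obtain ⟨u, u1, u2, u3⟩ := ht.toParallel α
  -- No channel is bound above the whole term, so `R` starts empty. The number `M` found here is the
  -- initial rank bound.
  obtain ⟨M, v, v1, v2⟩ := u2.exists_nf u3 (β := α) (R := fun _ => False)
  obtain ⟨w, w1, w2⟩ := LamAx.exists_round hAx v1 v2
  obtain ⟨t', h1, h2⟩ := w2.exists_normal hAx
  have hM : LamAx.Master α t t' := ⟨u, u1, u2, .head w1 h1⟩
  exact ⟨t', hM, hM.steps, h2.tree.hasType fun h => LamAx.Tame.hasType Ax h,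
    h2.tree.parallelForm LamAx.Comm.simple, h2.tree.normal h2.noActive h2.clean⟩
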